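/- Let $d\ge 3$, $p,q\in[1,\infty]$, $1/p+1/p^*=1$ (with $1/\infty=0$), $a\wedge b=\min(a,b)$, and let $R,L>0$, $\sigma\ge 0$. Let $\Theta\subset\mathbb R^d$ be compact and convex, and let $V:\Theta\to\mathbb R$ be convex, lower semi-continuous and $1$-strongly convex with respect to $\|\cdot\|_p$, that is, $V(x')\ge V(x)+\langle w,x'-x\rangle+\tfrac12\|x-x'\|_p^2$ for all $x,x'\in\Theta$ and $w\in\partial V(x)$, with $\sup_\Theta V-\inf_\Theta V\le R^2$. Let $f_1,f_2,\dots:\mathbb R^d\to\mathbb R$ be fixed convex functions with $|f_t(x)-f_t(x')|\le L\|x-x'\|_q$ for all $x,x'\in\mathbb R^d$. Let $\zeta_1,\zeta_2,\dots$ be independent random vectors, uniformly distributed on the sphere $\{x\in\mathbb R^d:\|x\|_1=1\}$ (normalized surface measure). Let $\xi'_t,\xi''_t$ ($t\ge1$) be real random variables (adversarial noise) with $\mathbb E[(\xi'_t)^2]\le\sigma^2$ and $\mathbb E[(\xi''_t)^2]\le\sigma^2$ such that $(\xi'_t,\xi''_t)_{t\ge1}$ is independent of $(\zeta_t)_{t\ge1}$;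 the noise variables may be dependent and need not be centred. Put $$\mathrm b_q(d)=\frac1{d+1}\cdot\begin{cases}q\,d^{1/q}&\text{if }q\in[1,\log d),\\ e\log d&\text{if }q\ge\log d.\end{cases}$$ Consider the algorithm that starts from $z_1=0$ and, for $t=1,2,\dots$, plays $x_t=\operatorname{argmax}_{x\in\Theta}\{\eta_t\langle z_t,x\rangle-V(x)\}$, observes $y'_t=f_t(x_t+h_t\zeta_t)+\xi'_t$ and $y''_t=f_t(x_t-h_t\zeta_t)+\xi''_t$, computes $g_t=\frac{d}{2h_t}(y'_t-y''_t)\,\mathrm{sign}(\zeta_t)$ (component-wise sign, equal to $1$ at $0$) and sets $z_{t+1}=z_t-g_t$, with the parameters $$\eta_t=\frac{R}{\sqrt{2.75\sum_{k=1}^{t-1}\|g_k\|_{p^*}^2}},\qquad h_t=\Big(6.65\sqrt6\,\frac{R}{\mathrm b_q(d)}\Big)^{1/2}t^{-1/4}d^{\,1-\frac1{2p}},$$ where $\eta_1=1$ and $1/0$ is read as $1$ in $\eta_t$ (so that the parameters do not depend on $L$, $\sigma$ or the horizon $T$). Then, for every $T$ and every $x\in\Theta$, the regret $\sum_{t=1}^T(f_t(x_t)-f_t(x))$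 is integrable and $$\mathbb E\Big[\sum_{t=1}^T\big(f_t(x_t)-f_t(x)\big)\Big]\le110.6\,RL\sqrt{T\,d^{1+\frac{2}{q\wedge2}-\frac2p}}+5.9\sqrt R\,(\sigma+L)\,T^{3/4}\cdot\begin{cases}\sqrt{q\,d^{1+\frac1q-\frac1p}}&\text{if }q\in[1,\log d),\\ \sqrt{e\log(d)\,d^{1-\frac1p}}&\text{if }q\ge\log d.\end{cases}$$ -/

import Mathlib

open MeasureTheory ProbabilityTheory
open scoped ENNReal

noncomputable section

namespace ZeroOrder

/-- The space `ℝ^d`. Its own (Euclidean) metric is only used for the topology, the inner product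
and the surface measure; the `ℓ_p`-norms are given by `ellNorm`. -/
abbrev Vec (d : ℕ) : Type := EuclideanSpace ℝ (Fin d)

/-- The `ℓ_p`-norm of a vector of `ℝ^d`, for `p ∈ [1, ∞]`. -/
def ellNorm {d : ℕ} (p : ℝ≥0∞) (x : Vec d) : ℝ :=
  ‖(WithLp.toLp p (WithLp.ofLp x) : PiLp p fun _ : Fin d => ℝ)‖

/-- The unit sphere of the `ℓ_1`-norm. -/
def l1Sphere (d : ℕ) : Set (Vec d) := {x | ellNorm 1 x = 1}

/-- The surface measure on hypersurfaces of `ℝ^d`: the `(d-1)`-dimensional Hausdorff measure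
of the Euclidean metric. -/
def surfaceMeasure (d : ℕ) : Measure (Vec d) := Measure.hausdorffMeasure ((d : ℝ) - 1)

/-- The component-wise sign, with value `1` at `0`. -/
def signVec {d : ℕ} (x : Vec d) : Vec d :=
  WithLp.toLp 2 fun i => if 0 ≤ x i then 1 else -1

/-- `w` is a subgradient at `x` of `V : Θ → ℝ` (the values of `V` off `Θ` play no role). -/
def IsSubgradientOn {d : ℕ} (Θ : Set (Vec d)) (V : Vec d → ℝ) (x w : Vec d) : Prop :=
  ∀ y ∈ Θ, V x + inner ℝ w (y - x) ≤ V y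

/-- The convex function `V : Θ → ℝ` is `1`-strongly convex with respect to the `ℓ_p`-norm. -/
def IsStronglyConvex {d : ℕ} (p : ℝ≥0∞) (Θ : Set (Vec d)) (V : Vec d → ℝ) : Prop :=
  ConvexOn ℝ Θ V ∧
    ∀ x ∈ Θ, ∀ x' ∈ Θ, ∀ w, IsSubgradientOn Θ V x w →
      V x + inner ℝ w (x' - x) + 1 / 2 * ellNorm p (x - x') ^ 2 ≤ V x'

/-- The quantity `b_q(d)`. -/
def bq (q : ℝ≥0∞) (d : ℕ) : ℝ :=
  1 / ((d : ℝ) + 1) *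
    if q < ENNReal.ofReal (Real.log d) then q.toReal * (d : ℝ) ^ (1 / q).toReal
    else Real.exp 1 * Real.log d

/-! Rounds are numbered from `0`: round `t` below is the round usually numbered `t + 1`. -/

/-- The discretization parameter, proportional to `(t + 1)^(-1/4)`. -/
def discretization (p q : ℝ≥0∞) (d : ℕ) (R : ℝ) (t : ℕ) : ℝ :=
  √(6.65 * √6 * (R / bq q d)) * ((t : ℝ) + 1) ^ (-(1 / 4) : ℝ) *
    (d : ℝ) ^ (1 - (1 / (2 * p)).toReal)

/-- The adaptive step size in round `t`, when `s` is the sum of the squared dual norms of the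
previous gradient estimates; it is `1` in the first round, and `1 / 0` is read as `1`. -/
def stepSize (R : ℝ) (t : ℕ) (s : ℝ) : ℝ :=
  if t = 0 then 1 else R * (if s = 0 then 1 else 1 / √(2.75 * s))

/-- A maximizer over `Θ` of `x ↦ η ⟨z, x⟩ - V x`. -/
def argmaxPoint {d : ℕ} (Θ : Set (Vec d)) (V : Vec d → ℝ) (η : ℝ) (z : Vec d) : Vec d :=
  Classical.epsilon fun x => x ∈ Θ ∧ IsMaxOn (fun y => η * inner ℝ z y - V y) Θ x

/-- The gradient estimate at `x` from the noisy values of `f` at `x + h ζ` and `x - h ζ`. -/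
def gradEstimate {d : ℕ} (f : Vec d → ℝ) (h : ℝ) (x ζ : Vec d) (ξ' ξ'' : ℝ) : Vec d :=
  ((d : ℝ) / (2 * h) * ((f (x + h • ζ) + ξ') - (f (x - h • ζ) + ξ''))) • signVec ζ

section Algorithm

variable {d : ℕ} (p : ℝ≥0∞) (R : ℝ) (h : ℕ → ℝ) (Θ : Set (Vec d)) (V : Vec d → ℝ)
  (f : ℕ → Vec d → ℝ) (ζ : ℕ → Vec d) (ξ' ξ'' : ℕ → ℝ)

/-- The state of the algorithm at the beginning of round `t`, for given realizations of the
random directions and of the noise: the dual vector `z_t`, and the sum of the squared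
`ℓ_{p*}`-norms of the gradient estimates of the previous rounds. -/
def state : ℕ → Vec d × ℝ
  | 0 => (0, 0)
  | t + 1 =>
    let x := argmaxPoint Θ V (stepSize R t (state t).2) (state t).1
    let g := gradEstimate (f t) (h t) x (ζ t) (ξ' t) (ξ'' t)
    ((state t).1 - g, (state t).2 + ellNorm p.conjExponent g ^ 2)

/-- The action `x_t` that the algorithm plays in round `t`. -/
def action (t : ℕ) : Vec d :=
  argmaxPoint Θ V (stepSize R t (state p R h Θ V f ζ ξ' ξ'' t).2)
    (state p R h Θ V f ζ ξ' ξ'' t).1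

/-- The gradient estimate `g_t` that the algorithm computes in round `t`. -/
def gradient (t : ℕ) : Vec d :=
  gradEstimate (f t) (h t) (action p R h Θ V f ζ ξ' ξ'' t) (ζ t) (ξ' t) (ξ'' t)

theorem state_succ_fst (t : ℕ) :
    (state p R h Θ V f ζ ξ' ξ'' (t + 1)).1 =
      (state p R h Θ V f ζ ξ' ξ'' t).1 - gradient p R h Θ V f ζ ξ' ξ'' t := rfl

theorem state_snd (t : ℕ) :
    (state p R h Θ V f ζ ξ' ξ'' t).2 =
      ∑ k ∈ Finset.range t, ellNorm p.conjExponent (gradient p R h Θ V f ζ ξ' ξ'' k) ^ 2 := by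
  induction t with
  | zero => rfl
  | succ t ih =>
    rw [Finset.sum_range_succ, ← ih]
    rfl

end Algorithm

end ZeroOrder

end

/-! The regret splits into a pathwise bound for linear losses, a bound on the bias of the gradient
estimate and a bound on its second moment.

Pathwise, the actions are those of follow-the-regularized-leader fed with the vectors `g t`. Strong
convexity of `V` pays for the movement between consecutive actions, and with the adaptive step size
the remaining cost telescopes, so that `ftrl_regret_le` bounds the linear regret by `6 R` times the
square root of the sum of the squared dual norms. After taking expectations, Jensen's inequality
leaves only second moments.

Bias. The outer normal of the `ℓ_1`-ball is proportional to the sign vector, so by the divergence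
theorem `d E[F(ζ) sign ζ]` is the gradient of the average of `F` over translates of that ball. Only
an inequality is needed: `IsPolar.mul_sphereMean_le` integrates by parts against a Lipschitz cut-off
and bounds the directional derivative of the convex `F` by an increment, so the smoothed function is
never differentiated. Convexity also shows that symmetrized averages around `x_t` are at least
`f_t(x_t)`, while around the comparator they cost at most `L h_t E‖U‖_q`, with `U` uniform in the
ball. The noise need not be centred: `sign ζ_t` has mean zero and `ζ_t` is independent of the action
and the noise of its round (`indepFun_action`).

Second moment. All sign vectors have the same dual norm, so it remains to bound the second moment of
`F(ζ) - F(-ζ)`. The density of a vector with independent Laplace coordinates depends on its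
`ℓ_1`-norm alone; hence the vector is `r ζ` with `r` independent of `ζ` and Gamma distributed. The
product of Laplace laws has a Poincaré inequality with constant `4` (`laplacePi_poincare`: a Hardy
inequality on the half-line, then tensorization). As `r` concentrates near `d`, it transfers to the
sphere in `IsPolar.integral_sq_sub_neg_le`. The same representation turns Laplace moments into the
bound `bq` for `E‖U‖_q`.

Everything that is needed about the surface measure is contained in the polar decomposition
`IsPolar`. The bias is proportional to `h_t` and the noise part of the second moment to `1 / h_t ^
2`; `regret_constants_le` adds them up. -/

noncomputable section

open scoped NNReal

namespace ZeroOrder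

/-! ### Norm inequalities in finite dimension. -/

section Norms

variable {d : ℕ} {p q r : ℝ≥0∞}

theorem ellNorm_nonneg (hp : 1 ≤ p) (x : Vec d) : 0 ≤ ellNorm p x :=
  have : Fact (1 ≤ p) := ⟨hp⟩
  norm_nonneg _

theorem ellNorm_neg (hp : 1 ≤ p) (x : Vec d) : ellNorm p (-x) = ellNorm p x :=
  have : Fact (1 ≤ p) := ⟨hp⟩
  norm_neg (WithLp.toLp p (WithLp.ofLp x) : PiLp p fun _ : Fin d => ℝ)

theorem ellNorm_sub_comm (hp : 1 ≤ p) (x y : Vec d) : ellNorm p (x - y) = ellNorm p (y - x) := by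
  rw [← ellNorm_neg hp, neg_sub]

theorem ellNorm_add_le (hp : 1 ≤ p) (x y : Vec d) :
    ellNorm p (x + y) ≤ ellNorm p x + ellNorm p y :=
  have : Fact (1 ≤ p) := ⟨hp⟩
  norm_add_le (WithLp.toLp p (WithLp.ofLp x) : PiLp p fun _ : Fin d => ℝ)
    (WithLp.toLp p (WithLp.ofLp y))

theorem ellNorm_smul (hp : 1 ≤ p) (c : ℝ) (x : Vec d) : ellNorm p (c • x) = |c| * ellNorm p x :=
  have : Fact (1 ≤ p) := ⟨hp⟩
  norm_smul c (WithLp.toLp p (WithLp.ofLp x) : PiLp p fun _ : Fin d => ℝ)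

theorem continuous_ellNorm (hp : 1 ≤ p) : Continuous (ellNorm p : Vec d → ℝ) := by
  have : Fact (1 ≤ p) := ⟨hp⟩
  unfold ellNorm
  exact continuous_norm.comp ((PiLp.continuous_toLp p _).comp (PiLp.continuous_ofLp 2 _))

theorem eq_of_ellNorm_sub_eq_zero (hp : 1 ≤ p) {x y : Vec d} (h : ellNorm p (x - y) = 0) :
    x = y := by
  have : Fact (1 ≤ p) := ⟨hp⟩
  have h1 := norm_eq_zero.1 h
  rw [← sub_eq_zero]
  ext i
  exact congrFun (congrArg WithLp.ofLp h1) i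

theorem ellNorm_one (x : Vec d) : ellNorm 1 x = ∑ i, |x i| :=
  PiLp.norm_eq_of_L1 (WithLp.toLp 1 (WithLp.ofLp x))

theorem ellNorm_two (x : Vec d) : ellNorm 2 x = ‖x‖ := rfl

theorem ellNorm_top (x : Vec d) : ellNorm ∞ x = ⨆ i, |x i| :=
  PiLp.norm_eq_ciSup (WithLp.toLp ∞ (WithLp.ofLp x))

theorem ellNorm_eq_sum (hp : 1 ≤ p) (hp' : p ≠ ∞) (x : Vec d) :
    ellNorm p x = (∑ i, |x i| ^ p.toReal) ^ (1 / p.toReal) :=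
  PiLp.norm_eq_sum (p := p) (ENNReal.toReal_pos (by positivity) hp')
    (WithLp.toLp p (WithLp.ofLp x))

theorem abs_apply_le_ellNorm (hp : 1 ≤ p) (x : Vec d) (i : Fin d) : |x i| ≤ ellNorm p x :=
  have : Fact (1 ≤ p) := ⟨hp⟩
  PiLp.norm_apply_le (WithLp.toLp p (WithLp.ofLp x) : PiLp p fun _ : Fin d => ℝ) i

theorem ofReal_ellNorm (hp : 1 ≤ p) (x : Vec d) :
    ENNReal.ofReal (ellNorm p x) = eLpNorm (WithLp.ofLp x) p Measure.count := by
  rcases eq_or_ne p ∞ with rfl | hp'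
  · rw [eLpNorm_exponent_top, eLpNormEssSup_count, ellNorm_top]
    rcases isEmpty_or_nonempty (Fin d) with h | h
    · simp
    · rw [Monotone.map_ciSup_of_continuousAt ENNReal.continuous_ofReal.continuousAt
        ENNReal.ofReal_mono (Set.finite_range _).bddAbove]
      simp [Real.enorm_eq_ofReal_abs]
  · have h0 : 0 < p.toReal := ENNReal.toReal_pos (by positivity) hp'
    rw [eLpNorm_eq_lintegral_rpow_enorm_toReal (by positivity) hp', ellNorm_eq_sum hp hp',
      ← ENNReal.ofReal_rpow_of_nonneg (by positivity) (by positivity),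
      ENNReal.ofReal_sum_of_nonneg (fun i _ => by positivity), lintegral_count, tsum_fintype]
    congr 2 with i
    rw [Real.enorm_eq_ofReal_abs, ENNReal.ofReal_rpow_of_nonneg (by positivity) h0.le]

theorem one_le_conjExponent (p : ℝ≥0∞) : 1 ≤ p.conjExponent := le_self_add

/-- Hölder's inequality for `eLpNorm` with the counting measure, which treats all exponents, `∞`
included, at once. -/
theorem sum_abs_mul_abs_le (hp : 1 ≤ p) (x y : Vec d) :
    ∑ i, |x i| * |y i| ≤ ellNorm p.conjExponent x * ellNorm p y := by
  have : p.conjExponent.HolderConjugate p :=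
    (ENNReal.HolderConjugate.conjExponent hp).symm
  have h := eLpNorm_smul_le_mul_eLpNorm (𝕜 := ℝ) (μ := (Measure.count : Measure (Fin d)))
    (f := WithLp.ofLp y) (φ := WithLp.ofLp x) (p := p.conjExponent) (q := p) (r := 1)
    (AEStronglyMeasurable.of_discrete) (AEStronglyMeasurable.of_discrete)
  rw [← ofReal_ellNorm hp, ← ofReal_ellNorm (one_le_conjExponent p),
    ← ENNReal.ofReal_mul (ellNorm_nonneg (one_le_conjExponent p) x)] at h
  have h2 := ofReal_ellNorm (p := 1) le_rfl
    (WithLp.toLp 2 (WithLp.ofLp x • WithLp.ofLp y) : Vec d)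
  rw [ellNorm_one] at h2
  rw [← h2, ENNReal.ofReal_le_ofReal_iff
    (mul_nonneg (ellNorm_nonneg (one_le_conjExponent p) _) (ellNorm_nonneg hp _))] at h
  simpa [abs_mul] using h

theorem abs_inner_le (hp : 1 ≤ p) (x y : Vec d) :
    |inner ℝ x y| ≤ ellNorm p.conjExponent x * ellNorm p y := by
  refine le_trans ?_ (sum_abs_mul_abs_le hp x y)
  rw [PiLp.inner_apply]
  refine (Finset.abs_sum_le_sum_abs _ _).trans (Finset.sum_le_sum fun i _ => ?_)
  simp [abs_mul, mul_comm]

/-- Write `|x i| ^ r` as `|x i| ^ (r - q) * |x i| ^ q` and bound the first factor by the `ℓ_q`-norm.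
-/
theorem ellNorm_antitone (hq : 1 ≤ q) (h : q ≤ r) (x : Vec d) : ellNorm r x ≤ ellNorm q x := by
  rcases eq_or_ne q ∞ with rfl | hq'
  · rw [top_le_iff.1 h]
  have hM := ellNorm_nonneg hq x
  rcases eq_or_ne r ∞ with rfl | hr'
  · rw [ellNorm_top]
    exact Real.iSup_le (fun i => abs_apply_le_ellNorm hq x i) hM
  have hr := hq.trans h
  have h0 : 0 < q.toReal := ENNReal.toReal_pos (by positivity) hq'
  have hqr : q.toReal ≤ r.toReal := ENNReal.toReal_mono hr' h
  have h1 : 0 < r.toReal := h0.trans_le hqr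
  rw [ellNorm_eq_sum hr hr', one_div, Real.rpow_inv_le_iff_of_pos (by positivity) hM h1]
  have hs : ∑ i, |x i| ^ q.toReal = ellNorm q x ^ q.toReal := by
    rw [ellNorm_eq_sum hq hq', one_div, Real.rpow_inv_rpow (by positivity) h0.ne']
  calc ∑ i, |x i| ^ r.toReal ≤ ∑ i, ellNorm q x ^ (r.toReal - q.toReal) * |x i| ^ q.toReal := by
        refine Finset.sum_le_sum fun i _ => ?_
        have : |x i| ^ r.toReal = |x i| ^ (r.toReal - q.toReal) * |x i| ^ q.toReal := by
          rw [← Real.rpow_add_of_nonneg (abs_nonneg _) (by linarith) h0.le, sub_add_cancel]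
        rw [this]
        gcongr ?_ * _
        exact Real.rpow_le_rpow (abs_nonneg _) (abs_apply_le_ellNorm hq x i) (by linarith)
    _ = ellNorm q x ^ r.toReal := by
        rw [← Finset.mul_sum, hs, ← Real.rpow_add_of_nonneg hM (by linarith) h0.le, sub_add_cancel]

theorem ellNorm_le_mul_norm (hd : 0 < d) (hq : 1 ≤ q) (x : Vec d) :
    ellNorm q x ≤ (d : ℝ) ^ ((1 / min q 2).toReal - 1 / 2) * ‖x‖ := by
  have hdr : (0 : ℝ) < d := by exact_mod_cast hd
  have key : ∀ q : ℝ≥0∞, 1 ≤ q → q ≤ 2 →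
      ellNorm q x ≤ (d : ℝ) ^ ((1 / q).toReal - 1 / 2) * ‖x‖ := by
    intro q hq hq2
    have h := eLpNorm_le_eLpNorm_mul_rpow_measure_univ (μ := (Measure.count : Measure (Fin d)))
      (f := WithLp.ofLp x) hq2 AEStronglyMeasurable.of_discrete
    rw [← ofReal_ellNorm hq, ← ofReal_ellNorm (by norm_num), ellNorm_two, Measure.count_univ] at h
    have h3 : ((ENat.card (Fin d) : ℕ∞) : ℝ≥0∞) = ENNReal.ofReal d := by simp
    rw [h3, ENNReal.ofReal_rpow_of_pos hdr, ← ENNReal.ofReal_mul (norm_nonneg _),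
      ENNReal.ofReal_le_ofReal_iff (by positivity), mul_comm] at h
    simpa using h
  rcases le_total q 2 with h | h
  · rw [min_eq_left h]; exact key q hq h
  · rw [min_eq_right h]
    have h2 : ((1 / 2 : ℝ≥0∞)).toReal - 1 / 2 = 0 := by simp
    rw [h2, Real.rpow_zero, one_mul, ← ellNorm_two]
    exact ellNorm_antitone (by norm_num) h x

theorem abs_signVec_apply (x : Vec d) (i : Fin d) : |signVec x i| = 1 := by
  simp only [signVec]
  split_ifs <;> simp

theorem ellNorm_of_abs_eq_one (hd : 0 < d) (hp : 1 ≤ p) {x : Vec d} (hx : ∀ i, |x i| = 1) :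
    ellNorm p x = (d : ℝ) ^ (1 / p).toReal := by
  have : Nonempty (Fin d) := ⟨⟨0, hd⟩⟩
  rcases eq_or_ne p ∞ with rfl | hp'
  · simp [ellNorm_top, hx]
  · simp [ellNorm_eq_sum hp hp', hx]

/-- The dual norm does not depend on the signs, so the size of a gradient estimate is governed by
its scalar factor alone. -/
theorem ellNorm_signVec (hd : 0 < d) (hp : 1 ≤ p) (x : Vec d) :
    ellNorm p.conjExponent (signVec x) = (d : ℝ) ^ (1 - (1 / p).toReal) := by
  rw [ellNorm_of_abs_eq_one hd (one_le_conjExponent p) (abs_signVec_apply x)]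
  have h := (ENNReal.HolderConjugate.conjExponent hp).inv_add_inv_eq_inv
  have h1 : p⁻¹ ≠ ∞ := by simp; positivity
  have h2 : (p.conjExponent)⁻¹ ≠ ∞ := by
    have := one_le_conjExponent p
    simp; positivity
  have h3 := congrArg ENNReal.toReal h
  rw [ENNReal.toReal_add h1 h2] at h3
  congr 1
  simp at h3 ⊢
  linarith

theorem measurable_signVec : Measurable (signVec : Vec d → Vec d) := by
  unfold signVec
  refine (PiLp.continuous_toLp 2 _).measurable.comp (measurable_pi_lambda _ fun i => ?_)
  exact Measurable.ite (measurableSet_le measurable_const (by fun_prop)) measurable_const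
    measurable_const

end Norms

/-! ### The map from dual vectors to actions. -/

section MirrorMap

variable {d : ℕ} {p : ℝ≥0∞} {Θ : Set (Vec d)} {V : Vec d → ℝ}

theorem argmaxPoint_spec (hΘ : IsCompact Θ) (hne : Θ.Nonempty) (hV : LowerSemicontinuousOn V Θ)
    (η : ℝ) (z : Vec d) : argmaxPoint Θ V η z ∈ Θ ∧
      ∀ y ∈ Θ, η * inner ℝ z y - V y ≤
        η * inner ℝ z (argmaxPoint Θ V η z) - V (argmaxPoint Θ V η z) := by
  have hlsc : LowerSemicontinuousOn (fun y => V y + -(η * inner ℝ z y)) Θ :=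
    hV.add ((Continuous.lowerSemicontinuous (by fun_prop)).lowerSemicontinuousOn _)
  obtain ⟨x, hx, hmin⟩ := hlsc.exists_isMinOn hne hΘ
  have h : ∃ x, x ∈ Θ ∧ IsMaxOn (fun y => η * inner ℝ z y - V y) Θ x := by
    refine ⟨x, hx, fun y hy => ?_⟩
    have := hmin hy
    simp only [Set.mem_ofPred_eq] at this ⊢
    linarith
  have := Classical.epsilon_spec h
  exact ⟨this.1, fun y hy => this.2 hy⟩

theorem argmaxPoint_eq (η : ℝ) (z : Vec d) : argmaxPoint Θ V η z = argmaxPoint Θ V 1 (η • z) := by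
  simp only [argmaxPoint, inner_smul_left, one_mul]
  rfl

/-- Optimality says exactly that `η • z` is a subgradient of `V` at the maximizer, which is where
strong convexity may be applied. -/
theorem strongly_convex_at_argmaxPoint (hΘ : IsCompact Θ) (hV : LowerSemicontinuousOn V Θ)
    (hsc : IsStronglyConvex p Θ V) (η : ℝ) (z : Vec d) {y : Vec d} (hy : y ∈ Θ) :
    V (argmaxPoint Θ V η z) + η * inner ℝ z (y - argmaxPoint Θ V η z) +
      1 / 2 * ellNorm p (argmaxPoint Θ V η z - y) ^ 2 ≤ V y := by
  obtain ⟨h1, h2⟩ := argmaxPoint_spec hΘ ⟨y, hy⟩ hV η z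
  have h := hsc.2 _ h1 y hy (η • z) fun y' hy' => by
    have := h2 y' hy'
    rw [inner_smul_left, inner_sub_right]
    simp only [conj_trivial]
    linarith
  rw [inner_smul_left] at h
  exact h

/-- The maximizer is a choice made by `Classical.epsilon`; continuity is what makes the actions
measurable. Adding the strong convexity inequalities at two maximizers shows that the map is
nonexpansive from the dual norm to the `ℓ_p`-norm. -/
theorem continuous_argmaxPoint (hΘ : IsCompact Θ) (hne : Θ.Nonempty)
    (hV : LowerSemicontinuousOn V Θ) (hp : 1 ≤ p) (hsc : IsStronglyConvex p Θ V) :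
    Continuous (argmaxPoint Θ V 1) := by
  have key : ∀ w w', ellNorm p (argmaxPoint Θ V 1 w - argmaxPoint Θ V 1 w') ≤
      ellNorm p.conjExponent (w - w') := by
    intro w w'
    have h1 := strongly_convex_at_argmaxPoint hΘ hV hsc 1 w
      (argmaxPoint_spec hΘ hne hV 1 w').1
    have h2 := strongly_convex_at_argmaxPoint hΘ hV hsc 1 w'
      (argmaxPoint_spec hΘ hne hV 1 w).1
    set x := argmaxPoint Θ V 1 w
    set x' := argmaxPoint Θ V 1 w'
    rw [ellNorm_sub_comm hp x' x] at h2
    have h3 := (le_abs_self _).trans (abs_inner_le hp (w - w') (x - x'))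
    rw [inner_sub_left] at h3
    have h4 : inner ℝ w (x' - x) = - inner ℝ w (x - x') := by rw [← inner_neg_right, neg_sub]
    have h5 := ellNorm_nonneg hp (x - x')
    have h6 := ellNorm_nonneg (one_le_conjExponent p) (w - w')
    by_contra! hlt
    nlinarith
  refine continuous_iff_continuousAt.2 fun w => ?_
  have hcoord : ∀ i, Filter.Tendsto (fun w' => argmaxPoint Θ V 1 w' i) (nhds w)
      (nhds (argmaxPoint Θ V 1 w i)) := by
    intro i
    rw [tendsto_iff_dist_tendsto_zero]
    refine squeeze_zero (fun _ => dist_nonneg)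
      (fun w' => (abs_apply_le_ellNorm hp (argmaxPoint Θ V 1 w' - argmaxPoint Θ V 1 w) i).trans
        (key w' w)) ?_
    have hc : Continuous fun w' => ellNorm p.conjExponent (w' - w) :=
      (continuous_ellNorm (one_le_conjExponent p)).comp (by fun_prop)
    have := hc.tendsto w
    have h0 : ellNorm p.conjExponent (0 : Vec d) = 0 := by
      simpa using ellNorm_smul (one_le_conjExponent p) 0 (0 : Vec d)
    simpa [h0] using this
  have := ((PiLp.continuous_toLp 2 (fun _ : Fin d => ℝ)).tendsto _).comp (tendsto_pi_nhds.2 hcoord)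
  exact this

/-- Quadratic growth puts every point within `√2 * R` of the minimizer of `V`, which is the
maximizer for `z = 0`. -/
theorem ellNorm_sub_le_of_mem (hΘ : IsCompact Θ) (hV : LowerSemicontinuousOn V Θ) (hp : 1 ≤ p)
    (hsc : IsStronglyConvex p Θ V) {R : ℝ} (hR : 0 < R)
    (hVR : ∀ x ∈ Θ, ∀ y ∈ Θ, V x - V y ≤ R ^ 2) {x y : Vec d} (hx : x ∈ Θ) (hy : y ∈ Θ) :
    ellNorm p (x - y) ≤ 2 * √2 * R := by
  have key : ∀ y ∈ Θ, ellNorm p (argmaxPoint Θ V 1 0 - y) ≤ √2 * R := by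
    intro y hy
    have h := strongly_convex_at_argmaxPoint hΘ hV hsc 1 0 hy
    have h2 := hVR y hy _ (argmaxPoint_spec hΘ ⟨y, hy⟩ hV 1 0).1
    simp only [inner_zero_left, mul_zero, add_zero] at h
    refine abs_le_of_sq_le_sq' ?_ (by positivity) |>.2
    rw [mul_pow, Real.sq_sqrt (by norm_num)]
    linarith
  have h := ellNorm_add_le hp (x - argmaxPoint Θ V 1 0) (argmaxPoint Θ V 1 0 - y)
  rw [sub_add_sub_cancel, ellNorm_sub_comm hp x (argmaxPoint Θ V 1 0)] at h
  linarith [key x hx, key y hy]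

end MirrorMap

/-! ### Follow-the-regularized-leader with the adaptive step size. -/

section Regret

/-- The cost of one round: `a` is the dual norm of the gradient, `δ` the distance moved, `s` the
previous sum of squares. If `a` is small compared with `√s`, completing the square gives about `a ^
2 / √s`, comparable to the increment of the square root; if `a` is large, the diameter bound on `δ`
suffices, since `√(s + a ^ 2)` then dwarfs `√s`. -/
theorem step_regret_le {R s a δ : ℝ} (hR : 0 < R) (hs : 0 ≤ s) (ha : 0 ≤ a) (hδ : 0 ≤ δ)
    (hδR : δ ≤ 2 * √2 * R) :
    a * δ - √(2.75 * s) / R / 2 * δ ^ 2 ≤ 4 * R * (√(s + a ^ 2) - √s) := by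
  have hc : (1.65 : ℝ) ≤ √2.75 := Real.le_sqrt_of_sq_le (by norm_num)
  have h2 : √2 ≤ 1.415 := Real.sqrt_le_iff.2 (by norm_num)
  rw [Real.sqrt_mul (by norm_num)]
  obtain ⟨ε, rfl⟩ : ∃ ε, δ = R * ε := ⟨δ / R, by field_simp⟩
  have hε : 0 ≤ ε := nonneg_of_mul_nonneg_right hδ hR
  have hε2 : ε ≤ 2.83 := by
    have : ε ≤ 2 * √2 := le_of_mul_le_mul_left (by linarith) hR
    linarith
  set u := √s
  set w := √(s + a ^ 2)
  have hu : 0 ≤ u := Real.sqrt_nonneg _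
  have hw : 0 ≤ w := Real.sqrt_nonneg _
  have hwu : w ^ 2 = u ^ 2 + a ^ 2 := by
    rw [Real.sq_sqrt (by positivity), Real.sq_sqrt hs]
  have hle : u ≤ w := by nlinarith [sq_nonneg a]
  suffices h : a * ε - 0.825 * u * ε ^ 2 ≤ 4 * (w - u) by
    have h3 : √2.75 * u / R / 2 * (R * ε) ^ 2 = R * (√2.75 / 2 * u * ε ^ 2) := by field_simp
    rw [h3]
    have h4 : 0.825 * u * ε ^ 2 ≤ √2.75 / 2 * u * ε ^ 2 := by
      gcongr
      linarith
    nlinarith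
  rcases le_or_gt a (9 * u) with h | h
  -- Here `1 + 9 ^ 2 ≤ 9.2 ^ 2`. The square then costs at most `(w + u) / (3.3 * u) ≤ 10.2 / 3.3 <
  -- 4` times `w - u`.
  · have hw9 : w ≤ 9.2 * u := abs_le_of_sq_le_sq' (by nlinarith) (by positivity) |>.2
    rcases hu.eq_or_lt with hu0 | hu0
    · have : a = 0 := by linarith
      rw [← hu0, this]
      linarith
    · have h5 : a * ε - 0.825 * u * ε ^ 2 ≤ a ^ 2 / (3.3 * u) := by
        rw [le_div_iff₀ (by positivity)]
        nlinarith [sq_nonneg (a - 1.65 * u * ε)]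
      refine h5.trans ?_
      rw [div_le_iff₀ (by positivity)]
      have : a ^ 2 = (w - u) * (w + u) := by linarith
      rw [this]
      nlinarith [mul_nonneg (sub_nonneg.2 hle) hu, mul_le_mul_of_nonneg_left hw9 (sub_nonneg.2 hle)]
  -- Now `u < a / 9 ≤ w / 9`, so `4 * (w - u)` exceeds `3.5 * w`, which covers `2.83 * a`.
  · have haw : a ≤ w := abs_le_of_sq_le_sq' (by nlinarith) hw |>.2
    have : a * ε ≤ a * 2.83 := by gcongr
    have : 0 ≤ 0.825 * u * ε ^ 2 := by positivity
    linarith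

variable {d : ℕ} {p : ℝ≥0∞} {Θ : Set (Vec d)} {V : Vec d → ℝ}

/-- Regret of follow-the-regularized-leader with the adaptive step size, on linear losses. -/
theorem ftrl_regret_le (hΘ : IsCompact Θ) (hV : LowerSemicontinuousOn V Θ) (hp : 1 ≤ p)
    (hsc : IsStronglyConvex p Θ V) {R : ℝ} (hR : 0 < R)
    (hVR : ∀ x ∈ Θ, ∀ y ∈ Θ, V x - V y ≤ R ^ 2) (g X : ℕ → Vec d)
    (hX : ∀ t, X t = argmaxPoint Θ V
      (stepSize R t (∑ k ∈ Finset.range t, ellNorm p.conjExponent (g k) ^ 2))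
      (-∑ k ∈ Finset.range t, g k)) (T : ℕ) {x : Vec d} (hx : x ∈ Θ) :
    ∑ t ∈ Finset.range T, inner ℝ (g t) (X t - x) ≤
      6 * R * √(∑ t ∈ Finset.range T, ellNorm p.conjExponent (g t) ^ 2) := by
  set S : ℕ → ℝ := fun t => ∑ k ∈ Finset.range t, ellNorm p.conjExponent (g k) ^ 2 with hS
  set G : ℕ → Vec d := fun t => ∑ k ∈ Finset.range t, g k with hG
  have hp' := one_le_conjExponent p
  have hS0 : ∀ t, 0 ≤ S t := fun t => Finset.sum_nonneg fun _ _ => sq_nonneg _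
  have hSs : ∀ t, S (t + 1) = S t + ellNorm p.conjExponent (g t) ^ 2 := fun t =>
    Finset.sum_range_succ _ _
  have hGs : ∀ t, G (t + 1) = G t + g t := fun t => Finset.sum_range_succ _ _
  have hXm : ∀ t, X t ∈ Θ := fun t => by
    rw [hX]
    exact (argmaxPoint_spec hΘ ⟨x, hx⟩ hV _ _).1
  have hX0 : ∀ y ∈ Θ, V (X 0) ≤ V y := by
    intro y hy
    have h := strongly_convex_at_argmaxPoint hΘ hV hsc
      (stepSize R 0 (S 0)) (-G 0) hy
    rw [← hX 0] at h
    have h0 : inner ℝ (-G 0) (y - X 0) = 0 := by simp [hG]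
    rw [h0] at h
    nlinarith [sq_nonneg (ellNorm p (X 0 - y))]
  let β : ℕ → ℝ := fun t => √(2.75 * S t) / R
  have hβ : ∀ t, 0 ≤ β t := fun t => by positivity
  -- The objective multiplied by the inverse step size `β t`. Subtracting the minimum `V (X 0)`
  -- makes the regularizer nonnegative on `Θ`, so increasing `β` can only increase `F`.
  let F : ℕ → Vec d → ℝ := fun t y => β t * (V y - V (X 0)) + inner ℝ (G t) y
  have hF : ∀ t, ∀ y ∈ Θ, F t (X t) + β t / 2 * ellNorm p (X t - y) ^ 2 ≤ F t y := by
    intro t y hy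
    rcases (hS0 t).eq_or_lt with h0 | h0
    -- No nonzero gradient has been seen: `F t` vanishes identically and any action minimizes it.
    -- This is why the default step sizes `1` and `R` do not matter.
    · have hb : β t = 0 := by simp [β, ← h0]
      have hg : G t = 0 := by
        refine Finset.sum_eq_zero fun k hk => ?_
        have := (Finset.sum_eq_zero_iff_of_nonneg fun _ _ => sq_nonneg _).1 h0.symm k hk
        refine eq_of_ellNorm_sub_eq_zero hp' (y := 0) ?_
        rw [sub_zero]
        exact pow_eq_zero_iff (two_ne_zero) |>.1 this
      simp [F, hb, hg]
    · have ht : t ≠ 0 := by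
        rintro rfl
        simp [hS] at h0
      have h := strongly_convex_at_argmaxPoint hΘ hV hsc (stepSize R t (S t)) (-G t) hy
      rw [← hX t] at h
      have hpos : 0 < √(2.75 * S t) := Real.sqrt_pos.2 (by positivity)
      have hη : stepSize R t (S t) = R * (1 / √(2.75 * S t)) := by
        simp [stepSize, ht, h0.ne']
      have hβη : β t * stepSize R t (S t) = 1 := by
        rw [hη]
        simp only [β]
        field_simp
      have h2 := mul_le_mul_of_nonneg_left h (hβ t)
      have h3 : β t * (V (X t) + stepSize R t (S t) * inner ℝ (-G t) (y - X t) +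
          1 / 2 * ellNorm p (X t - y) ^ 2) = β t * V (X t) +
          (β t * stepSize R t (S t)) * inner ℝ (-G t) (y - X t) +
          β t / 2 * ellNorm p (X t - y) ^ 2 := by ring
      rw [h3, hβη, inner_neg_left, inner_sub_right] at h2
      simp only [F]
      linarith
  have hβmono : ∀ t, β t ≤ β (t + 1) := fun t => by
    simp only [β]
    gcongr
    rw [hSs]
    linarith [sq_nonneg (ellNorm p.conjExponent (g t))]
  have hsum : ∀ n, ∑ t ∈ Finset.range n, inner ℝ (g t) (X t) ≤ F n (X n) + 4 * R * √(S n) := by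
    intro n
    induction n with
    | zero => simp [F, β, hS, hG]
    | succ n ih =>
      rw [Finset.sum_range_succ]
      -- Comparing with the next minimizer yields a quadratic gain in the movement, which
      -- `step_regret_le` plays off against Hölder's bound for `⟨g n, X n - X (n + 1)⟩`.
      have h1 := hF n (X (n + 1)) (hXm _)
      have h2 : F (n + 1) (X (n + 1)) = F n (X (n + 1)) + inner ℝ (g n) (X (n + 1)) +
          (β (n + 1) - β n) * (V (X (n + 1)) - V (X 0)) := by
        simp only [F, hGs, inner_add_left]
        ring
      have h3 : 0 ≤ (β (n + 1) - β n) * (V (X (n + 1)) - V (X 0)) :=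
        mul_nonneg (sub_nonneg.2 (hβmono n)) (sub_nonneg.2 (hX0 _ (hXm _)))
      have h4 := (le_abs_self _).trans (abs_inner_le hp (g n) (X n - X (n + 1)))
      rw [inner_sub_right] at h4
      have h5 := step_regret_le hR (hS0 n) (ellNorm_nonneg hp' (g n))
        (ellNorm_nonneg hp (X n - X (n + 1)))
        (ellNorm_sub_le_of_mem hΘ hV hp hsc hR hVR (hXm n) (hXm (n + 1)))
      rw [← hSs] at h5
      have h6 : β n = √(2.75 * S n) / R := rfl
      rw [← h6] at h5
      linarith
  have h1 := hsum T
  have h2 := hF T x hx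
  have h3 : 0 ≤ β T / 2 * ellNorm p (X T - x) ^ 2 := mul_nonneg (by linarith [hβ T]) (sq_nonneg _)
  have h4 : F T x ≤ β T * R ^ 2 + inner ℝ (G T) x := by
    simp only [F]
    gcongr
    exact hVR x hx _ (hXm 0)
  have h5 : β T * R ^ 2 ≤ 2 * R * √(S T) := by
    have hc : √2.75 ≤ 2 := Real.sqrt_le_iff.2 (by norm_num)
    simp only [β]
    rw [Real.sqrt_mul (by norm_num)]
    have : √2.75 * √(S T) / R * R ^ 2 = √2.75 * (R * √(S T)) := by field_simp
    rw [this]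
    have : 0 ≤ R * √(S T) := by positivity
    nlinarith
  have h6 : inner ℝ (G T) x = ∑ t ∈ Finset.range T, inner ℝ (g t) x := sum_inner _ _ _
  simp only [inner_sub_right, Finset.sum_sub_distrib]
  linarith

end Regret

/-! ### Polar coordinates for the `ℓ_1`-norm. -/

section Polar

open scoped Pointwise

variable {n : ℕ}

/-- The linear isometry that flips the signs of the coordinates `i` with `s i = false`. -/
def signFlip {d : ℕ} (s : Fin d → Bool) : Vec d ≃ₗᵢ[ℝ] Vec d :=
  LinearIsometryEquiv.piLpCongrRight 2 fun i =>
    if s i then LinearIsometryEquiv.refl ℝ ℝ else LinearIsometryEquiv.neg ℝ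

theorem signFlip_apply {d : ℕ} (s : Fin d → Bool) (x : Vec d) (i : Fin d) :
    signFlip s x i = if s i then x i else -x i := by
  simp only [signFlip, LinearIsometryEquiv.piLpCongrRight_apply]
  split_ifs <;> simp

theorem signFlip_signFlip {d : ℕ} (s : Fin d → Bool) (x : Vec d) :
    signFlip s (signFlip s x) = x := by
  ext i
  simp only [signFlip_apply]
  split_ifs <;> simp

/-- The vectors of `ℝ^d` with sign pattern `s`. -/
def orthant {d : ℕ} (s : Fin d → Bool) : Set (Vec d) := {x | ∀ i, s i = true ↔ 0 ≤ x i}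

theorem measurableSet_orthant {d : ℕ} (s : Fin d → Bool) : MeasurableSet (orthant s) := by
  have : orthant s = ⋂ i, {x : Vec d | s i = true ↔ 0 ≤ x i} := by
    ext x
    simp [orthant]
  rw [this]
  refine MeasurableSet.iInter fun i => ?_
  have hm : MeasurableSet {x : Vec d | 0 ≤ x i} :=
    measurableSet_le measurable_const (by fun_prop)
  cases h : s i
  · simpa [Set.compl_ofPred] using hm.compl
  · simpa using hm

/-- Zero coordinates count as nonnegative, so the orthants form an exact partition and no null set
has to be discarded. -/
theorem sum_indicator_orthant {d : ℕ} (f : Vec d → ℝ≥0∞) (x : Vec d) :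
    ∑ s : Fin d → Bool, (orthant s).indicator f x = f x := by
  rw [Finset.sum_eq_single fun i => decide (0 ≤ x i)]
  · rw [Set.indicator_of_mem]
    simp [orthant]
  · intro s _ hs
    refine Set.indicator_of_notMem (fun hx => hs ?_) _
    ext i
    have := hx i
    by_cases h : 0 ≤ x i <;> simp_all
  · simp

theorem sum_signFlip_of_mem_orthant {d : ℕ} {s : Fin d → Bool} {x : Vec d} (hx : x ∈ orthant s) :
    ∑ i, signFlip s x i = ellNorm 1 x := by
  rw [ellNorm_one]
  refine Finset.sum_congr rfl fun i _ => ?_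
  rw [signFlip_apply]
  split_ifs with h
  · rw [abs_of_nonneg ((hx i).1 h)]
  · rw [abs_of_neg (not_le.1 fun h' => h ((hx i).2 h'))]

/-- The vector of `ℝ^d` with all coordinates equal to `1`. -/
def onesVec (d : ℕ) : Vec d := WithLp.toLp 2 fun _ => 1

theorem inner_onesVec {d : ℕ} (x : Vec d) : inner ℝ (onesVec d) x = ∑ i, x i := by
  simp [PiLp.inner_apply, onesVec]

/-- The hyperplane of vectors whose coordinates sum to zero. -/
abbrev sumZero (d : ℕ) : Submodule ℝ (Vec d) := (Submodule.span ℝ {onesVec d})ᗮ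

theorem mem_sumZero {d : ℕ} (x : Vec d) : x ∈ sumZero d ↔ ∑ i, x i = 0 := by
  rw [Submodule.mem_orthogonal_singleton_iff_inner_right, inner_onesVec]

theorem finrank_sumZero : Module.finrank ℝ (sumZero (n + 1)) = n := by
  have : Fact (Module.finrank ℝ (Vec (n + 1)) = n + 1) := ⟨by simp⟩
  refine Submodule.finrank_orthogonal_span_singleton fun h => ?_
  have := congrArg (fun v : Vec (n + 1) => v 0) h
  simp [onesVec] at this

/-- The linear coordinates `(k, r) ↦ k + r / d` on `ℝ^d`, where `r` is the sum of the entries. -/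
def hyperplaneEquiv (n : ℕ) : (sumZero (n + 1) × ℝ) ≃L[ℝ] Vec (n + 1) :=
  (LinearMap.linearEquivOfInjective
    ((sumZero (n + 1)).subtype.coprod
      (LinearMap.toSpanSingleton ℝ _ (((n : ℝ) + 1)⁻¹ • onesVec (n + 1))))
    (by
      rw [← LinearMap.ker_eq_bot, LinearMap.ker_eq_bot']
      rintro ⟨k, r⟩ h
      have hk := (mem_sumZero _).1 k.2
      simp only [LinearMap.coprod_apply, Submodule.subtype_apply,
        LinearMap.toSpanSingleton_apply] at h
      have h1 := congrArg (inner ℝ (onesVec (n + 1))) h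
      rw [inner_add_right, inner_onesVec, hk, inner_smul_right, inner_smul_right, inner_onesVec]
        at h1
      have h2 : (n : ℝ) + 1 ≠ 0 := by positivity
      have h3 : r = 0 := by simpa [onesVec, h2] using h1
      subst h3
      simpa using h)
    (by rw [Module.finrank_prod, finrank_sumZero]; simp)).toContinuousLinearEquiv

theorem hyperplaneEquiv_apply (k : sumZero (n + 1)) (r : ℝ) :
    hyperplaneEquiv n (k, r) = (k : Vec (n + 1)) + r • (((n : ℝ) + 1)⁻¹ • onesVec (n + 1)) := rfl

theorem sum_hyperplaneEquiv (k : sumZero (n + 1)) (r : ℝ) :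
    ∑ i, hyperplaneEquiv n (k, r) i = r := by
  rw [hyperplaneEquiv_apply, ← inner_onesVec, inner_add_right, inner_onesVec,
    (mem_sumZero _).1 k.2, inner_smul_right, inner_smul_right, inner_onesVec]
  have h2 : (n : ℝ) + 1 ≠ 0 := by positivity
  simp [onesVec, h2]

/-- Both sides are Haar measures. The value of `C` is never needed, because normalization to a
probability measure fixes the constants later. -/
theorem exists_map_hyperplaneEquiv (n : ℕ) : ∃ C : ℝ≥0∞, C ≠ 0 ∧ C ≠ ∞ ∧
    Measure.map (hyperplaneEquiv n)
      ((Measure.hausdorffMeasure (n : ℝ) : Measure (sumZero (n + 1))).prod volume) =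
      C • (volume : Measure (Vec (n + 1))) := by
  have h0 : (Measure.hausdorffMeasure (n : ℝ) : Measure (sumZero (n + 1))).IsAddHaarMeasure := by
    have := isAddHaarMeasure_hausdorffMeasure (E := sumZero (n + 1))
    rwa [finrank_sumZero] at this
  have h1 : (Measure.map (hyperplaneEquiv n)
      ((Measure.hausdorffMeasure (n : ℝ) : Measure (sumZero (n + 1))).prod volume)).IsAddHaarMeasure :=
    (hyperplaneEquiv n).isAddHaarMeasure_map _
  have h2 := Measure.isAddLeftInvariant_eq_smul (Measure.map (hyperplaneEquiv n)
      ((Measure.hausdorffMeasure (n : ℝ) : Measure (sumZero (n + 1))).prod volume))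
      (volume : Measure (Vec (n + 1)))
  refine ⟨_, ?_, ?_, h2⟩
  · exact_mod_cast (Measure.addHaarScalarFactor_pos_of_isAddHaarMeasure _ _).ne'
  · exact ENNReal.coe_ne_top

/-- Cavalieri's principle for the hyperplanes on which the sum of the absolute values is
constant, inside one orthant. -/
theorem lintegral_orthant_eq {C : ℝ≥0∞} (hC : Measure.map (hyperplaneEquiv n)
      ((Measure.hausdorffMeasure (n : ℝ) : Measure (sumZero (n + 1))).prod volume) =
      C • (volume : Measure (Vec (n + 1))))
    (s : Fin (n + 1) → Bool) {f : Vec (n + 1) → ℝ≥0∞} (hf : Measurable f) :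
    C * ∫⁻ x, (orthant s).indicator f x =
      ∫⁻ r, ∫⁻ x in {x | ellNorm 1 x = r}, (orthant s).indicator f x
        ∂Measure.hausdorffMeasure (n : ℝ) := by
  have h0 : (Measure.hausdorffMeasure (n : ℝ) : Measure (sumZero (n + 1))).IsAddHaarMeasure := by
    have := isAddHaarMeasure_hausdorffMeasure (E := sumZero (n + 1))
    rwa [finrank_sumZero] at this
  set F := (orthant s).indicator f with hF
  have hFm : Measurable F := hf.indicator (measurableSet_orthant s)
  -- After flipping signs, the `ℓ_1`-norm on the orthant is the sum of the coordinates, and its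
  -- level sets lie in parallel hyperplanes.
  have hT : MeasurePreserving (signFlip s) := (signFlip s).measurePreserving
  have hm : Measurable fun z => F (signFlip s (hyperplaneEquiv n z)) :=
    hFm.comp ((signFlip s).continuous.measurable.comp (hyperplaneEquiv n).continuous.measurable)
  rw [← hT.lintegral_comp hFm, ← smul_eq_mul, ← lintegral_smul_measure, ← hC,
    lintegral_map (f := fun x => F (signFlip s x)) (hFm.comp (signFlip s).continuous.measurable)
      (hyperplaneEquiv n).continuous.measurable, lintegral_prod_symm _ hm.aemeasurable]
  congr 1 with r
  -- An isometric parametrization of a slice; isometries transport Hausdorff measure exactly, so no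
  -- Jacobian depending on the slice appears.
  let e : sumZero (n + 1) → Vec (n + 1) := fun k => signFlip s (hyperplaneEquiv n (k, r))
  have he : Isometry e := by
    refine (signFlip s).isometry.comp ?_
    simp only [hyperplaneEquiv_apply]
    exact (IsometryEquiv.addRight _).isometry.comp isometry_subtype_coe
  have hrange : Set.range e = {x | ∑ i, signFlip s x i = r} := by
    ext x
    constructor
    · rintro ⟨k, rfl⟩
      simp only [e, Set.mem_ofPred_eq, signFlip_signFlip, sum_hyperplaneEquiv]
    · intro hx
      obtain ⟨⟨k, r'⟩, hk⟩ := (hyperplaneEquiv n).surjective (signFlip s x)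
      have hr : r' = r := by
        rw [← sum_hyperplaneEquiv k r', hk]
        exact hx
      refine ⟨k, ?_⟩
      simp only [e]
      rw [← hr, hk, signFlip_signFlip]
  have hmr : MeasurableSet {x : Vec (n + 1) | ∑ i, signFlip s x i = r} := by
    rw [← hrange]
    exact (he.isClosedEmbedding).isClosed_range.measurableSet
  have hmr' : MeasurableSet {x : Vec (n + 1) | ellNorm 1 x = r} :=
    measurableSet_eq_fun (continuous_ellNorm le_rfl).measurable measurable_const
  calc ∫⁻ k, F (signFlip s (hyperplaneEquiv n (k, r))) ∂Measure.hausdorffMeasure (n : ℝ)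
      = ∫⁻ x, F x ∂(Measure.map e (Measure.hausdorffMeasure (n : ℝ))) :=
        (lintegral_map hFm he.continuous.measurable).symm
    _ = ∫⁻ x in {x | ∑ i, signFlip s x i = r}, F x ∂Measure.hausdorffMeasure (n : ℝ) := by
        rw [he.map_hausdorffMeasure (Or.inl (by positivity)), hrange]
    _ = _ := by
        rw [← lintegral_indicator hmr, ← lintegral_indicator hmr']
        congr 1 with x
        -- The hyperplane and the level set of the norm agree inside the orthant, and `F` vanishes
        -- outside it.
        by_cases hx : x ∈ orthant s
        · simp only [Set.indicator_apply, Set.mem_ofPred_eq, sum_signFlip_of_mem_orthant hx]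
        · have : F x = 0 := Set.indicator_of_notMem hx _
          simp [Set.indicator_apply, this]

theorem lintegral_hausdorffMeasure_smul {r : ℝ} (hr : 0 < r) {f : Vec (n + 1) → ℝ≥0∞}
    (hf : Measurable f) :
    ∫⁻ x, f x ∂Measure.hausdorffMeasure (n : ℝ) =
      ENNReal.ofReal (r ^ n) * ∫⁻ x, f (r • x) ∂Measure.hausdorffMeasure (n : ℝ) := by
  have hmap : Measure.map (fun x : Vec (n + 1) => r • x)
      (ENNReal.ofReal (r ^ n) • Measure.hausdorffMeasure (n : ℝ)) =
      Measure.hausdorffMeasure (n : ℝ) := by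
    ext A hA
    rw [Measure.map_apply (by fun_prop) hA, Measure.smul_apply, smul_eq_mul]
    have h1 : (fun x : Vec (n + 1) => r • x) ⁻¹' A = r⁻¹ • A := by
      rw [← Set.preimage_smul_inv₀ (inv_ne_zero hr.ne'), inv_inv]
    rw [h1, Measure.hausdorffMeasure_smul₀ (by positivity) (inv_ne_zero hr.ne')]
    rw [ENNReal.smul_def, smul_eq_mul, ← mul_assoc]
    have h2 : ((‖r⁻¹‖₊ ^ (n : ℝ) : NNReal) : ℝ≥0∞) = ENNReal.ofReal ((r⁻¹) ^ n) := by
      rw [NNReal.rpow_natCast, ENNReal.coe_pow, ENNReal.ofReal_pow (by positivity)]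
      congr 1
      rw [ENNReal.ofReal_eq_coe_nnreal (by positivity), Real.nnnorm_of_nonneg (by positivity)]
    rw [h2, ← ENNReal.ofReal_mul (by positivity), ← mul_pow, mul_inv_cancel₀ hr.ne']
    simp
  conv_lhs => rw [← hmap]
  rw [lintegral_map hf (by fun_prop), lintegral_smul_measure, smul_eq_mul]

theorem measurableSet_l1Sphere (d : ℕ) : MeasurableSet (l1Sphere d) :=
  measurableSet_eq_fun (continuous_ellNorm le_rfl).measurable measurable_const

/-- Polar coordinates for the `ℓ_1`-norm, with the surface measure on the unit sphere. -/
theorem lintegral_eq_lintegral_l1Sphere (n : ℕ)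
    [this : SFinite ((surfaceMeasure (n + 1)).restrict (l1Sphere (n + 1)))] :
    ∃ C : ℝ≥0∞, C ≠ 0 ∧ C ≠ ∞ ∧
    ∀ f : Vec (n + 1) → ℝ≥0∞, Measurable f →
      C * ∫⁻ x, f x = ∫⁻ r in Set.Ioi (0 : ℝ), ENNReal.ofReal (r ^ n) *
        ∫⁻ y in l1Sphere (n + 1), f (r • y) ∂surfaceMeasure (n + 1) := by
  obtain ⟨C, hC0, hC1, hC⟩ := exists_map_hyperplaneEquiv n
  refine ⟨C, hC0, hC1, fun f hf => ?_⟩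
  have hsurf : surfaceMeasure (n + 1) = Measure.hausdorffMeasure (n : ℝ) := by
    simp [surfaceMeasure]
  rw [hsurf] at this ⊢
  have hlev : ∀ r : ℝ, MeasurableSet {x : Vec (n + 1) | ellNorm 1 x = r} := fun r =>
    measurableSet_eq_fun (continuous_ellNorm le_rfl).measurable measurable_const
  have hslice : ∀ g : Vec (n + 1) → ℝ≥0∞, Measurable g → ∀ r : ℝ, 0 < r →
      ∫⁻ x in {x | ellNorm 1 x = r}, g x ∂Measure.hausdorffMeasure (n : ℝ) =
      ENNReal.ofReal (r ^ n) * ∫⁻ y in l1Sphere (n + 1), g (r • y)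
        ∂Measure.hausdorffMeasure (n : ℝ) := by
    intro g hg r hr
    rw [← lintegral_indicator (hlev r),
      lintegral_hausdorffMeasure_smul hr (hg.indicator (hlev r)),
      ← lintegral_indicator (measurableSet_l1Sphere _)]
    congr 2 with y
    simp only [Set.indicator_apply, Set.mem_ofPred_eq, l1Sphere, ellNorm_smul le_rfl,
      abs_of_pos hr, mul_eq_left₀ hr.ne']
  have hpolar : ∀ s : Fin (n + 1) → Bool, C * ∫⁻ x, (orthant s).indicator f x =
      ∫⁻ r in Set.Ioi (0 : ℝ), ENNReal.ofReal (r ^ n) *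
        ∫⁻ y in l1Sphere (n + 1), (orthant s).indicator f (r • y)
          ∂Measure.hausdorffMeasure (n : ℝ) := by
    intro s
    rw [lintegral_orthant_eq hC s hf, ← lintegral_indicator measurableSet_Ioi]
    refine lintegral_congr_ae ?_
    filter_upwards [compl_mem_ae_iff.2 (measure_singleton (0 : ℝ))] with r hr
    rcases lt_or_gt_of_ne hr with h | h
    · have : {x : Vec (n + 1) | ellNorm 1 x = r} = ∅ := by
        ext x
        simp only [Set.mem_ofPred_eq, Set.mem_empty_iff_false, iff_false]
        exact fun hx => (ellNorm_nonneg le_rfl x).not_gt (hx ▸ h)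
      rw [this]
      simp [h.not_gt]
    · rw [hslice _ (hf.indicator (measurableSet_orthant s)) r h, Set.indicator_of_mem (Set.mem_Ioi.2 h)]
  have hmeas : ∀ g : Vec (n + 1) → ℝ≥0∞, Measurable g → ∀ r : ℝ,
      Measurable fun y => g (r • y) := fun g hg r => hg.comp (by fun_prop)
  have hind : ∀ s, Measurable ((orthant s).indicator f) := fun s =>
    hf.indicator (measurableSet_orthant s)
  calc C * ∫⁻ x, f x = ∑ s : Fin (n + 1) → Bool, C * ∫⁻ x, (orthant s).indicator f x := by
        rw [← Finset.mul_sum, ← lintegral_finsetSum _ fun s _ => hind s]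
        simp_rw [sum_indicator_orthant]
    _ = ∑ s : Fin (n + 1) → Bool, ∫⁻ r in Set.Ioi (0 : ℝ), ENNReal.ofReal (r ^ n) *
        ∫⁻ y in l1Sphere (n + 1), (orthant s).indicator f (r • y)
          ∂Measure.hausdorffMeasure (n : ℝ) := Finset.sum_congr rfl fun s _ => hpolar s
    _ = _ := by
        have hm2 : ∀ g : Vec (n + 1) → ℝ≥0∞, Measurable g → Measurable fun r : ℝ =>
            ENNReal.ofReal (r ^ n) * ∫⁻ y in l1Sphere (n + 1), g (r • y)
              ∂Measure.hausdorffMeasure (n : ℝ) := fun g hg => by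
          refine (by fun_prop : Measurable fun r : ℝ => ENNReal.ofReal (r ^ n)).mul ?_
          exact Measurable.lintegral_prod_right (f := fun r y => g (r • y))
            (hg.comp (by fun_prop))
        rw [← lintegral_finsetSum _ fun s _ => hm2 _ (hind s)]
        congr 1 with r
        rw [← Finset.mul_sum, ← lintegral_finsetSum _ fun s _ => hmeas _ (hind s) r]
        simp_rw [sum_indicator_orthant]

/-- A probability measure `Q` on the unit sphere of the `ℓ_1`-norm of `ℝ^d` such that the Lebesgue
measure is, up to the factor `C`, the product of `r ^ (d - 1) dr` and `Q` in polar coordinates. -/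
structure IsPolar {d : ℕ} (C : ℝ) (Q : Measure (Vec d)) : Prop where
  prob : IsProbabilityMeasure Q
  pos : 0 < C
  ae_norm : ∀ᵐ y ∂Q, ellNorm 1 y = 1
  lintegral_eq : ∀ f : Vec d → ℝ≥0∞, Measurable f →
    ∫⁻ x, f x = ENNReal.ofReal C * ∫⁻ r in Set.Ioi (0 : ℝ), ENNReal.ofReal (r ^ (d - 1)) *
      ∫⁻ y, f (r • y) ∂Q

/-- The surface area of the sphere is neither `0` nor `∞`, since the conditional measure would
otherwise be zero. Thus the existence of a uniformly distributed vector replaces a computation of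
the Hausdorff measure. -/
theorem exists_isPolar_cond {d : ℕ} (hd : 0 < d)
    (hQ : IsProbabilityMeasure (ProbabilityTheory.cond (surfaceMeasure d) (l1Sphere d))) :
    ∃ C : ℝ, IsPolar C (ProbabilityTheory.cond (surfaceMeasure d) (l1Sphere d)) := by
  obtain ⟨n, rfl⟩ : ∃ n, d = n + 1 := ⟨d - 1, by omega⟩
  set m := surfaceMeasure (n + 1) (l1Sphere (n + 1)) with hm
  have hm0 : m ≠ 0 := by
    intro h
    have h1 : ProbabilityTheory.cond (surfaceMeasure (n + 1)) (l1Sphere (n + 1)) = 0 :=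
      cond_eq_zero_of_meas_eq_zero h
    rw [h1] at hQ
    exact IsProbabilityMeasure.ne_zero (0 : Measure (Vec (n + 1))) rfl
  have hmt : m ≠ ∞ := by
    intro h
    have h1 : ProbabilityTheory.cond (surfaceMeasure (n + 1)) (l1Sphere (n + 1)) = 0 := by
      rw [ProbabilityTheory.cond, ← hm, h]
      simp
    rw [h1] at hQ
    exact IsProbabilityMeasure.ne_zero (0 : Measure (Vec (n + 1))) rfl
  have hfin : IsFiniteMeasure ((surfaceMeasure (n + 1)).restrict (l1Sphere (n + 1))) :=
    ⟨by rw [Measure.restrict_apply_univ]; exact hmt.lt_top⟩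
  obtain ⟨C, hC0, hCt, hC⟩ := lintegral_eq_lintegral_l1Sphere n
  have hreal : ENNReal.ofReal (m / C).toReal = m / C :=
    ENNReal.ofReal_toReal (ENNReal.div_ne_top hmt hC0)
  refine ⟨(m / C).toReal, hQ, ENNReal.toReal_pos (ENNReal.div_ne_zero.2 ⟨hm0, hCt⟩)
    (ENNReal.div_ne_top hmt hC0), ?_, fun f hf => ?_⟩
  · exact ae_cond_mem (measurableSet_l1Sphere _)
  · rw [hreal]
    have h1 : ∀ g : Vec (n + 1) → ℝ≥0∞, ∫⁻ y in l1Sphere (n + 1), g y ∂surfaceMeasure (n + 1) =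
        m * ∫⁻ y, g y ∂ProbabilityTheory.cond (surfaceMeasure (n + 1)) (l1Sphere (n + 1)) := by
      intro g
      rw [ProbabilityTheory.cond, lintegral_smul_measure, smul_eq_mul, ← mul_assoc,
        ENNReal.mul_inv_cancel hm0 hmt, one_mul]
    have h2 := hC f hf
    simp_rw [h1, mul_left_comm _ m] at h2
    rw [lintegral_const_mul' _ _ hmt] at h2
    rw [Nat.add_sub_cancel, ENNReal.div_eq_inv_mul, mul_assoc, ← h2, ← mul_assoc,
      ENNReal.inv_mul_cancel hC0 hCt, one_mul]

end Polar

/-! ### The Laplace distribution on the line and a Hardy inequality. -/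

section LaplaceOneDim

/-- The Laplace distribution on the real line. -/
def laplace : Measure ℝ := volume.withDensity fun x => ENNReal.ofReal (Real.exp (-|x|) / 2)

theorem integrableOn_pow_mul_exp_neg (k : ℕ) :
    IntegrableOn (fun x : ℝ => x ^ k * Real.exp (-x)) (Set.Ioi 0) := by
  have h := Real.GammaIntegral_convergent (s := k + 1) (by positivity)
  refine h.congr_fun (fun x _ => ?_) measurableSet_Ioi
  simp [mul_comm]

theorem integral_rpow_mul_exp_neg {s : ℝ} (hs : -1 < s) :
    ∫ x in Set.Ioi (0 : ℝ), x ^ s * Real.exp (-x) = Real.Gamma (s + 1) := by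
  rw [Real.Gamma_eq_integral (by linarith)]
  simp [mul_comm]

theorem integral_eq_integral_Ioi_add {f : ℝ → ℝ} (hf : Integrable f) :
    ∫ x, f x = ∫ x in Set.Ioi (0 : ℝ), (f x + f (-x)) := by
  rw [integral_add hf.integrableOn hf.comp_neg.integrableOn, integral_comp_neg_Ioi, neg_zero,
    ← setIntegral_union (Set.Iic_disjoint_Ioi le_rfl).symm measurableSet_Iic hf.integrableOn
      hf.integrableOn, Set.union_comm, Set.Iic_union_Ioi, setIntegral_univ]

theorem integral_laplace (f : ℝ → ℝ) :
    ∫ x, f x ∂laplace = ∫ x, Real.exp (-|x|) / 2 * f x := by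
  rw [laplace, integral_withDensity_eq_integral_toReal_smul (by fun_prop) (by simp)]
  refine integral_congr_ae (Filter.Eventually.of_forall fun x => ?_)
  simp only [smul_eq_mul]
  rw [ENNReal.toReal_ofReal (by positivity)]

theorem integrable_laplace_iff {f : ℝ → ℝ} :
    Integrable f laplace ↔ Integrable fun x => Real.exp (-|x|) / 2 * f x := by
  rw [laplace, integrable_withDensity_iff_integrable_smul' (by fun_prop) (by simp)]
  refine integrable_congr (Filter.Eventually.of_forall fun x => ?_)
  simp only [smul_eq_mul]
  rw [ENNReal.toReal_ofReal (by positivity)]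

theorem integrable_comp_abs {f : ℝ → ℝ} (hf : IntegrableOn f (Set.Ioi 0)) :
    Integrable fun x => f |x| := by
  have h1 : Integrable ((Set.Ioi 0).indicator f) := (integrable_indicator_iff measurableSet_Ioi).2 hf
  refine (h1.add h1.comp_neg).congr ?_
  filter_upwards [compl_mem_ae_iff.2 (measure_singleton (0 : ℝ))] with x hx
  rcases lt_or_gt_of_ne hx with h | h
  · simp [Set.indicator_apply, h, h.not_gt, abs_of_neg h]
  · simp [Set.indicator_apply, h, h.not_gt, abs_of_pos h]

theorem integrable_laplace_abs_pow (k : ℕ) : Integrable (fun x : ℝ => |x| ^ k) laplace := by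
  rw [integrable_laplace_iff]
  have := (integrable_comp_abs (integrableOn_pow_mul_exp_neg k)).div_const 2
  refine this.congr (Filter.Eventually.of_forall fun x => ?_)
  simp only
  ring

theorem integrable_exp_neg_abs : Integrable fun x : ℝ => Real.exp (-|x|) / 2 := by
  simpa using integrable_laplace_iff.1 (integrable_laplace_abs_pow 0)

theorem integral_exp_neg_abs_div_two : ∫ x : ℝ, Real.exp (-|x|) / 2 = 1 := by
  rw [integral_comp_abs (f := fun x => Real.exp (-x) / 2), integral_div, integral_exp_neg_Ioi_zero]
  norm_num

instance : IsProbabilityMeasure laplace := by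
  refine ⟨?_⟩
  rw [laplace, withDensity_apply _ MeasurableSet.univ, Measure.restrict_univ,
    ← ofReal_integral_eq_lintegral_ofReal integrable_exp_neg_abs
      (Filter.Eventually.of_forall fun x => by positivity), integral_exp_neg_abs_div_two]
  simp

theorem integral_abs_rpow_laplace {s : ℝ} (hs : 0 ≤ s) :
    ∫ x, |x| ^ s ∂laplace = Real.Gamma (s + 1) := by
  rw [integral_laplace, integral_comp_abs (f := fun x => Real.exp (-x) / 2 * x ^ s),
    ← integral_rpow_mul_exp_neg (by linarith), ← integral_const_mul]
  congr 1 with x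
  ring

theorem integrable_abs_rpow_laplace {s : ℝ} (hs : 0 ≤ s) :
    Integrable (fun x => |x| ^ s) laplace := by
  rw [integrable_laplace_iff]
  have h := Real.GammaIntegral_convergent (s := s + 1) (by linarith)
  have := (integrable_comp_abs h).div_const 2
  refine this.congr (Filter.Eventually.of_forall fun x => ?_)
  simp only [add_sub_cancel_right]
  ring

/-- With `u = g - g 0`, integrate the derivative of `u ^ 2 * exp (-t)` over `[0, T]`: the boundary
term at `T` is nonnegative, and `2 * u * g' ≤ 2 * g' ^ 2 + u ^ 2 / 2` absorbs half of `u ^ 2`. The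
fundamental theorem of calculus holds by absolute continuity, though `g` is only differentiable
almost everywhere. -/
theorem half_line_hardy {g : ℝ → ℝ} {K : ℝ≥0} (hg : LipschitzWith K g) :
    IntegrableOn (fun t => (g t - g 0) ^ 2 * Real.exp (-t)) (Set.Ioi 0) ∧
    IntegrableOn (fun t => deriv g t ^ 2 * Real.exp (-t)) (Set.Ioi 0) ∧
    ∫ t in Set.Ioi (0 : ℝ), (g t - g 0) ^ 2 * Real.exp (-t) ≤
      4 * ∫ t in Set.Ioi (0 : ℝ), deriv g t ^ 2 * Real.exp (-t) := by
  have hgc := hg.continuous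
  have hgd := measurable_deriv g
  have h1 : IntegrableOn (fun t => (g t - g 0) ^ 2 * Real.exp (-t)) (Set.Ioi 0) := by
    refine Integrable.mono' ((integrableOn_pow_mul_exp_neg 2).const_mul (K ^ 2 : ℝ))
      (by fun_prop) ?_
    refine (ae_restrict_mem measurableSet_Ioi).mono fun t ht => ?_
    have h := hg.dist_le_mul t 0
    rw [Real.dist_eq, Real.dist_eq, sub_zero] at h
    rw [Real.norm_of_nonneg (by positivity), ← mul_assoc]
    gcongr
    rw [← mul_pow, ← sq_abs (g t - g 0), ← sq_abs (K * t), abs_mul, NNReal.abs_eq]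
    gcongr
  have h2 : IntegrableOn (fun t => deriv g t ^ 2 * Real.exp (-t)) (Set.Ioi 0) := by
    refine Integrable.mono' ((integrableOn_pow_mul_exp_neg 0).const_mul (K ^ 2 : ℝ))
      (by fun_prop) ?_
    refine (ae_restrict_mem measurableSet_Ioi).mono fun t ht => ?_
    have h := norm_deriv_le_of_lipschitz (x₀ := t) hg
    rw [Real.norm_of_nonneg (by positivity), pow_zero, one_mul]
    refine mul_le_mul_of_nonneg_right ?_ (by positivity)
    rw [← sq_abs]
    gcongr
    exact h
  refine ⟨h1, h2, ?_⟩
  have hT : ∀ T : ℝ, 0 ≤ T → ∫ t in (0)..T, (g t - g 0) ^ 2 * Real.exp (-t) ≤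
      4 * ∫ t in (0)..T, deriv g t ^ 2 * Real.exp (-t) := by
    intro T hT0
    let w : ℝ → ℝ := fun t => (g t - g 0) * (g t - g 0) * Real.exp (-t)
    have hacg : AbsolutelyContinuousOnInterval (fun t => g t - g 0) 0 T :=
      ((hg.lipschitzOnWith (s := Set.uIcc 0 T)).sub
        (LipschitzWith.const (g 0)).lipschitzOnWith).absolutelyContinuousOnInterval
    have hace : AbsolutelyContinuousOnInterval (fun t => Real.exp (-t)) 0 T :=
      (ContDiff.contDiffOn (by fun_prop)).absolutelyContinuousOnInterval
    have hw : AbsolutelyContinuousOnInterval w 0 T := (hacg.fun_mul hacg).fun_mul hace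
    have hint := hw.integral_deriv_eq_sub
    have hw0 : w 0 = 0 := by simp [w]
    have hwT : 0 ≤ w T := mul_nonneg (mul_self_nonneg _) (Real.exp_pos _).le
    have hi1 : IntervalIntegrable (fun t => (g t - g 0) ^ 2 * Real.exp (-t)) volume 0 T :=
      (intervalIntegrable_iff_integrableOn_Ioc_of_le hT0).2 (h1.mono_set Set.Ioc_subset_Ioi_self)
    have hi2 : IntervalIntegrable (fun t => deriv g t ^ 2 * Real.exp (-t)) volume 0 T :=
      (intervalIntegrable_iff_integrableOn_Ioc_of_le hT0).2 (h2.mono_set Set.Ioc_subset_Ioi_self)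
    have hle : ∫ t in (0)..T, deriv w t ≤ ∫ t in (0)..T,
        (2 * (deriv g t ^ 2 * Real.exp (-t)) - 1 / 2 * ((g t - g 0) ^ 2 * Real.exp (-t))) := by
      refine intervalIntegral.integral_mono_ae hT0 hw.intervalIntegrable_deriv
        ((hi2.const_mul 2).sub (hi1.const_mul _)) ?_
      filter_upwards [hg.ae_differentiableAt] with t ht
      have hd : HasDerivAt w ((deriv g t * (g t - g 0) + (g t - g 0) * deriv g t) * Real.exp (-t) +
          (g t - g 0) * (g t - g 0) * (Real.exp (-t) * (-1))) t :=
        ((ht.hasDerivAt.sub_const _).mul (ht.hasDerivAt.sub_const _)).mul (hasDerivAt_neg t).exp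
      rw [hd.deriv]
      have := mul_nonneg (sq_nonneg (2 * deriv g t - (g t - g 0))) (Real.exp_pos (-t)).le
      nlinarith
    rw [hint, hw0, sub_zero, intervalIntegral.integral_sub (hi2.const_mul 2) (hi1.const_mul _),
      intervalIntegral.integral_const_mul, intervalIntegral.integral_const_mul] at hle
    linarith
  have t1 := intervalIntegral_tendsto_integral_Ioi 0 h1 Filter.tendsto_id
  have t2 := (intervalIntegral_tendsto_integral_Ioi 0 h2 Filter.tendsto_id).const_mul 4
  exact le_of_tendsto_of_tendsto t1 t2 ((Filter.eventually_ge_atTop 0).mono fun T h => hT T h)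

theorem integrable_laplace_sq_sub {g : ℝ → ℝ} {K : ℝ≥0} (hg : LipschitzWith K g) :
    Integrable (fun t => (g t - g 0) ^ 2) laplace := by
  have hgc := hg.continuous
  refine Integrable.mono' ((integrable_laplace_abs_pow 2).const_mul (K ^ 2 : ℝ)) (by fun_prop)
    (Filter.Eventually.of_forall fun t => ?_)
  have h := hg.dist_le_mul t 0
  rw [Real.dist_eq, Real.dist_eq, sub_zero] at h
  rw [Real.norm_of_nonneg (by positivity), ← mul_pow, ← sq_abs (g t - g 0)]
  gcongr

theorem integrable_laplace_sq_deriv {g : ℝ → ℝ} {K : ℝ≥0} (hg : LipschitzWith K g) :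
    Integrable (fun t => deriv g t ^ 2) laplace := by
  have hgd := measurable_deriv g
  refine Integrable.mono' (integrable_const (K ^ 2 : ℝ)) (by fun_prop)
    (Filter.Eventually.of_forall fun t => ?_)
  have h := norm_deriv_le_of_lipschitz (x₀ := t) hg
  rw [Real.norm_of_nonneg (by positivity), ← sq_abs]
  gcongr
  exact h

/-- The half-line inequality for `g` and for its reflection. Subtracting `g 0` instead of the mean
is what allows the two halves to be treated separately. -/
theorem laplace_hardy {g : ℝ → ℝ} {K : ℝ≥0} (hg : LipschitzWith K g) :
    ∫ t, (g t - g 0) ^ 2 ∂laplace ≤ 4 * ∫ t, deriv g t ^ 2 ∂laplace := by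
  obtain ⟨a1, a2, a3⟩ := half_line_hardy hg
  have hg' : LipschitzWith K fun t => g (-t) := by
    simpa [Function.comp_def] using hg.comp (LipschitzWith.id.neg)
  obtain ⟨b1, b2, b3⟩ := half_line_hardy hg'
  simp only [deriv_comp_neg, neg_zero, neg_sq] at b1 b2 b3
  rw [integral_laplace, integral_laplace,
    integral_eq_integral_Ioi_add (integrable_laplace_iff.1 (integrable_laplace_sq_sub hg)),
    integral_eq_integral_Ioi_add (integrable_laplace_iff.1 (integrable_laplace_sq_deriv hg))]
  have e1 : ∫ x in Set.Ioi (0 : ℝ), (Real.exp (-|x|) / 2 * (g x - g 0) ^ 2 +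
      Real.exp (-|-x|) / 2 * (g (-x) - g 0) ^ 2) =
      ((∫ t in Set.Ioi (0 : ℝ), (g t - g 0) ^ 2 * Real.exp (-t)) +
      ∫ t in Set.Ioi (0 : ℝ), (g (-t) - g 0) ^ 2 * Real.exp (-t)) / 2 := by
    rw [← integral_add a1 b1, ← integral_div]
    refine setIntegral_congr_fun measurableSet_Ioi fun x hx => ?_
    simp only [abs_neg, abs_of_pos (Set.mem_Ioi.1 hx)]
    ring
  have e2 : ∫ x in Set.Ioi (0 : ℝ), (Real.exp (-|x|) / 2 * deriv g x ^ 2 +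
      Real.exp (-|-x|) / 2 * deriv g (-x) ^ 2) =
      ((∫ t in Set.Ioi (0 : ℝ), deriv g t ^ 2 * Real.exp (-t)) +
      ∫ t in Set.Ioi (0 : ℝ), deriv g (-t) ^ 2 * Real.exp (-t)) / 2 := by
    rw [← integral_add a2 b2, ← integral_div]
    refine setIntegral_congr_fun measurableSet_Ioi fun x hx => ?_
    simp only [abs_neg, abs_of_pos (Set.mem_Ioi.1 hx)]
    ring
  rw [e1, e2]
  linarith

end LaplaceOneDim

/-! ### The Poincaré inequality for products of Laplace distributions. -/

section Poincare

variable {n : ℕ}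

/-- The product of `n` Laplace distributions. -/
abbrev laplacePi (n : ℕ) : Measure (Fin n → ℝ) := Measure.pi fun _ => laplace

theorem sq_integral_le_integral_sq {α : Type*} [MeasurableSpace α] {μ : Measure α}
    [IsProbabilityMeasure μ] {f : α → ℝ} (hf : MemLp f 2 μ) :
    (∫ x, f x ∂μ) ^ 2 ≤ ∫ x, f x ^ 2 ∂μ := by
  have h := variance_nonneg f μ
  rw [variance_eq_sub hf] at h
  simpa using h

/-- The mean is the best constant in mean square; a variance may thus be bounded by centring at the
value at `0`, as the Hardy inequality requires. -/
theorem integral_sq_sub_le {α : Type*} [MeasurableSpace α] {μ : Measure α}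
    [IsProbabilityMeasure μ] {f : α → ℝ} (hf : MemLp f 2 μ) (c : ℝ) :
    ∫ x, f x ^ 2 ∂μ - (∫ x, f x ∂μ) ^ 2 ≤ ∫ x, (f x - c) ^ 2 ∂μ := by
  have h1 : Integrable f μ := hf.integrable (by norm_num)
  have h2 : Integrable (fun x => f x ^ 2) μ := hf.integrable_sq
  have h3 : ∫ x, (f x - c) ^ 2 ∂μ = ∫ x, f x ^ 2 ∂μ - 2 * c * ∫ x, f x ∂μ + c ^ 2 := by
    have h4 : ∀ x, (f x - c) ^ 2 = f x ^ 2 - 2 * c * f x + c ^ 2 := fun x => by ring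
    simp_rw [h4]
    have h5 : Integrable (fun x => 2 * c * f x) μ := h1.const_mul _
    have h6 : Integrable (fun x => f x ^ 2 - 2 * c * f x) μ := h2.sub h5
    rw [integral_add h6 (integrable_const _), integral_sub h2 h5, integral_const_mul]
    simp
  rw [h3]
  nlinarith [sq_nonneg (∫ x, f x ∂μ - c)]

theorem memLp_of_lipschitz_laplace {g : ℝ → ℝ} {K : ℝ≥0} (hg : LipschitzWith K g) :
    MemLp g 2 laplace := by
  have h : MemLp (fun t => g t - g 0) 2 laplace :=
    (memLp_two_iff_integrable_sq (hg.continuous.sub continuous_const).aestronglyMeasurable).2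
      (integrable_laplace_sq_sub hg)
  simpa [Pi.add_def] using h.add (memLp_const (g 0))

theorem integrable_laplacePi_comp_eval {φ : ℝ → ℝ} (hφ : Integrable φ laplace) (i : Fin n) :
    Integrable (fun x => φ (x i)) (laplacePi n) :=
  (measurePreserving_eval (fun _ : Fin n => laplace) i).integrable_comp_of_integrable hφ

theorem memLp_of_lipschitz_laplacePi {G : (Fin n → ℝ) → ℝ} {K : ℝ≥0} (hG : LipschitzWith K G) :
    MemLp G 2 (laplacePi n) := by
  have hGc := hG.continuous
  have h : MemLp (fun x => G x - G 0) 2 (laplacePi n) := by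
    rw [memLp_two_iff_integrable_sq (by fun_prop)]
    have hb : Integrable (fun x : Fin n → ℝ => (K : ℝ) ^ 2 * ∑ i, |x i| ^ 2) (laplacePi n) :=
      (integrable_finsetSum _ fun i _ =>
        integrable_laplacePi_comp_eval (integrable_laplace_abs_pow 2) i).const_mul _
    refine hb.mono' (by fun_prop) (Filter.Eventually.of_forall fun x => ?_)
    have h := hG.dist_le_mul x 0
    rw [Real.dist_eq, dist_zero_right] at h
    have hx : ‖x‖ ^ 2 ≤ ∑ i, |x i| ^ 2 := by
      have : ‖x‖ ≤ √(∑ i, |x i| ^ 2) := by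
        refine (pi_norm_le_iff_of_nonneg (by positivity)).2 fun i => ?_
        refine Real.le_sqrt_of_sq_le ?_
        rw [Real.norm_eq_abs]
        exact Finset.single_le_sum (f := fun i => |x i| ^ 2) (fun i _ => by positivity)
          (Finset.mem_univ i)
      calc ‖x‖ ^ 2 ≤ √(∑ i, |x i| ^ 2) ^ 2 := by gcongr
        _ = _ := Real.sq_sqrt (by positivity)
    rw [Real.norm_of_nonneg (by positivity), ← sq_abs]
    calc |G x - G 0| ^ 2 ≤ (K * ‖x‖) ^ 2 := by gcongr
      _ = K ^ 2 * ‖x‖ ^ 2 := by ring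
      _ ≤ _ := by gcongr
  simpa [Pi.add_def] using h.add (memLp_const (G 0))

/-- The partial derivative in direction `i`. -/
def pderiv (G : (Fin n → ℝ) → ℝ) (i : Fin n) (x : Fin n → ℝ) : ℝ :=
  lineDeriv ℝ G x (Pi.single i 1)

theorem measurable_pderiv {G : (Fin n → ℝ) → ℝ} {K : ℝ≥0} (hG : LipschitzWith K G) (i : Fin n) :
    Measurable (pderiv G i) := measurable_lineDeriv hG.continuous

theorem sq_pderiv_le {G : (Fin n → ℝ) → ℝ} {K : ℝ≥0} (hG : LipschitzWith K G) (i : Fin n)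
    (x : Fin n → ℝ) : pderiv G i x ^ 2 ≤ (K : ℝ) ^ 2 := by
  have h := norm_lineDeriv_le_of_lipschitz ℝ hG (x₀ := x) (v := Pi.single i 1)
  rw [Pi.norm_single, norm_one, mul_one] at h
  rw [← sq_abs]
  unfold pderiv
  gcongr
  exact h

theorem integrable_sq_pderiv {α : Type*} [MeasurableSpace α] {μ : Measure α} [IsFiniteMeasure μ]
    {G : (Fin n → ℝ) → ℝ} {K : ℝ≥0} (hG : LipschitzWith K G) (i : Fin n) {φ : α → Fin n → ℝ}
    (hφ : Measurable φ) : Integrable (fun x => pderiv G i (φ x) ^ 2) μ := by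
  refine (integrable_const ((K : ℝ) ^ 2)).mono'
    (((measurable_pderiv hG i).comp hφ).pow_const 2).aestronglyMeasurable
    (Filter.Eventually.of_forall fun x => ?_)
  rw [Real.norm_of_nonneg (by positivity)]
  exact sq_pderiv_le hG i _

/-- Prepending a coordinate to a vector. -/
def consPi (a : ℝ) (y : Fin n → ℝ) : Fin (n + 1) → ℝ := Fin.cons a y

theorem continuous_consPi : Continuous fun z : ℝ × (Fin n → ℝ) => consPi z.1 z.2 := by
  refine continuous_pi fun i => ?_
  refine Fin.cases ?_ (fun i => ?_) i
  · exact continuous_fst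
  · exact (continuous_apply i).comp continuous_snd

theorem measurePreserving_consPi : MeasurePreserving
    (fun z : ℝ × (Fin n → ℝ) => consPi z.1 z.2) (laplace.prod (laplacePi n))
    (laplacePi (n + 1)) := by
  have h := (measurePreserving_piFinSuccAbove (fun _ : Fin (n + 1) => laplace) 0).symm
  have e : (fun z : ℝ × (Fin n → ℝ) => consPi z.1 z.2) =
      (MeasurableEquiv.piFinSuccAbove (fun _ : Fin (n + 1) => ℝ) 0).symm := by
    ext z i
    simp only [MeasurableEquiv.piFinSuccAbove_symm_apply, consPi, Fin.insertNthEquiv_apply,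
      Fin.insertNth_zero']
  rw [e]
  exact h

theorem dist_consPi_left (a b : ℝ) (y : Fin n → ℝ) : dist (consPi a y) (consPi b y) ≤ dist a b := by
  refine (dist_pi_le_iff dist_nonneg).2 fun i => ?_
  refine Fin.cases ?_ (fun i => ?_) i <;> simp [consPi]

theorem dist_consPi_right (a : ℝ) (y z : Fin n → ℝ) :
    dist (consPi a y) (consPi a z) ≤ dist y z := by
  refine (dist_pi_le_iff dist_nonneg).2 fun i => ?_
  refine Fin.cases ?_ (fun i => ?_) i
  · simp [consPi]
  · simpa [consPi] using dist_le_pi_dist y z i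

theorem pderiv_zero_consPi (G : (Fin (n + 1) → ℝ) → ℝ) (a : ℝ) (y : Fin n → ℝ) :
    pderiv G 0 (consPi a y) = deriv (fun s => G (consPi s y)) a := by
  have h : ∀ t : ℝ, consPi a y + t • Pi.single 0 1 = consPi (t + a) y := by
    intro t
    ext i
    refine Fin.cases ?_ (fun i => ?_) i
    · simp [consPi, add_comm]
    · simp [consPi]
  simp only [pderiv, lineDeriv, h]
  rw [deriv_comp_add_const (fun s => G (consPi s y)), zero_add]

theorem pderiv_succ_consPi (G : (Fin (n + 1) → ℝ) → ℝ) (a : ℝ) (y : Fin n → ℝ) (i : Fin n) :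
    pderiv G i.succ (consPi a y) = pderiv (fun z => G (consPi a z)) i y := by
  have h : ∀ t : ℝ, consPi a y + t • Pi.single i.succ 1 = consPi a (y + t • Pi.single i 1) := by
    intro t
    ext j
    refine Fin.cases ?_ (fun j => ?_) j
    · simp [consPi]
    · simp [consPi, Pi.single_apply]
  simp only [pderiv, lineDeriv, h]

/-- The Poincaré inequality for the product of Laplace distributions. -/
theorem laplacePi_poincare : ∀ {n : ℕ} {G : (Fin n → ℝ) → ℝ} {K : ℝ≥0}, LipschitzWith K G →
    ∫ x, G x ^ 2 ∂laplacePi n - (∫ x, G x ∂laplacePi n) ^ 2 ≤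
      4 * ∫ x, ∑ i, pderiv G i x ^ 2 ∂laplacePi n := by
  intro n
  induction n with
  | zero =>
    intro G K hG
    have h : ∀ x : Fin 0 → ℝ, G x = G 0 := fun x => congrArg G (Subsingleton.elim _ _)
    simp [h]
  | succ n ih =>
    intro G K hG
    have hGc := hG.continuous
    have hcc := continuous_consPi (n := n)
    have hmp := measurePreserving_consPi (n := n)
    have hLp : MemLp (fun z : ℝ × (Fin n → ℝ) => G (consPi z.1 z.2)) 2
        (laplace.prod (laplacePi n)) :=
      (memLp_of_lipschitz_laplacePi hG).comp_measurePreserving hmp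
    have hi2 := hLp.integrable_sq
    have hi1 := hLp.integrable (by norm_num)
    have hcomp : ∀ F : (Fin (n + 1) → ℝ) → ℝ, AEStronglyMeasurable F (laplacePi (n + 1)) →
        ∫ x, F x ∂laplacePi (n + 1) =
          ∫ z, F (consPi z.1 z.2) ∂(laplace.prod (laplacePi n)) := by
      intro F hF
      rw [← hmp.map_eq, integral_map hmp.measurable.aemeasurable (by rwa [hmp.map_eq])]
    have hGr : ∀ a, LipschitzWith K fun y => G (consPi a y) := fun a =>
      LipschitzWith.of_dist_le_mul fun y z => (hG.dist_le_mul _ _).trans (by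
        gcongr
        exact dist_consPi_right a y z)
    have hGl : ∀ y, LipschitzWith K fun a => G (consPi a y) := fun y =>
      LipschitzWith.of_dist_le_mul fun a b => (hG.dist_le_mul _ _).trans (by
        gcongr
        exact dist_consPi_left a b y)
    -- The conditional mean given the first coordinate. The total variance is the mean of the
    -- conditional variances (induction hypothesis) plus the variance of `m`.
    set m : ℝ → ℝ := fun a => ∫ y, G (consPi a y) ∂laplacePi n with hm
    have hyi : ∀ a, Integrable (fun y => G (consPi a y)) (laplacePi n) := fun a =>
      (memLp_of_lipschitz_laplacePi (hGr a)).integrable (by norm_num)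
    have hmL : LipschitzWith K m := LipschitzWith.of_dist_le_mul fun a b => by
      rw [Real.dist_eq, hm, ← integral_sub (hyi a) (hyi b)]
      have h := norm_integral_le_of_norm_le_const (μ := laplacePi n) (C := K * dist a b)
        (f := fun y => G (consPi a y) - G (consPi b y))
        (Filter.Eventually.of_forall fun y => (hGl y).dist_le_mul a b)
      simpa using h
    have hmLp := memLp_of_lipschitz_laplace hmL
    have hD : ∀ i, Integrable (fun z : ℝ × (Fin n → ℝ) => pderiv G i (consPi z.1 z.2) ^ 2)
        (laplace.prod (laplacePi n)) := fun i => integrable_sq_pderiv hG i hcc.measurable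
    have hDs : Integrable (fun z : ℝ × (Fin n → ℝ) =>
        ∑ i : Fin n, pderiv G i.succ (consPi z.1 z.2) ^ 2) (laplace.prod (laplacePi n)) :=
      integrable_finsetSum _ fun i _ => hD i.succ
    have hmeas : AEStronglyMeasurable (fun x => ∑ i, pderiv G i x ^ 2) (laplacePi (n + 1)) := by
      refine Measurable.aestronglyMeasurable (Finset.measurable_fun_sum _ fun i _ => ?_)
      exact (measurable_pderiv hG i).pow_const 2
    -- the variance in the last coordinates
    have hfirst : ∫ a, ((∫ y, G (consPi a y) ^ 2 ∂laplacePi n) - m a ^ 2) ∂laplace ≤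
        4 * ∫ a, ∫ y, ∑ i : Fin n, pderiv G i.succ (consPi a y) ^ 2 ∂laplacePi n ∂laplace := by
      rw [← integral_const_mul]
      refine integral_mono (hi2.integral_prod_left.sub hmLp.integrable_sq)
        (hDs.integral_prod_left.const_mul 4) fun a => ?_
      simp only [pderiv_succ_consPi]
      exact ih (hGr a)
    -- the variance in the first coordinate
    have hcross : Integrable (fun z : ℝ × (Fin n → ℝ) => (G (consPi z.1 z.2) - G (consPi 0 z.2)) ^ 2)
        (laplace.prod (laplacePi n)) := by
      have hb := (((integrable_laplace_abs_pow 2).const_mul ((K : ℝ) ^ 2))).comp_fst (laplacePi n)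
      have hc0 : Continuous fun z : ℝ × (Fin n → ℝ) => G (consPi 0 z.2) :=
        hGc.comp (hcc.comp (by fun_prop : Continuous fun z : ℝ × (Fin n → ℝ) => ((0 : ℝ), z.2)))
      have hc1 := hGc.comp hcc
      refine hb.mono' ((hc1.sub hc0).pow 2).aestronglyMeasurable
        (Filter.Eventually.of_forall fun z => ?_)
      have h := (hGl z.2).dist_le_mul z.1 0
      rw [Real.dist_eq, dist_zero_right, Real.norm_eq_abs] at h
      rw [Real.norm_of_nonneg (by positivity), ← sq_abs, ← mul_pow]
      gcongr
    have hsecond : ∫ a, m a ^ 2 ∂laplace - (∫ a, m a ∂laplace) ^ 2 ≤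
        4 * ∫ z, pderiv G 0 (consPi z.1 z.2) ^ 2 ∂(laplace.prod (laplacePi n)) := by
      refine (integral_sq_sub_le hmLp (m 0)).trans ?_
      have h1 : ∫ a, (m a - m 0) ^ 2 ∂laplace ≤
          ∫ a, ∫ y, (G (consPi a y) - G (consPi 0 y)) ^ 2 ∂laplacePi n ∂laplace := by
        refine integral_mono (integrable_laplace_sq_sub hmL) hcross.integral_prod_left fun a => ?_
        simp only [hm]
        rw [← integral_sub (hyi a) (hyi 0)]
        -- Jensen's inequality moves the square inside the average over the other coordinates, after
        -- which the one-dimensional inequality applies for each fixed `y`.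
        exact sq_integral_le_integral_sq ((memLp_of_lipschitz_laplacePi (hGr a)).sub
          (memLp_of_lipschitz_laplacePi (hGr 0)))
      refine h1.trans ?_
      rw [integral_integral_swap hcross, integral_prod_symm _ (hD 0), ← integral_const_mul]
      refine integral_mono hcross.integral_prod_right ((hD 0).integral_prod_right.const_mul 4)
        fun y => ?_
      simp only [pderiv_zero_consPi]
      exact laplace_hardy (hGl y)
    rw [hcomp (fun x => G x ^ 2) (hGc.pow 2).aestronglyMeasurable, hcomp _ hGc.aestronglyMeasurable, hcomp _ hmeas]
    have e1 : ∫ z, G (consPi z.1 z.2) ∂(laplace.prod (laplacePi n)) = ∫ a, m a ∂laplace :=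
      integral_prod _ hi1
    have e2 := integral_prod _ hi2
    have e3 : ∫ z, ∑ i, pderiv G i (consPi z.1 z.2) ^ 2 ∂(laplace.prod (laplacePi n)) =
        ∫ z, pderiv G 0 (consPi z.1 z.2) ^ 2 ∂(laplace.prod (laplacePi n)) +
        ∫ a, ∫ y, ∑ i : Fin n, pderiv G i.succ (consPi a y) ^ 2 ∂laplacePi n ∂laplace := by
      simp only [Fin.sum_univ_succ]
      rw [integral_add (hD 0) hDs, integral_prod _ hDs]
    rw [integral_sub hi2.integral_prod_left hmLp.integrable_sq] at hfirst
    simp only at e2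
    rw [e1, e2, e3]
    linarith

end Poincare

/-! ### The Laplace product measure on Euclidean space: density, variance and moments. -/

section LaplaceVec

variable {d : ℕ}

/-- The product of `d` Laplace distributions, on `ℝ^d`. -/
def laplaceVec (d : ℕ) : Measure (Vec d) := Measure.map (WithLp.toLp 2) (laplacePi d)

theorem measurable_toLp (d : ℕ) : Measurable (WithLp.toLp 2 : (Fin d → ℝ) → Vec d) :=
  (PiLp.continuous_toLp 2 _).measurable

instance : IsProbabilityMeasure (laplaceVec d) :=
  Measure.isProbabilityMeasure_map (measurable_toLp d).aemeasurable

theorem integral_laplaceVec {f : Vec d → ℝ} (hf : Continuous f) :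
    ∫ x, f x ∂laplaceVec d = ∫ x, f (WithLp.toLp 2 x) ∂laplacePi d :=
  integral_map (measurable_toLp d).aemeasurable hf.aestronglyMeasurable

theorem integrable_laplaceVec_iff {f : Vec d → ℝ} (hf : Continuous f) :
    Integrable f (laplaceVec d) ↔ Integrable (fun x => f (WithLp.toLp 2 x)) (laplacePi d) :=
  integrable_map_measure hf.aestronglyMeasurable (measurable_toLp d).aemeasurable

theorem laplacePi_eq_withDensity : laplacePi d =
    volume.withDensity fun x => ENNReal.ofReal (∏ i, Real.exp (-|x i|) / 2) := by
  refine Measure.pi_eq fun s hs => ?_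
  have hint : ∀ i, Integrable (fun x : ℝ => Real.exp (-|x|) / 2) (volume.restrict (s i)) :=
    fun i => integrable_exp_neg_abs.restrict
  have h1 := integral_fintype_prod_eq_prod (𝕜 := ℝ) (μ := fun i => volume.restrict (s i))
    (fun (_ : Fin d) (x : ℝ) => Real.exp (-|x|) / 2)
  rw [withDensity_apply _ (MeasurableSet.univ_pi hs), volume_pi, Measure.restrict_pi_pi,
    ← ofReal_integral_eq_lintegral_ofReal (Integrable.fintype_prod hint)
      (Filter.Eventually.of_forall fun x => by positivity), h1,
    ENNReal.ofReal_prod_of_nonneg fun i _ => integral_nonneg fun x => by positivity]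
  refine Finset.prod_congr rfl fun i _ => ?_
  rw [laplace, withDensity_apply _ (hs i), ofReal_integral_eq_lintegral_ofReal (hint i)
    (Filter.Eventually.of_forall fun x => by positivity)]

/-- The density depends on the `ℓ_1`-norm only; this links the product measure to the sphere. -/
theorem laplaceVec_eq_withDensity : laplaceVec d =
    volume.withDensity fun x => ENNReal.ofReal (Real.exp (-ellNorm 1 x) / 2 ^ d) := by
  have hm := (continuous_ellNorm (d := d) le_rfl).measurable
  have hmp : MeasurePreserving (WithLp.toLp 2 : (Fin d → ℝ) → Vec d) :=
    PiLp.volume_preserving_toLp (Fin d)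
  ext s hs
  rw [laplaceVec, Measure.map_apply (measurable_toLp d) hs, laplacePi_eq_withDensity,
    withDensity_apply _ (measurable_toLp d hs), withDensity_apply _ hs,
    ← hmp.setLIntegral_comp_preimage hs (by fun_prop)]
  congr 1 with x
  rw [Finset.prod_div_distrib, ← Real.exp_sum, ellNorm_one]
  simp

theorem integral_laplaceVec_eq (f : Vec d → ℝ) :
    ∫ x, f x ∂laplaceVec d = ∫ x, Real.exp (-ellNorm 1 x) / 2 ^ d * f x := by
  have hm := (continuous_ellNorm (d := d) le_rfl).measurable
  rw [laplaceVec_eq_withDensity,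
    integral_withDensity_eq_integral_toReal_smul (by fun_prop) (by simp)]
  refine integral_congr_ae (Filter.Eventually.of_forall fun x => ?_)
  simp only [smul_eq_mul]
  rw [ENNReal.toReal_ofReal (by positivity)]

theorem integral_laplaceVec_of_odd {f : Vec d → ℝ} (hf : ∀ x, f (-x) = -f x) :
    ∫ x, f x ∂laplaceVec d = 0 := by
  have h := integral_neg_eq_self (fun x : Vec d => Real.exp (-ellNorm 1 x) / 2 ^ d * f x) volume
  simp only [ellNorm_neg le_rfl, hf, mul_neg, integral_neg] at h
  rw [integral_laplaceVec_eq]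
  linarith

theorem lipschitz_comp_toLp {F : Vec d → ℝ} {L : ℝ≥0} (hF : LipschitzWith L F) :
    ∃ K, LipschitzWith K fun x => F (WithLp.toLp 2 x) :=
  ⟨_, hF.comp (PiLp.lipschitzWith_toLp 2 fun _ : Fin d => ℝ)⟩

/-- Differentiate along the gradient `v` itself: the derivative is `‖v‖ ^ 2` and is at most `L *
‖v‖`. This recovers the Euclidean Lipschitz constant, where the constant for the supremum metric of
the product space would lose a power of `d`. -/
theorem sum_sq_pderiv_le {F : Vec d → ℝ} {L : ℝ≥0} (hF : LipschitzWith L F) {x : Fin d → ℝ}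
    (hx : DifferentiableAt ℝ (fun x => F (WithLp.toLp 2 x)) x) :
    ∑ i, pderiv (fun x => F (WithLp.toLp 2 x)) i x ^ 2 ≤ (L : ℝ) ^ 2 := by
  set G : (Fin d → ℝ) → ℝ := fun x => F (WithLp.toLp 2 x) with hG
  set v : Fin d → ℝ := fun i => pderiv G i x with hv
  have h1 : lineDeriv ℝ G x v = ∑ i, pderiv G i x ^ 2 := by
    rw [hx.lineDeriv_eq_fderiv]
    have hsum : v = ∑ i, v i • Pi.single i (1 : ℝ) := by
      ext j
      simp [Finset.sum_apply, Pi.single_apply]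
    conv_lhs => rw [hsum]
    rw [map_sum]
    refine Finset.sum_congr rfl fun i _ => ?_
    rw [map_smul, ← hx.lineDeriv_eq_fderiv, smul_eq_mul, sq]
    rfl
  have h2 : |lineDeriv ℝ G x v| ≤ L * ‖(WithLp.toLp 2 v : Vec d)‖ :=
    norm_lineDeriv_le_of_lipschitz ℝ hF (x₀ := WithLp.toLp 2 x) (v := WithLp.toLp 2 v)
  have h3 : ‖(WithLp.toLp 2 v : Vec d)‖ ^ 2 = ∑ i, pderiv G i x ^ 2 := by
    rw [EuclideanSpace.norm_sq_eq]
    simp [hv]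
  rw [h1] at h2
  have h4 := (le_abs_self _).trans h2
  rw [← h3] at h4 ⊢
  have h5 := norm_nonneg (WithLp.toLp 2 v : Vec d)
  have hL := L.coe_nonneg
  by_contra! hlt
  nlinarith

theorem laplaceVec_poincare {F : Vec d → ℝ} {L : ℝ≥0} (hF : LipschitzWith L F)
    (h0 : ∫ x, F x ∂laplaceVec d = 0) : ∫ x, F x ^ 2 ∂laplaceVec d ≤ 4 * (L : ℝ) ^ 2 := by
  obtain ⟨K, hK⟩ := lipschitz_comp_toLp hF
  have h := laplacePi_poincare hK
  rw [integral_laplaceVec hF.continuous] at h0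
  rw [h0] at h
  rw [integral_laplaceVec (f := fun x => F x ^ 2) (hF.continuous.pow 2)]
  have hae : ∀ᵐ x ∂laplacePi d, DifferentiableAt ℝ (fun x => F (WithLp.toLp 2 x)) x := by
    rw [laplacePi_eq_withDensity]
    exact (withDensity_absolutelyContinuous _ _).ae_le hK.ae_differentiableAt
  have h2 : ∫ x, ∑ i, pderiv (fun x => F (WithLp.toLp 2 x)) i x ^ 2 ∂laplacePi d ≤ (L : ℝ) ^ 2 := by
    have := integral_mono_ae (integrable_finsetSum _ fun i _ =>
      integrable_sq_pderiv (μ := laplacePi d) hK i measurable_id) (integrable_const ((L : ℝ) ^ 2))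
      (hae.mono fun x hx => sum_sq_pderiv_le hF hx)
    simpa using this
  linarith

theorem memLp_of_lipschitz_laplaceVec {F : Vec d → ℝ} {L : ℝ≥0} (hF : LipschitzWith L F) :
    MemLp F 2 (laplaceVec d) := by
  obtain ⟨K, hK⟩ := lipschitz_comp_toLp hF
  exact (memLp_map_measure_iff hF.continuous.aestronglyMeasurable
    (measurable_toLp d).aemeasurable).2 (memLp_of_lipschitz_laplacePi hK)

theorem integral_norm_sq_laplaceVec : ∫ x, ‖x‖ ^ 2 ∂laplaceVec d = 2 * d := by
  rw [integral_laplaceVec (by fun_prop)]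
  simp only [EuclideanSpace.norm_sq_eq, Real.norm_eq_abs]
  rw [integral_finsetSum _ fun i _ =>
    integrable_laplacePi_comp_eval (integrable_laplace_abs_pow 2) i]
  have h : ∀ i : Fin d, ∫ x : Fin d → ℝ, |x i| ^ 2 ∂laplacePi d = 2 := by
    intro i
    have h1 := (measurePreserving_eval (fun _ : Fin d => laplace) i)
    have h2 : ∫ t, |t| ^ 2 ∂laplace = ∫ x : Fin d → ℝ, |x i| ^ 2 ∂laplacePi d := by
      rw [← h1.map_eq, integral_map h1.measurable.aemeasurable (by fun_prop)]
    rw [← h2]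
    have h3 := integral_abs_rpow_laplace (s := 2) (by norm_num)
    have h4 : Real.Gamma (2 + 1) = 2 := by
      have := Real.Gamma_nat_eq_factorial 2
      norm_num at this ⊢
    rw [← h4, ← h3]
    simp
  rw [Finset.sum_congr rfl fun i _ => h i]
  simp [mul_comm]

theorem integrable_ellNorm_rpow_laplaceVec {q : ℝ≥0∞} (hq : 1 ≤ q) (hq' : q ≠ ∞) :
    Integrable (fun x => ellNorm q x ^ q.toReal) (laplaceVec d) ∧
    ∫ x, ellNorm q x ^ q.toReal ∂laplaceVec d = d * Real.Gamma (q.toReal + 1) := by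
  have hq0 : 0 < q.toReal := ENNReal.toReal_pos (by positivity) hq'
  have hc : Continuous fun x : Vec d => ellNorm q x ^ q.toReal :=
    (continuous_ellNorm hq).rpow_const fun _ => Or.inr hq0.le
  have h : ∀ x : Vec d, ellNorm q x ^ q.toReal = ∑ i, |x i| ^ q.toReal := by
    intro x
    rw [ellNorm_eq_sum hq hq', one_div, Real.rpow_inv_rpow (by positivity) hq0.ne']
  have hint : ∀ i : Fin d, Integrable (fun x : Fin d → ℝ => |x i| ^ q.toReal) (laplacePi d) :=
    fun i => integrable_laplacePi_comp_eval (integrable_abs_rpow_laplace hq0.le) i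
  rw [integrable_laplaceVec_iff hc, integral_laplaceVec hc]
  simp only [h]
  refine ⟨integrable_finsetSum _ fun i _ => hint i, ?_⟩
  rw [integral_finsetSum _ fun i _ => hint i]
  have h2 : ∀ i : Fin d, ∫ x : Fin d → ℝ, |x i| ^ q.toReal ∂laplacePi d =
      Real.Gamma (q.toReal + 1) := by
    intro i
    have h1 := (measurePreserving_eval (fun _ : Fin d => laplace) i)
    rw [← integral_abs_rpow_laplace hq0.le, ← h1.map_eq,
      integral_map h1.measurable.aemeasurable
        (Measurable.pow_const (by fun_prop) _).aestronglyMeasurable]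
  simp [h2]

/-- Convexity and `Γ(1) = Γ(2) = 1` give `Γ ≤ 1` on `[1, 2]`, hence the claim there; the functional
equation propagates it in unit steps. -/
theorem Gamma_add_one_le_rpow {x : ℝ} (hx : 1 ≤ x) : Real.Gamma (x + 1) ≤ x ^ x := by
  have base : ∀ y : ℝ, 1 ≤ y → y ≤ 2 → Real.Gamma (y + 1) ≤ y ^ y := by
    intro y h1 h2
    have hG : Real.Gamma y ≤ 1 := by
      have hc := Real.convexOn_Gamma
      have := hc.2 (Set.mem_Ioi.2 one_pos) (Set.mem_Ioi.2 two_pos) (sub_nonneg.2 h2)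
        (sub_nonneg.2 h1) (by ring)
      rw [Real.Gamma_one, Real.Gamma_two] at this
      have e : (2 - y) • (1 : ℝ) + (y - 1) • 2 = y := by simp; ring
      rw [e] at this
      simp only [smul_eq_mul] at this
      linarith
    rw [Real.Gamma_add_one (by linarith)]
    calc y * Real.Gamma y ≤ y * 1 := by gcongr
      _ = y ^ (1 : ℝ) := by simp
      _ ≤ y ^ y := Real.rpow_le_rpow_of_exponent_le h1 h1
  have step : ∀ n : ℕ, ∀ y : ℝ, 1 ≤ y → y ≤ n + 2 → Real.Gamma (y + 1) ≤ y ^ y := by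
    intro n
    induction n with
    | zero => intro y h1 h2; exact base y h1 (by simpa using h2)
    | succ n ih =>
      intro y h1 h2
      rcases le_total y 2 with h | h
      · exact base y h1 h
      · have h3 := ih (y - 1) (by linarith) (by push_cast at h2; linarith)
        rw [sub_add_cancel] at h3
        rw [Real.Gamma_add_one (by linarith)]
        calc y * Real.Gamma y ≤ y * (y - 1) ^ (y - 1) := by gcongr
          _ ≤ y * y ^ (y - 1) := by
              gcongr
              linarith
          _ = y ^ y := by
              rw [mul_comm, ← Real.rpow_add_one (by linarith), sub_add_cancel]
  obtain ⟨n, hn⟩ := exists_nat_ge x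
  exact step n x hx (by linarith)

/-- By Jensen's inequality the mean is at most `(d * Γ(q + 1)) ^ (1 / q)`, and `Γ(q + 1) ≤ q ^ q`.
-/
theorem integral_ellNorm_laplaceVec_le {q : ℝ≥0∞} (hq : 1 ≤ q) (hq' : q ≠ ∞) :
    Integrable (ellNorm q) (laplaceVec d) ∧
    ∫ x, ellNorm q x ∂laplaceVec d ≤ q.toReal * (d : ℝ) ^ (1 / q).toReal := by
  have h1q : 1 ≤ q.toReal := by
    rw [← ENNReal.toReal_one]
    exact ENNReal.toReal_mono hq' hq
  obtain ⟨h1, h2⟩ := integrable_ellNorm_rpow_laplaceVec (d := d) hq hq'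
  have hi : Integrable (ellNorm q) (laplaceVec d) := by
    refine (h1.add (integrable_const 1)).mono' (continuous_ellNorm hq).aestronglyMeasurable
      (Filter.Eventually.of_forall fun x => ?_)
    have h0 := ellNorm_nonneg hq x
    rw [Real.norm_of_nonneg h0, Pi.add_apply]
    rcases le_total (ellNorm q x) 1 with h | h
    · have : 0 ≤ ellNorm q x ^ q.toReal := by positivity
      linarith
    · have := Real.rpow_le_rpow_of_exponent_le h h1q
      rw [Real.rpow_one] at this
      linarith
  refine ⟨hi, ?_⟩
  have hJ := (convexOn_rpow h1q).map_integral_le (μ := laplaceVec d) (f := ellNorm q)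
    (continuousOn_id.rpow_const fun x _ => Or.inr (by linarith)) isClosed_Ici
    (Filter.Eventually.of_forall fun x => ellNorm_nonneg hq x) hi h1
  simp only [h2] at hJ
  have hI : 0 ≤ ∫ x, ellNorm q x ∂laplaceVec d := integral_nonneg fun x => ellNorm_nonneg hq x
  refine (Real.rpow_le_rpow_iff hI (by positivity) (by linarith : 0 < q.toReal)).1 ?_
  refine hJ.trans ?_
  have e : (1 / q).toReal * q.toReal = 1 := by
    rw [one_div, ENNReal.toReal_inv]
    field_simp
  rw [Real.mul_rpow (by positivity) (by positivity), ← Real.rpow_mul (by positivity), e,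
    Real.rpow_one, mul_comm]
  gcongr
  exact Gamma_add_one_le_rpow h1q

end LaplaceVec

/-! ### Independence of radius and direction, and the second moment on the sphere. -/

section Radial

variable {d : ℕ} {C : ℝ} {Q : Measure (Vec d)}

/-- The measure on `(0, ∞)` with density `w r * r ^ (d - 1)`. -/
def radial (d : ℕ) (w : ℝ → ℝ) : Measure ℝ :=
  (volume.restrict (Set.Ioi 0)).withDensity fun r => ENNReal.ofReal (w r * r ^ (d - 1))

instance (w : ℝ → ℝ) : SFinite (radial d w) := by
  unfold radial
  infer_instance

theorem measurable_smul_prod : Measurable fun z : ℝ × Vec d => z.1 • z.2 :=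
  (continuous_fst.smul continuous_snd).measurable

/-- A density that is a function of the `ℓ_1`-norm makes radius and direction independent. It is
applied to the Laplace density, to the indicator of the ball and to that of a thin shell. -/
theorem IsPolar.withDensity_eq (hQ : IsPolar C Q) {w : ℝ → ℝ} (hw : Measurable w)
    (hw0 : ∀ r, 0 ≤ w r) :
    (volume : Measure (Vec d)).withDensity (fun x => ENNReal.ofReal (w (ellNorm 1 x))) =
      Measure.map (fun z : ℝ × Vec d => z.1 • z.2) ((radial d fun r => C * w r).prod Q) := by
  have := hQ.prob
  have hm := (continuous_ellNorm (d := d) le_rfl).measurable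
  have hs := measurable_smul_prod (d := d)
  refine Measure.ext_of_lintegral _ fun f hf => ?_
  rw [lintegral_withDensity_eq_lintegral_mul _ (by fun_prop) hf, lintegral_map hf hs,
    lintegral_prod (fun z : ℝ × Vec d => f (z.1 • z.2)) (hf.comp hs).aemeasurable, hQ.lintegral_eq _ (by fun_prop), radial,
    lintegral_withDensity_eq_lintegral_mul _ (by fun_prop)
      (Measurable.lintegral_prod_right (f := fun r y => f (r • y)) (hf.comp hs)),
    ← lintegral_const_mul' _ _ ENNReal.ofReal_ne_top]
  refine setLIntegral_congr_fun measurableSet_Ioi fun r hr => ?_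
  have hr0 : 0 < r := hr
  have h1 : ∫⁻ y, (fun x => ENNReal.ofReal (w (ellNorm 1 x)) * f x) (r • y) ∂Q =
      ENNReal.ofReal (w r) * ∫⁻ y, f (r • y) ∂Q := by
    rw [← lintegral_const_mul' _ _ ENNReal.ofReal_ne_top]
    refine lintegral_congr_ae (hQ.ae_norm.mono fun y hy => ?_)
    simp only [ellNorm_smul le_rfl, hy, abs_of_pos hr0, mul_one]
  simp only [Pi.mul_apply] at h1 ⊢
  have h2 := hQ.pos
  rw [h1, mul_assoc C, ENNReal.ofReal_mul hQ.pos.le, ENNReal.ofReal_mul (hw0 r)]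
  ring

theorem measure_radial_univ {w : ℝ → ℝ}
    (hw : IntegrableOn (fun r => w r * r ^ (d - 1)) (Set.Ioi 0)) (hw0 : ∀ r, 0 ≤ w r) :
    radial d w Set.univ = ENNReal.ofReal (∫ r in Set.Ioi (0 : ℝ), w r * r ^ (d - 1)) := by
  rw [radial, withDensity_apply _ MeasurableSet.univ, Measure.restrict_univ,
    ofReal_integral_eq_lintegral_ofReal hw]
  refine (ae_restrict_mem measurableSet_Ioi).mono fun r hr => ?_
  have : 0 < r := hr
  exact mul_nonneg (hw0 r) (by positivity)

theorem integral_radial {w : ℝ → ℝ} (hw : Measurable w) (hw0 : ∀ r, 0 ≤ w r) (f : ℝ → ℝ) :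
    ∫ r, f r ∂radial d w = ∫ r in Set.Ioi (0 : ℝ), w r * r ^ (d - 1) * f r := by
  rw [radial, integral_withDensity_eq_integral_toReal_smul (by fun_prop) (by simp)]
  refine setIntegral_congr_fun measurableSet_Ioi fun r hr => ?_
  have : 0 < r := hr
  simp only [smul_eq_mul]
  rw [ENNReal.toReal_ofReal (mul_nonneg (hw0 r) (by positivity))]

theorem integrable_radial_iff {w : ℝ → ℝ} (hw : Measurable w) (hw0 : ∀ r, 0 ≤ w r) {f : ℝ → ℝ} :
    Integrable f (radial d w) ↔
      IntegrableOn (fun r => w r * r ^ (d - 1) * f r) (Set.Ioi 0) := by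
  rw [radial, integrable_withDensity_iff_integrable_smul' (by fun_prop) (by simp)]
  refine integrable_congr ((ae_restrict_mem measurableSet_Ioi).mono fun r hr => ?_)
  have : 0 < r := hr
  simp only [smul_eq_mul]
  rw [ENNReal.toReal_ofReal (mul_nonneg (hw0 r) (by positivity))]

theorem ae_radial_pos (w : ℝ → ℝ) : ∀ᵐ r ∂radial d w, 0 < r :=
  (withDensity_absolutelyContinuous _ _).ae_le (ae_restrict_mem measurableSet_Ioi)

/-- The distribution of the `ℓ_1`-norm of a vector with independent Laplace coordinates. -/
def gammaRadial (d : ℕ) : Measure ℝ :=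
  radial d fun r => (((d - 1).factorial : ℝ))⁻¹ * Real.exp (-r)

/-- The total mass `1` of the Laplace law determines the unknown constant `C`. -/
theorem IsPolar.const_eq (hQ : IsPolar C Q) : C / 2 ^ d = ((d - 1).factorial : ℝ)⁻¹ ∧
    laplaceVec d = Measure.map (fun z : ℝ × Vec d => z.1 • z.2) ((gammaRadial d).prod Q) := by
  have := hQ.prob
  have h := hQ.withDensity_eq (w := fun r => Real.exp (-r) / 2 ^ d) (by fun_prop)
    (fun r => by positivity)
  rw [← laplaceVec_eq_withDensity] at h
  have h1 := congrArg (fun μ : Measure (Vec d) => μ Set.univ) h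
  have hC := hQ.pos
  have e : ∀ r : ℝ, C * (Real.exp (-r) / 2 ^ d) * r ^ (d - 1) =
      C / 2 ^ d * (r ^ (d - 1) * Real.exp (-r)) := fun r => by ring
  have hI : ∫ r in Set.Ioi (0 : ℝ), r ^ (d - 1) * Real.exp (-r) = (d - 1).factorial := by
    have := integral_rpow_mul_exp_neg (s := ((d - 1 : ℕ) : ℝ)) (by
      have : (0 : ℝ) ≤ ((d - 1 : ℕ) : ℝ) := by positivity
      linarith)
    rw [Real.Gamma_nat_eq_factorial] at this
    simpa using this
  simp only [measure_univ] at h1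
  rw [Measure.map_apply measurable_smul_prod MeasurableSet.univ, Set.preimage_univ,
    ← Set.univ_prod_univ, Measure.prod_prod, measure_univ (μ := Q), mul_one, measure_radial_univ
    (by
      simp only [e]
      exact (integrableOn_pow_mul_exp_neg (d - 1)).const_mul (C / 2 ^ d))
    (fun r => by positivity)] at h1
  simp only [e] at h1
  rw [integral_const_mul, hI, eq_comm, ENNReal.ofReal_eq_one] at h1
  have h2 : C / 2 ^ d = ((d - 1).factorial : ℝ)⁻¹ := eq_inv_of_mul_eq_one_left h1
  refine ⟨h2, ?_⟩
  rw [h, gammaRadial, ← h2]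
  congr 3
  ext r
  ring

theorem integrable_pow_gammaRadial (k : ℕ) : Integrable (fun r => r ^ k) (gammaRadial d) := by
  rw [gammaRadial, integrable_radial_iff (by fun_prop) fun r => by positivity]
  refine Integrable.congr ((integrableOn_pow_mul_exp_neg (d - 1 + k)).const_mul
    (((d - 1).factorial : ℝ))⁻¹) (Filter.Eventually.of_forall fun r => ?_)
  simp only [pow_add]
  ring

theorem integral_pow_gammaRadial (k : ℕ) :
    ∫ r, r ^ k ∂gammaRadial d = (d - 1 + k).factorial / (d - 1).factorial := by
  rw [gammaRadial, integral_radial (by fun_prop) fun r => by positivity]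
  have h := integral_rpow_mul_exp_neg (s := ((d - 1 + k : ℕ) : ℝ)) (by
      have : (0 : ℝ) ≤ ((d - 1 + k : ℕ) : ℝ) := by positivity
      linarith)
  rw [Real.Gamma_nat_eq_factorial] at h
  simp only [Real.rpow_natCast] at h
  rw [div_eq_inv_mul, ← h, ← integral_const_mul]
  congr 1 with r
  rw [pow_add]
  ring

instance : IsProbabilityMeasure (gammaRadial d) := by
  refine ⟨?_⟩
  have h := integral_pow_gammaRadial (d := d) 0
  have hi := integrable_pow_gammaRadial (d := d) 0
  simp only [pow_zero, add_zero] at h hi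
  have hf : IsFiniteMeasure (gammaRadial d) := by
    rwa [integrable_const_iff_isFiniteMeasure one_ne_zero] at hi
  rw [integral_const, smul_eq_mul, mul_one, div_self (by positivity), Measure.real,
    ENNReal.toReal_eq_one_iff] at h
  exact h

theorem integral_id_gammaRadial (hd : 0 < d) : ∫ r, r ∂gammaRadial d = d := by
  have h := integral_pow_gammaRadial (d := d) 1
  obtain ⟨n, rfl⟩ : ∃ n, d = n + 1 := ⟨d - 1, by omega⟩
  simp only [pow_one, Nat.add_sub_cancel, Nat.factorial_succ, Nat.cast_mul] at h
  rw [h]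
  field_simp

theorem integral_sq_gammaRadial (hd : 0 < d) :
    ∫ r, r ^ 2 ∂gammaRadial d = (d : ℝ) * (d + 1) := by
  have h := integral_pow_gammaRadial (d := d) 2
  obtain ⟨n, rfl⟩ : ∃ n, d = n + 1 := ⟨d - 1, by omega⟩
  simp only [Nat.add_sub_cancel, Nat.factorial_succ, Nat.cast_mul] at h
  rw [h]
  push_cast
  field_simp

theorem integrable_one_sub_div_sq_gammaRadial :
    Integrable (fun r : ℝ => (1 - r / d) ^ 2) (gammaRadial d) := by
  have h := ((integrable_const (1 : ℝ)).sub
    ((integrable_pow_gammaRadial (d := d) 1).const_mul (2 / (d : ℝ)))).add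
    ((integrable_pow_gammaRadial (d := d) 2).const_mul (1 / (d : ℝ) ^ 2))
  refine h.congr (Filter.Eventually.of_forall fun r => ?_)
  simp only [Pi.add_apply, Pi.sub_apply]
  ring

/-- Mean and variance of this Gamma law are both `d`: the radius concentrates around `d` with
relative variance `1 / d`. -/
theorem integral_one_sub_div_sq_gammaRadial (hd : 0 < d) :
    ∫ r : ℝ, (1 - r / d) ^ 2 ∂gammaRadial d = 1 / (d : ℝ) := by
  have h1 : Integrable (fun r => 2 / (d : ℝ) * r ^ 1) (gammaRadial d) :=
    (integrable_pow_gammaRadial (d := d) 1).const_mul (2 / (d : ℝ))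
  have h2 : Integrable (fun r => 1 / (d : ℝ) ^ 2 * r ^ 2) (gammaRadial d) :=
    (integrable_pow_gammaRadial (d := d) 2).const_mul (1 / (d : ℝ) ^ 2)
  have h3 : Integrable (fun r => 1 - 2 / (d : ℝ) * r ^ 1) (gammaRadial d) :=
    (integrable_const (1 : ℝ)).sub h1
  have e : ∀ r : ℝ, (1 - r / d) ^ 2 = 1 - 2 / (d : ℝ) * r ^ 1 + 1 / (d : ℝ) ^ 2 * r ^ 2 :=
    fun r => by ring
  simp_rw [e]
  have hd' : (0 : ℝ) < d := by exact_mod_cast hd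
  rw [integral_add h3 h2, integral_sub (integrable_const _) h1, integral_const_mul,
    integral_const_mul, integral_sq_gammaRadial hd]
  simp only [pow_one]
  rw [integral_id_gammaRadial hd]
  simp
  field_simp
  ring

theorem IsPolar.norm_le_one (hQ : IsPolar C Q) : ∀ᵐ y ∂Q, ‖y‖ ≤ 1 :=
  hQ.ae_norm.mono fun y hy => by
    rw [← ellNorm_two, ← hy]
    exact ellNorm_antitone le_rfl (by norm_num) y

theorem IsPolar.integrable_of_bound (hQ : IsPolar C Q) {f : Vec d → ℝ} (hf : Measurable f)
    {M : ℝ} (hM : ∀ y, ‖y‖ ≤ 1 → |f y| ≤ M) : Integrable f Q := by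
  have := hQ.prob
  exact (integrable_const M).mono' hf.aestronglyMeasurable (hQ.norm_le_one.mono fun y hy => hM y hy)

theorem IsPolar.integrable_continuous (hQ : IsPolar C Q) {f : Vec d → ℝ} (hf : Continuous f) :
    Integrable f Q := by
  obtain ⟨M, hM⟩ := (isCompact_closedBall (0 : Vec d) 1).exists_bound_of_continuousOn
    hf.continuousOn
  exact hQ.integrable_of_bound hf.measurable fun y hy => hM y (by simpa using hy)

theorem IsPolar.integral_laplaceVec_eq (hQ : IsPolar C Q) {f : Vec d → ℝ} (hf : Continuous f) :
    ∫ x, f x ∂laplaceVec d = ∫ z, f (z.1 • z.2) ∂((gammaRadial d).prod Q) := by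
  rw [hQ.const_eq.2, integral_map measurable_smul_prod.aemeasurable hf.aestronglyMeasurable]

theorem IsPolar.integrable_laplaceVec_iff (hQ : IsPolar C Q) {f : Vec d → ℝ} (hf : Continuous f) :
    Integrable f (laplaceVec d) ↔
      Integrable (fun z : ℝ × Vec d => f (z.1 • z.2)) ((gammaRadial d).prod Q) := by
  rw [hQ.const_eq.2, integrable_map_measure hf.aestronglyMeasurable
    measurable_smul_prod.aemeasurable]
  rfl

theorem IsPolar.integral_norm_sq (hQ : IsPolar C Q) (hd : 0 < d) :
    ∫ y, ‖y‖ ^ 2 ∂Q = 2 / ((d : ℝ) + 1) := by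
  have := hQ.prob
  have h := integral_norm_sq_laplaceVec (d := d)
  rw [hQ.integral_laplaceVec_eq (by fun_prop)] at h
  simp only [norm_smul, mul_pow, Real.norm_eq_abs, sq_abs] at h
  rw [integral_prod_mul (fun r : ℝ => r ^ 2) (fun y : Vec d => ‖y‖ ^ 2),
    integral_sq_gammaRadial hd] at h
  have hd' : (0 : ℝ) < d := by exact_mod_cast hd
  rw [eq_div_iff (by positivity)]
  have h3 : (d : ℝ) * ((∫ y, ‖y‖ ^ 2 ∂Q) * (d + 1)) = d * 2 := by linarith
  exact mul_left_cancel₀ hd'.ne' h3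

/-- The second moment of the odd part of a Lipschitz function on the `ℓ_1`-sphere. -/
theorem IsPolar.integral_sq_sub_neg_le (hQ : IsPolar C Q) (hd : 0 < d) {F : Vec d → ℝ} {L : ℝ≥0}
    (hF : LipschitzWith L F) :
    ∫ y, (F y - F (-y)) ^ 2 ∂Q ≤ 48 * (L : ℝ) ^ 2 / (d : ℝ) ^ 2 := by
  have := hQ.prob
  have hd' : (0 : ℝ) < d := by exact_mod_cast hd
  have hFc := hF.continuous
  set φ : Vec d → ℝ := fun y => F y - F (-y) with hφ
  have hφc : Continuous φ := by fun_prop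
  have hφL : LipschitzWith (2 * L) φ := by
    have h1 : LipschitzWith L fun y => F (-y) := by
      simpa [Function.comp_def] using hF.comp (LipschitzWith.id.neg)
    have := hF.sub h1
    rwa [← two_mul] at this
  -- Rescaling by the typical radius `d` makes `ψ (r • y)` close to `φ y` and divides the Lipschitz
  -- constant by `d`; oddness gives mean zero under the Laplace law.
  set ψ : Vec d → ℝ := fun x => φ ((d : ℝ)⁻¹ • x) with hψ
  have hψc : Continuous ψ := by fun_prop
  have hψL : LipschitzWith (2 * L * (d : ℝ≥0)⁻¹) ψ := by
    have := hφL.comp (lipschitzWith_smul (β := Vec d) ((d : ℝ)⁻¹))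
    simpa [Function.comp_def] using this
  have hψ0 : ∫ x, ψ x ∂laplaceVec d = 0 := integral_laplaceVec_of_odd fun x => by
    simp only [hψ, hφ, smul_neg, neg_neg]
    ring
  have h1 := laplaceVec_poincare hψL hψ0
  have hi := (memLp_of_lipschitz_laplaceVec hψL).integrable_sq
  rw [hQ.integrable_laplaceVec_iff (f := fun x => ψ x ^ 2) (hψc.pow 2)] at hi
  rw [hQ.integral_laplaceVec_eq (f := fun x => ψ x ^ 2) (hψc.pow 2)] at h1
  have hi2 : Integrable (fun z : ℝ × Vec d => (1 - z.1 / d) ^ 2 * ‖z.2‖ ^ 2)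
      ((gammaRadial d).prod Q) :=
    (integrable_one_sub_div_sq_gammaRadial).mul_prod
      (hQ.integrable_continuous (f := fun y => ‖y‖ ^ 2) (by fun_prop))
  have hi3 : Integrable (fun z : ℝ × Vec d => φ z.2 ^ 2) ((gammaRadial d).prod Q) :=
    (hQ.integrable_continuous (hφc.pow 2)).comp_snd _
  -- From `φ ^ 2 ≤ 2 ψ ^ 2 + 2 (φ - ψ) ^ 2`. The first term will contribute `2 * 16` by Poincaré and
  -- the second `8 * 2` by the concentration of the radius, in units of `L ^ 2 / d ^ 2`; hence the
  -- `48`.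
  have hpt : ∀ z : ℝ × Vec d, φ z.2 ^ 2 ≤ 2 * ψ (z.1 • z.2) ^ 2 +
      8 * (L : ℝ) ^ 2 * ((1 - z.1 / d) ^ 2 * ‖z.2‖ ^ 2) := by
    rintro ⟨r, y⟩
    have h := hφL.dist_le_mul y ((d : ℝ)⁻¹ • r • y)
    have e : y - (d : ℝ)⁻¹ • r • y = (1 - r / d) • y := by
      rw [sub_smul, one_smul, smul_smul]
      congr 2
      ring
    rw [Real.dist_eq, dist_eq_norm, e, norm_smul, Real.norm_eq_abs] at h
    have h2 := pow_le_pow_left₀ (abs_nonneg _) h 2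
    rw [sq_abs, mul_pow, mul_pow, sq_abs] at h2
    push_cast at h2
    simp only [hψ]
    nlinarith [sq_nonneg (φ y - 2 * φ ((d : ℝ)⁻¹ • r • y))]
  have h2 : ∫ y, φ y ^ 2 ∂Q = ∫ z : ℝ × Vec d, φ z.2 ^ 2 ∂((gammaRadial d).prod Q) := by
    rw [integral_fun_snd (μ := gammaRadial d) (ν := Q) (fun y => φ y ^ 2)]
    simp
  have h3 : Integrable (fun z : ℝ × Vec d => 2 * ψ (z.1 • z.2) ^ 2) ((gammaRadial d).prod Q) :=
    hi.const_mul 2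
  have h4 : Integrable (fun z : ℝ × Vec d => 8 * (L : ℝ) ^ 2 * ((1 - z.1 / d) ^ 2 * ‖z.2‖ ^ 2))
      ((gammaRadial d).prod Q) := hi2.const_mul _
  have h5 := integral_mono hi3 (h3.add h4) hpt
  simp only [Pi.add_apply] at h5
  rw [integral_add h3 h4, integral_const_mul, integral_const_mul,
    integral_prod_mul (fun r : ℝ => (1 - r / d) ^ 2) (fun y : Vec d => ‖y‖ ^ 2),
    integral_one_sub_div_sq_gammaRadial hd, hQ.integral_norm_sq hd] at h5
  rw [h2]
  refine h5.trans ?_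
  have h6 : (1 / (d : ℝ)) * (2 / ((d : ℝ) + 1)) ≤ 2 / (d : ℝ) ^ 2 := by
    rw [div_mul_div_comm, one_mul]
    gcongr
    nlinarith
  have h7 : 4 * ((2 * L * (d : ℝ≥0)⁻¹ : ℝ≥0) : ℝ) ^ 2 = 16 * (L : ℝ) ^ 2 / (d : ℝ) ^ 2 := by
    push_cast
    field_simp
    ring
  rw [h7] at h1
  calc _ ≤ 2 * (16 * (L : ℝ) ^ 2 / (d : ℝ) ^ 2) + 8 * (L : ℝ) ^ 2 * (2 / (d : ℝ) ^ 2) := by gcongr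
    _ = _ := by ring

end Radial

/-! ### The uniform distribution on the `ℓ_1`-ball. -/

section UniformBall

variable {d : ℕ} {C : ℝ} {Q : Measure (Vec d)}

/-- The distribution of the `ℓ_1`-norm of a uniform vector of the unit ball of the `ℓ_1`-norm. -/
def ballRadial (d : ℕ) : Measure ℝ := radial d fun r => d * (Set.Iio 1).indicator 1 r

/-- The uniform distribution on the unit ball of the `ℓ_1`-norm, in terms of its polar
coordinates. -/
def ballMeasure (Q : Measure (Vec d)) : Measure (Vec d) :=
  Measure.map (fun z : ℝ × Vec d => z.1 • z.2) ((ballRadial d).prod Q)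

theorem measurable_indicator_Iio : Measurable ((Set.Iio (1 : ℝ)).indicator (1 : ℝ → ℝ)) :=
  measurable_one.indicator measurableSet_Iio

theorem indicator_Iio_nonneg (r : ℝ) : 0 ≤ (Set.Iio (1 : ℝ)).indicator (1 : ℝ → ℝ) r :=
  Set.indicator_nonneg (fun _ _ => zero_le_one) r

theorem integrable_pow_ballRadial (k : ℕ) : Integrable (fun r => r ^ k) (ballRadial d) ∧
    ∫ r, r ^ k ∂ballRadial d = d / ((d - 1 : ℕ) + k + 1) := by
  have hm : Measurable fun r => d * (Set.Iio (1 : ℝ)).indicator (1 : ℝ → ℝ) r :=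
    measurable_indicator_Iio.const_mul _
  have h0 : ∀ r : ℝ, 0 ≤ d * (Set.Iio (1 : ℝ)).indicator (1 : ℝ → ℝ) r := fun r =>
    mul_nonneg (by positivity) (indicator_Iio_nonneg r)
  have e : ∀ r : ℝ, d * (Set.Iio (1 : ℝ)).indicator (1 : ℝ → ℝ) r * r ^ (d - 1) * r ^ k =
      (Set.Iio (1 : ℝ)).indicator (fun r => d * r ^ (d - 1 + k)) r := by
    intro r
    by_cases h : r < 1
    · simp [h, pow_add, mul_assoc]
    · simp [h]
  have hint : IntegrableOn (fun r : ℝ => (d : ℝ) * r ^ (d - 1 + k)) (Set.Ioo 0 1) :=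
    (Continuous.integrableOn_Icc (by fun_prop)).mono_set Set.Ioo_subset_Icc_self
  rw [ballRadial, integrable_radial_iff hm h0, integral_radial hm h0]
  simp only [e]
  rw [integrableOn_indicator_iff measurableSet_Iio, setIntegral_indicator measurableSet_Iio,
    Set.Iio_inter_Ioi, Set.Ioi_inter_Iio]
  refine ⟨hint, ?_⟩
  rw [← integral_Ioc_eq_integral_Ioo, ← intervalIntegral.integral_of_le zero_le_one,
    intervalIntegral.integral_const_mul, integral_pow]
  push_cast
  simp
  ring

theorem isProbabilityMeasure_ballRadial (hd : 0 < d) : IsProbabilityMeasure (ballRadial d) := by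
  refine ⟨?_⟩
  obtain ⟨hi, h⟩ := integrable_pow_ballRadial (d := d) 0
  simp only [pow_zero] at h hi
  have hf : IsFiniteMeasure (ballRadial d) := by
    rwa [integrable_const_iff_isFiniteMeasure one_ne_zero] at hi
  have hd' : (0 : ℝ) < d := by exact_mod_cast hd
  have h1 : (d : ℝ) / ((d - 1 : ℕ) + (0 : ℕ) + 1) = 1 := by
    rw [Nat.cast_sub hd]
    simp [hd'.ne']
  rw [h1, integral_const, smul_eq_mul, mul_one, Measure.real, ENNReal.toReal_eq_one_iff] at h
  exact h

theorem IsPolar.isProbabilityMeasure_ballMeasure (hQ : IsPolar C Q) (hd : 0 < d) :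
    IsProbabilityMeasure (ballMeasure Q) := by
  have := hQ.prob
  have := isProbabilityMeasure_ballRadial hd
  exact Measure.isProbabilityMeasure_map measurable_smul_prod.aemeasurable

theorem IsPolar.ballMeasure_eq (hQ : IsPolar C Q) (hd : 0 < d) :
    (volume : Measure (Vec d)).restrict {x | ellNorm 1 x < 1} =
      ENNReal.ofReal (C / d) • ballMeasure Q := by
  have := hQ.prob
  have hd' : (0 : ℝ) < d := by exact_mod_cast hd
  have hC := hQ.pos
  have hms : MeasurableSet {x : Vec d | ellNorm 1 x < 1} :=
    measurableSet_lt (continuous_ellNorm le_rfl).measurable measurable_const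
  have h := hQ.withDensity_eq measurable_indicator_Iio indicator_Iio_nonneg
  have h1 : (volume : Measure (Vec d)).withDensity
      (fun x => ENNReal.ofReal ((Set.Iio (1 : ℝ)).indicator (1 : ℝ → ℝ) (ellNorm 1 x))) =
      (volume : Measure (Vec d)).restrict {x | ellNorm 1 x < 1} := by
    rw [← withDensity_indicator_one hms]
    congr 1
    ext x
    by_cases hx : ellNorm 1 x < 1 <;> simp [hx]
  have h2 : radial d (fun r => C * (Set.Iio (1 : ℝ)).indicator (1 : ℝ → ℝ) r) =
      ENNReal.ofReal (C / d) • ballRadial d := by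
    rw [ballRadial, radial, radial, ← withDensity_smul' _ _ ENNReal.ofReal_ne_top]
    congr 1
    ext r
    rw [Pi.smul_apply, smul_eq_mul, ← ENNReal.ofReal_mul (by positivity)]
    congr 1
    field_simp
  rw [← h1, h, h2, Measure.prod_smul_left, Measure.map_smul, ballMeasure]

theorem IsPolar.ae_ballMeasure (hQ : IsPolar C Q) (hd : 0 < d) :
    ∀ᵐ u ∂ballMeasure Q, ellNorm 1 u < 1 := by
  have hms : MeasurableSet {x : Vec d | ellNorm 1 x < 1} :=
    measurableSet_lt (continuous_ellNorm le_rfl).measurable measurable_const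
  have h : ∀ᵐ u ∂((volume : Measure (Vec d)).restrict {x | ellNorm 1 x < 1}), ellNorm 1 u < 1 :=
    ae_restrict_mem hms
  rw [hQ.ballMeasure_eq hd] at h
  have hd' : (0 : ℝ) < d := by exact_mod_cast hd
  have hC := hQ.pos
  exact (Measure.ae_ennreal_smul_measure_iff
    (ENNReal.ofReal_pos.2 (div_pos hC hd')).ne').1 h

theorem IsPolar.integrable_ballMeasure (hQ : IsPolar C Q) (hd : 0 < d) {f : Vec d → ℝ}
    (hf : Continuous f) : Integrable f (ballMeasure Q) := by
  have := hQ.isProbabilityMeasure_ballMeasure hd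
  obtain ⟨M, hM⟩ := (isCompact_closedBall (0 : Vec d) 1).exists_bound_of_continuousOn
    hf.continuousOn
  refine (integrable_const M).mono' hf.aestronglyMeasurable
    ((hQ.ae_ballMeasure hd).mono fun u hu => hM u ?_)
  rw [mem_closedBall_zero_iff, ← ellNorm_two]
  exact (ellNorm_antitone le_rfl (by norm_num) u).trans hu.le

/-- Ball and Laplace law share the direction and differ only in the mean radius, `d / (d + 1)`
against `d`. So the mean norm in the ball is that of a Laplace vector divided by `d + 1`. -/
theorem IsPolar.integral_ellNorm_ballMeasure_le (hQ : IsPolar C Q) (hd : 0 < d) {q : ℝ≥0∞}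
    (hq : 1 ≤ q) (hq' : q ≠ ∞) :
    ∫ u, ellNorm q u ∂ballMeasure Q ≤
      1 / ((d : ℝ) + 1) * (q.toReal * (d : ℝ) ^ (1 / q).toReal) := by
  have := hQ.prob
  have hd' : (0 : ℝ) < d := by exact_mod_cast hd
  have hc := continuous_ellNorm (d := d) hq
  have hsplit : ∀ ρ : Measure ℝ, SFinite ρ → (∀ᵐ r ∂ρ, 0 < r) →
      ∫ z : ℝ × Vec d, ellNorm q (z.1 • z.2) ∂(ρ.prod Q) = (∫ r, r ∂ρ) * ∫ y, ellNorm q y ∂Q := by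
    intro ρ _ hρ
    rw [← integral_prod_mul]
    refine integral_congr_ae ?_
    have : ∀ᵐ z ∂(ρ.prod Q), 0 < z.1 := Measure.quasiMeasurePreserving_fst.ae hρ
    filter_upwards [this] with z hz
    rw [ellNorm_smul hq, abs_of_pos hz]
  have h1 := (integral_ellNorm_laplaceVec_le (d := d) hq hq').2
  rw [hQ.integral_laplaceVec_eq hc, gammaRadial, hsplit _ inferInstance (ae_radial_pos _)] at h1
  change (∫ r, r ∂gammaRadial d) * _ ≤ _ at h1
  rw [integral_id_gammaRadial hd] at h1
  rw [ballMeasure, integral_map measurable_smul_prod.aemeasurable hc.aestronglyMeasurable,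
    ballRadial, hsplit _ inferInstance (ae_radial_pos _)]
  change (∫ r, r ∂ballRadial d) * _ ≤ _
  have h2 := (integrable_pow_ballRadial (d := d) 1).2
  simp only [pow_one] at h2
  have h3 : (d : ℝ) / ((d - 1 : ℕ) + (1 : ℕ) + 1) = 1 / ((d : ℝ) + 1) * d := by
    rw [Nat.cast_sub hd]
    simp
    field_simp
  rw [h2, h3, mul_assoc]
  gcongr

/-- The expected `ℓ_q`-norm of a uniform vector of the unit ball of the `ℓ_1`-norm. -/
theorem IsPolar.integral_ellNorm_ballMeasure_le_bq (hQ : IsPolar C Q) (hd : 3 ≤ d) {q : ℝ≥0∞}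
    (hq : 1 ≤ q) : ∫ u, ellNorm q u ∂ballMeasure Q ≤ bq q d := by
  have hd0 : 0 < d := by omega
  have hd' : (3 : ℝ) ≤ d := by exact_mod_cast hd
  rw [bq]
  split_ifs with h
  · exact hQ.integral_ellNorm_ballMeasure_le hd0 hq h.ne_top
  · have hlog : 1 ≤ Real.log d := by
      rw [Real.le_log_iff_exp_le (by linarith)]
      linarith [Real.exp_one_lt_d9]
    have hl1 : 1 ≤ ENNReal.ofReal (Real.log d) := by
      rw [← ENNReal.ofReal_one]
      exact ENNReal.ofReal_le_ofReal hlog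
    -- For large `q`, decreasing the exponent to `log d` increases the norm, and `d ^ (1 / log d) =
    -- e`. The assumption `3 ≤ d` ensures that `log d` is an admissible exponent.
    have hmono : ∫ u, ellNorm q u ∂ballMeasure Q ≤
        ∫ u, ellNorm (ENNReal.ofReal (Real.log d)) u ∂ballMeasure Q :=
      integral_mono (hQ.integrable_ballMeasure hd0 (continuous_ellNorm hq))
        (hQ.integrable_ballMeasure hd0 (continuous_ellNorm hl1))
        fun u => ellNorm_antitone hl1 (not_lt.1 h) u
    refine hmono.trans ((hQ.integral_ellNorm_ballMeasure_le hd0 hl1 ENNReal.ofReal_ne_top).trans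
      (le_of_eq ?_))
    congr 1
    rw [one_div, ENNReal.toReal_inv, ENNReal.toReal_ofReal (by linarith), mul_comm]
    congr 1
    rw [Real.rpow_def_of_pos (by linarith), mul_inv_cancel₀ (by linarith)]

end UniformBall

/-! ### The divergence theorem on the `ℓ_1`-ball for convex functions. -/

section Divergence

variable {d : ℕ} {C : ℝ} {Q : Measure (Vec d)}

theorem norm_le_ellNorm_one (x : Vec d) : ‖x‖ ≤ ellNorm 1 x := by
  rw [← ellNorm_two]
  exact ellNorm_antitone le_rfl (by norm_num) x

theorem signVec_smul {r : ℝ} (hr : 0 < r) (x : Vec d) : signVec (r • x) = signVec x := by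
  simp [signVec, mul_nonneg_iff_of_pos_left hr]

theorem norm_signVec (x : Vec d) : ‖signVec x‖ = √d := by
  rw [EuclideanSpace.norm_eq]
  simp [abs_signVec_apply]

theorem abs_inner_signVec_le (x v : Vec d) : |inner ℝ (signVec x) v| ≤ √d * ‖v‖ := by
  rw [← norm_signVec x]
  exact abs_real_inner_le_norm _ _

theorem lipschitz_ellNorm_one : ∃ K, LipschitzWith K (ellNorm 1 : Vec d → ℝ) := by
  have hL : LipschitzWith 1 (fun x : PiLp 1 fun _ : Fin d => ℝ => ‖x‖) := lipschitzWith_one_norm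
  exact ⟨_, hL.comp ((PiLp.lipschitzWith_toLp 1 fun _ : Fin d => ℝ).comp
    (PiLp.lipschitzWith_ofLp 2 fun _ : Fin d => ℝ))⟩

/-- A Lipschitz approximation of the indicator function of the unit ball of the `ℓ_1`-norm. -/
def ballBump (ε : ℝ) (x : Vec d) : ℝ := min 1 (max ((1 - ellNorm 1 x) / ε) 0)

theorem ballBump_nonneg (ε : ℝ) (x : Vec d) : 0 ≤ ballBump ε x :=
  le_min zero_le_one (le_max_right _ _)

theorem ballBump_le_one (ε : ℝ) (x : Vec d) : ballBump ε x ≤ 1 := min_le_left _ _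

theorem ballBump_eq_zero {ε : ℝ} (hε : 0 < ε) {x : Vec d} (hx : 1 ≤ ellNorm 1 x) :
    ballBump ε x = 0 := by
  have : (1 - ellNorm 1 x) / ε ≤ 0 := div_nonpos_of_nonpos_of_nonneg (by linarith) hε.le
  simp [ballBump, max_eq_right this]

theorem lipschitz_ballBump {ε : ℝ} (hε : 0 < ε) :
    ∃ K, LipschitzWith K (ballBump ε : Vec d → ℝ) := by
  obtain ⟨K, hK⟩ := lipschitz_ellNorm_one (d := d)
  have h1 : LipschitzWith (Real.toNNReal ε⁻¹) fun s : ℝ => (1 - s) / ε := by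
    refine LipschitzWith.of_dist_le_mul fun s t => ?_
    rw [Real.dist_eq, Real.dist_eq, Real.coe_toNNReal _ (by positivity), ← sub_div, abs_div,
      abs_of_pos hε, div_eq_inv_mul, sub_sub_sub_cancel_left, abs_sub_comm]
  exact ⟨_, (((h1.comp hK).max_const 0).const_min 1)⟩

theorem hasCompactSupport_ballBump {ε : ℝ} (hε : 0 < ε) :
    HasCompactSupport (ballBump ε : Vec d → ℝ) := by
  refine HasCompactSupport.intro (isCompact_closedBall (0 : Vec d) 1) fun x hx => ?_
  rw [mem_closedBall_zero_iff, not_le] at hx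
  exact ballBump_eq_zero hε (hx.le.trans (norm_le_ellNorm_one x))

theorem hasDerivAt_ellNorm_one {x : Vec d} (hx : ∀ i, x i ≠ 0) (v : Vec d) :
    HasDerivAt (fun t : ℝ => ellNorm 1 (x + t • v)) (inner ℝ (signVec x) v) 0 := by
  have h : ∀ i ∈ Finset.univ, HasDerivAt (fun t : ℝ => |x i + t * v i|) (signVec x i * v i) 0 := by
    intro i _
    have h1 : HasDerivAt (fun t : ℝ => x i + t * v i) (v i) 0 := by
      simpa using ((hasDerivAt_id (0 : ℝ)).mul_const (v i)).const_add (x i)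
    have h2 : x i + 0 * v i ≠ 0 := by simpa using hx i
    have h3 := (hasDerivAt_abs h2).comp (0 : ℝ) h1
    have h4 : ((SignType.sign (x i + 0 * v i) : SignType) : ℝ) = signVec x i := by
      simp only [zero_mul, add_zero, signVec]
      split_ifs with h
      · rw [sign_pos (lt_of_le_of_ne h (hx i).symm)]
        simp
      · rw [sign_neg (not_le.1 h)]
        simp
    rwa [h4] at h3
  have h5 := HasDerivAt.fun_sum h
  have h6 : inner ℝ (signVec x) v = ∑ i, signVec x i * v i := by
    rw [PiLp.inner_apply]
    simp [mul_comm]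
  rw [h6]
  simpa [ellNorm_one] using h5

/-- The cut-off is constant off the shell and affine in the norm inside it, so its gradient is a
multiple of the sign vector. The excluded points form a null set. -/
theorem lineDeriv_ballBump {ε : ℝ} (hε : 0 < ε) {x : Vec d} (hx : ∀ i, x i ≠ 0)
    (h1 : ellNorm 1 x ≠ 1) (h2 : ellNorm 1 x ≠ 1 - ε) (v : Vec d) :
    lineDeriv ℝ (ballBump ε) x (-v) =
      ε⁻¹ * (Set.Ioo (1 - ε) 1).indicator 1 (ellNorm 1 x) * inner ℝ (signVec x) v := by
  have hN := hasDerivAt_ellNorm_one hx (-v)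
  have hc := hN.continuousAt
  have h0 : ellNorm 1 (x + (0 : ℝ) • -v) = ellNorm 1 x := by simp
  rcases lt_trichotomy (ellNorm 1 x) (1 - ε) with h | h | h
  · have hev : (fun t : ℝ => ballBump ε (x + t • -v)) =ᶠ[nhds 0] fun _ => 1 := by
      filter_upwards [hc.eventually_lt continuousAt_const (h0.trans_lt h)] with t ht
      have h3 : 1 ≤ (1 - ellNorm 1 (x + t • -v)) / ε := by
        rw [one_le_div hε]
        linarith
      rw [ballBump, max_eq_left (by linarith), min_eq_left h3]
    rw [lineDeriv, hev.deriv_eq]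
    simp [h.not_gt]
  · exact absurd h h2
  rcases lt_trichotomy (ellNorm 1 x) 1 with h' | h' | h'
  · have hev : (fun t : ℝ => ballBump ε (x + t • -v)) =ᶠ[nhds 0]
        fun t => (1 - ellNorm 1 (x + t • -v)) / ε := by
      filter_upwards [hc.eventually_lt continuousAt_const (h0.trans_lt h'),
        continuousAt_const.eventually_lt hc (h.trans_eq h0.symm)] with t ht ht'
      have h3 : (1 - ellNorm 1 (x + t • -v)) / ε ≤ 1 := by
        rw [div_le_one hε]
        linarith
      have h4 : 0 ≤ (1 - ellNorm 1 (x + t • -v)) / ε := div_nonneg (by linarith) hε.le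
      rw [ballBump, max_eq_left h4, min_eq_right h3]
    rw [lineDeriv, hev.deriv_eq, ((hN.const_sub 1).div_const ε).deriv,
      Set.indicator_of_mem (Set.mem_Ioo.2 ⟨h, h'⟩), inner_neg_right]
    simp only [Pi.one_apply]
    ring
  · exact absurd h' h1
  · have hev : (fun t : ℝ => ballBump ε (x + t • -v)) =ᶠ[nhds 0] fun _ => 0 := by
      filter_upwards [continuousAt_const.eventually_lt hc (h'.trans_eq h0.symm)] with t ht
      exact ballBump_eq_zero hε ht.le
    rw [lineDeriv, hev.deriv_eq]
    simp [h'.not_gt]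

theorem ae_apply_ne_zero : ∀ᵐ x : Vec d, ∀ i, x i ≠ 0 := by
  rw [ae_all_iff]
  intro i
  have h := Measure.addHaar_submodule (volume : Measure (Vec d))
    (LinearMap.ker (EuclideanSpace.proj i : Vec d →L[ℝ] ℝ).toLinearMap) (by
      intro h
      have : (EuclideanSpace.single i (1 : ℝ) : Vec d) ∈
        LinearMap.ker (EuclideanSpace.proj i : Vec d →L[ℝ] ℝ).toLinearMap := h ▸ Submodule.mem_top
      simp at this)
  refine (measure_eq_zero_iff_ae_notMem.1 h).mono fun x hx h0 => hx ?_
  simpa using h0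

/-- In polar coordinates a sphere occupies at most a single radius. -/
theorem IsPolar.ae_ellNorm_ne (hQ : IsPolar C Q) (c : ℝ) :
    ∀ᵐ x : Vec d, ellNorm 1 x ≠ c := by
  have hm : MeasurableSet {x : Vec d | ellNorm 1 x = c} :=
    measurableSet_eq_fun (continuous_ellNorm le_rfl).measurable measurable_const
  have h := hQ.lintegral_eq _ (measurable_one.indicator hm)
  rw [lintegral_indicator_one hm] at h
  refine measure_eq_zero_iff_ae_notMem.1 (h.trans ?_)
  have hz : ∀ᵐ r : ℝ ∂(volume.restrict (Set.Ioi 0)), ENNReal.ofReal (r ^ (d - 1)) *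
      ∫⁻ y, ({x : Vec d | ellNorm 1 x = c}).indicator 1 (r • y) ∂Q = 0 := by
    filter_upwards [ae_restrict_mem measurableSet_Ioi,
      ae_restrict_of_ae (compl_mem_ae_iff.2 (measure_singleton c))] with r hr hrc
    have hr0 : 0 < r := hr
    have : ∫⁻ y, ({x : Vec d | ellNorm 1 x = c}).indicator (1 : Vec d → ℝ≥0∞) (r • y) ∂Q = 0 := by
      refine lintegral_eq_zero_of_ae_eq_zero (hQ.ae_norm.mono fun y hy => ?_)
      refine Set.indicator_of_notMem ?_ _
      rw [Set.mem_ofPred_eq, ellNorm_smul le_rfl, hy, abs_of_pos hr0, mul_one]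
      exact hrc
    rw [this, mul_zero]
  rw [lintegral_congr_ae hz]
  simp

/-- The mean over the `ℓ_1`-sphere of radius `r` of `F x ⟨sign x, v⟩`. -/
def sphereMean (Q : Measure (Vec d)) (F : Vec d → ℝ) (v : Vec d) (r : ℝ) : ℝ :=
  ∫ y, F (r • y) * inner ℝ (signVec y) v ∂Q

theorem measurable_inner_signVec (v : Vec d) : Measurable fun x : Vec d => inner ℝ (signVec x) v :=
  measurable_signVec.inner measurable_const

theorem IsPolar.integrable_mul_inner_signVec (hQ : IsPolar C Q) {F : Vec d → ℝ}
    (hF : Continuous F) (v : Vec d) :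
    Integrable (fun y => F y * inner ℝ (signVec y) v) Q := by
  refine Integrable.mul_bdd (c := √d * ‖v‖) (hQ.integrable_continuous hF)
    (measurable_inner_signVec v).aestronglyMeasurable
    (Filter.Eventually.of_forall fun y => abs_inner_signVec_le y v)

theorem IsPolar.continuous_sphereMean (hQ : IsPolar C Q) {F : Vec d → ℝ} {K : ℝ≥0}
    (hF : LipschitzWith K F) (v : Vec d) : Continuous (sphereMean Q F v) := by
  have := hQ.prob
  have hFc := hF.continuous
  have hi : ∀ r : ℝ, Integrable (fun y => F (r • y) * inner ℝ (signVec y) v) Q := fun r =>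
    hQ.integrable_mul_inner_signVec (F := fun y => F (r • y)) (by fun_prop) v
  refine (LipschitzWith.of_dist_le_mul (K := K * Real.toNNReal (√d * ‖v‖))
    fun r s => ?_).continuous
  rw [Real.dist_eq, sphereMean, sphereMean, ← integral_sub (hi r) (hi s)]
  have h := norm_integral_le_of_norm_le_const (μ := Q) (C := K * (√d * ‖v‖) * dist r s)
    (f := fun y => F (r • y) * inner ℝ (signVec y) v - F (s • y) * inner ℝ (signVec y) v)
    (hQ.norm_le_one.mono fun y hy => by
      rw [← sub_mul, norm_mul, Real.norm_eq_abs, Real.norm_eq_abs]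
      have h1 := hF.dist_le_mul (r • y) (s • y)
      rw [Real.dist_eq, dist_eq_norm, ← sub_smul, norm_smul] at h1
      calc _ ≤ (K * (‖r - s‖ * ‖y‖)) * (√d * ‖v‖) := by
            gcongr
            exact abs_inner_signVec_le y v
        _ ≤ (K * (‖r - s‖ * 1)) * (√d * ‖v‖) := by gcongr
        _ = _ := by
            rw [dist_eq_norm]
            ring)
  rw [NNReal.coe_mul, Real.coe_toNNReal _ (by positivity)]
  simpa using h

/-- The derivative of the cut-off lives on the shell between radii `1 - ε` and `1`, where polar
coordinates turn the integral into an average of sphere means. -/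
theorem IsPolar.integral_lineDeriv_ballBump (hQ : IsPolar C Q) {F : Vec d → ℝ} {K : ℝ≥0}
    (hF : LipschitzWith K F) (v : Vec d) {ε : ℝ} (hε : 0 < ε) (hε1 : ε < 1) :
    ∫ x, lineDeriv ℝ (ballBump ε) x (-v) * F x =
      C * (ε⁻¹ * ∫ r in (1 - ε)..1, r ^ (d - 1) * sphereMean Q F v r) := by
  have := hQ.prob
  have hFc := hF.continuous
  set w : ℝ → ℝ := fun r => ε⁻¹ * (Set.Ioo (1 - ε) 1).indicator 1 r with hw
  have hwm : Measurable w := (measurable_one.indicator measurableSet_Ioo).const_mul _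
  have hw0 : ∀ r, 0 ≤ w r := fun r =>
    mul_nonneg (by positivity) (Set.indicator_nonneg (fun _ _ => zero_le_one) r)
  have hC := hQ.pos
  set φ : Vec d → ℝ := fun x => F x * inner ℝ (signVec x) v with hφ
  have hφm : Measurable φ := hFc.measurable.mul (measurable_inner_signVec v)
  have hN := (continuous_ellNorm (d := d) le_rfl).measurable
  have e1 : ∫ x, lineDeriv ℝ (ballBump ε) x (-v) * F x = ∫ x, w (ellNorm 1 x) * φ x := by
    refine integral_congr_ae ?_
    filter_upwards [ae_apply_ne_zero, hQ.ae_ellNorm_ne 1, hQ.ae_ellNorm_ne (1 - ε)]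
      with x hx h1 h2
    rw [lineDeriv_ballBump hε hx h1 h2]
    simp only [hw, hφ]
    ring
  have e2 : ∫ x, w (ellNorm 1 x) * φ x =
      ∫ z : ℝ × Vec d, φ (z.1 • z.2) ∂((radial d fun r => C * w r).prod Q) := by
    rw [← integral_map measurable_smul_prod.aemeasurable hφm.aestronglyMeasurable,
      ← hQ.withDensity_eq hwm hw0, integral_withDensity_eq_integral_toReal_smul
        (by fun_prop) (by simp)]
    refine integral_congr_ae (Filter.Eventually.of_forall fun x => ?_)
    simp only [smul_eq_mul]
    rw [ENNReal.toReal_ofReal (hw0 _)]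
  have hCw : Measurable fun r => C * w r := hwm.const_mul _
  have hCw0 : ∀ r, 0 ≤ C * w r := fun r => mul_nonneg hC.le (hw0 r)
  have ew : ∀ (k : ℝ → ℝ) (r : ℝ), C * w r * r ^ (d - 1) * k r =
      (Set.Ioo (1 - ε) 1).indicator (fun r => C * (ε⁻¹ * (r ^ (d - 1) * k r))) r := by
    intro k r
    by_cases h : r ∈ Set.Ioo (1 - ε) 1
    · simp only [hw, Set.indicator_of_mem h, Pi.one_apply]
      ring
    · simp [hw, Set.indicator_of_notMem h]
  have hsub : Set.Ioo (1 - ε) 1 ∩ Set.Ioi 0 = Set.Ioo (1 - ε) 1 :=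
    Set.inter_eq_left.2 fun r hr => (by linarith [hr.1] : (0 : ℝ) < r)
  have hsub' : Set.Ioi 0 ∩ Set.Ioo (1 - ε) 1 = Set.Ioo (1 - ε) 1 := by
    rw [Set.inter_comm, hsub]
  have hfin : IsFiniteMeasure (radial d fun r => C * w r) := by
    rw [← integrable_const_iff_isFiniteMeasure (c := (1 : ℝ)) one_ne_zero,
      integrable_radial_iff hCw hCw0]
    simp only [ew fun _ => 1]
    rw [integrableOn_indicator_iff measurableSet_Ioo, hsub]
    exact (Continuous.integrableOn_Icc (by fun_prop)).mono_set Set.Ioo_subset_Icc_self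
  have haeR : ∀ᵐ r ∂(radial d fun r => C * w r), r ∈ Set.Ioo (1 - ε) 1 := by
    rw [radial, ae_withDensity_iff (by fun_prop)]
    refine Filter.Eventually.of_forall fun r hr => ?_
    by_contra h
    exact hr (by simp [hw, Set.indicator_of_notMem h])
  have hint : Integrable (fun z : ℝ × Vec d => φ (z.1 • z.2))
      ((radial d fun r => C * w r).prod Q) := by
    obtain ⟨M, hM⟩ := (isCompact_closedBall (0 : Vec d) 1).exists_bound_of_continuousOn
      hFc.continuousOn
    refine (integrable_const (M * (√d * ‖v‖))).mono'
      (hφm.comp measurable_smul_prod).aestronglyMeasurable ?_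
    filter_upwards [Measure.quasiMeasurePreserving_fst.ae haeR,
      Measure.quasiMeasurePreserving_snd.ae hQ.norm_le_one] with z hz1 hz2
    have hr : |z.1| ≤ 1 := by
      rw [abs_le]
      constructor <;> linarith [hz1.1, hz1.2]
    have hz : ‖z.1 • z.2‖ ≤ 1 := by
      rw [norm_smul, Real.norm_eq_abs]
      exact mul_le_one₀ hr (norm_nonneg _) hz2
    have h1 := hM (z.1 • z.2) (by simpa using hz)
    simp only [hφ]
    rw [norm_mul]
    gcongr
    · exact (norm_nonneg _).trans h1
    · exact abs_inner_signVec_le _ v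
  rw [e1, e2, integral_prod _ hint]
  have e3 : ∫ r, ∫ y, φ (r • y) ∂Q ∂(radial d fun r => C * w r) =
      ∫ r, sphereMean Q F v r ∂(radial d fun r => C * w r) := by
    refine integral_congr_ae ((ae_radial_pos _).mono fun r hr => ?_)
    simp only [hφ, sphereMean, signVec_smul hr]
  rw [e3, integral_radial hCw hCw0]
  simp only [ew]
  rw [setIntegral_indicator measurableSet_Ioo, hsub', integral_const_mul, integral_const_mul,
    ← integral_Ioc_eq_integral_Ioo, intervalIntegral.integral_of_le (by linarith)]

theorem lineDeriv_le_of_convexOn {F : Vec d → ℝ} (hF : ConvexOn ℝ Set.univ F) {x v : Vec d}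
    (hx : LineDifferentiableAt ℝ F x v) : lineDeriv ℝ F x v ≤ F (x + v) - F x := by
  have hc : ConvexOn ℝ Set.univ fun t : ℝ => F (x + t • v) := by
    have := hF.comp_affineMap (AffineMap.lineMap (k := ℝ) x (x + v))
    simp only [Set.preimage_univ] at this
    refine this.congr fun t _ => ?_
    simp [AffineMap.lineMap_apply, add_comm]
  have hx' : HasDerivAt (fun t : ℝ => F (x + t • v)) (lineDeriv ℝ F x v) 0 := hx.hasLineDerivAt
  have h := hc.le_slope_of_hasDerivAt (Set.mem_univ 0) (Set.mem_univ 1) zero_lt_one hx'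
  simpa [slope_def_field] using h

/-- The gradient of the average of a convex function over the unit ball of the `ℓ_1`-norm, as
an average over the sphere (an inequality between directional derivatives). -/
theorem IsPolar.mul_sphereMean_le (hQ : IsPolar C Q) (hd : 0 < d) {F : Vec d → ℝ} {K : ℝ≥0}
    (hF : LipschitzWith K F) (hFc : ConvexOn ℝ Set.univ F) (v : Vec d) :
    d * ∫ y, F y * inner ℝ (signVec y) v ∂Q ≤ ∫ u, (F (u + v) - F u) ∂ballMeasure Q := by
  have := hQ.prob
  have hd' : (0 : ℝ) < d := by exact_mod_cast hd
  have hcont := hF.continuous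
  have hC := hQ.pos
  have hD : Continuous fun x => F (x + v) - F x := by fun_prop
  -- The `+ 2` keeps `ε n` below `1`, so the shells stay away from the origin.
  set ε : ℕ → ℝ := fun n => 1 / ((n : ℝ) + 2) with hε
  have hε0 : ∀ n, 0 < ε n := fun n => by positivity
  have hε1 : ∀ n, ε n < 1 := fun n => by
    simp only [hε]
    rw [div_lt_one (by positivity)]
    have : (0 : ℝ) ≤ n := by positivity
    linarith
  have hεt : Filter.Tendsto ε Filter.atTop (nhds 0) :=
    tendsto_const_nhds.div_atTop
      (Filter.tendsto_atTop_add_const_right _ _ tendsto_natCast_atTop_atTop)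
  have hms : MeasurableSet {x : Vec d | ellNorm 1 x < 1} :=
    measurableSet_lt (continuous_ellNorm le_rfl).measurable measurable_const
  have hfinB : volume {x : Vec d | ellNorm 1 x < 1} < ∞ := by
    refine (measure_mono fun x hx => ?_).trans_lt
      (isCompact_closedBall (0 : Vec d) 1).measure_lt_top
    rw [mem_closedBall_zero_iff]
    exact (norm_le_ellNorm_one x).trans (le_of_lt hx)
  have hineq : ∀ n, C * ((ε n)⁻¹ * ∫ r in (1 - ε n)..1, r ^ (d - 1) * sphereMean Q F v r) ≤
      ∫ x, (F (x + v) - F x) * ballBump (ε n) x := by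
    intro n
    obtain ⟨K', hK'⟩ := lipschitz_ballBump (d := d) (hε0 n)
    have hcs := hasCompactSupport_ballBump (d := d) (hε0 n)
    -- Integration by parts for Lipschitz functions moves the derivative from the cut-off to `F`,
    -- where convexity bounds it by an increment.
    rw [← hQ.integral_lineDeriv_ballBump hF v (hε0 n) (hε1 n),
      ← hF.integral_lineDeriv_mul_eq hK' hcs]
    refine integral_mono_ae ?_ ?_ ?_
    · refine Integrable.bdd_mul (c := K * ‖v‖) (hK'.continuous.integrable_of_hasCompactSupport hcs)
        (measurable_lineDeriv hcont).aestronglyMeasurable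
        (Filter.Eventually.of_forall fun x => norm_lineDeriv_le_of_lipschitz ℝ hF)
    · exact (hD.mul hK'.continuous).integrable_of_hasCompactSupport hcs.mul_left
    · filter_upwards [hF.ae_lineDifferentiableAt v] with x hx
      exact mul_le_mul_of_nonneg_right (lineDeriv_le_of_convexOn hFc hx) (ballBump_nonneg _ _)
  have hleft : Filter.Tendsto (fun n => C * ((ε n)⁻¹ *
      ∫ r in (1 - ε n)..1, r ^ (d - 1) * sphereMean Q F v r)) Filter.atTop
      (nhds (C * sphereMean Q F v 1)) := by
    refine Filter.Tendsto.const_mul C ?_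
    have hk : Continuous fun r => r ^ (d - 1) * sphereMean Q F v r :=
      (continuous_pow _).mul (hQ.continuous_sphereMean hF v)
    -- The shell average is a difference quotient at `1` of the primitive of `r ^ (d - 1) *
    -- sphereMean Q F v r`, so it converges to the mean over the unit sphere.
    have hder := (hk.integral_hasStrictDerivAt 0 1).hasDerivAt
    rw [hasDerivAt_iff_tendsto_slope] at hder
    have ht : Filter.Tendsto (fun n => 1 - ε n) Filter.atTop (nhdsWithin 1 {1}ᶜ) := by
      refine tendsto_nhdsWithin_iff.2 ⟨by simpa using hεt.const_sub 1,
        Filter.Eventually.of_forall fun n => ?_⟩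
      have := hε0 n
      simp only [Set.mem_compl_iff, Set.mem_singleton_iff]
      linarith
    have h := hder.comp ht
    simp only [one_pow, one_mul] at h
    refine h.congr fun n => ?_
    simp only [Function.comp_apply, slope_def_field]
    rw [intervalIntegral.integral_interval_sub_left (hk.intervalIntegrable _ _)
      (hk.intervalIntegrable _ _), intervalIntegral.integral_symm]
    have e : 1 - ε n - 1 = -ε n := by ring
    rw [e, neg_div_neg_eq, div_eq_inv_mul]
  have hright : Filter.Tendsto (fun n => ∫ x, (F (x + v) - F x) * ballBump (ε n) x) Filter.atTop
      (nhds (∫ x, (F (x + v) - F x) * ({x : Vec d | ellNorm 1 x < 1}).indicator 1 x)) := by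
    refine tendsto_integral_of_dominated_convergence
      (({x : Vec d | ellNorm 1 x < 1}).indicator fun _ => (K : ℝ) * ‖v‖) (fun n => ?_) ?_
      (fun n => Filter.Eventually.of_forall fun x => ?_)
      (Filter.Eventually.of_forall fun x => ?_)
    · obtain ⟨K', hK'⟩ := lipschitz_ballBump (d := d) (hε0 n)
      exact (hD.mul hK'.continuous).aestronglyMeasurable
    · exact (integrable_indicator_iff hms).2 (integrableOn_const hfinB.ne)
    · by_cases hx : ellNorm 1 x < 1
      · rw [Set.indicator_of_mem (by exact hx), norm_mul]
        have h1 := hF.dist_le_mul (x + v) x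
        rw [Real.dist_eq, dist_eq_norm, add_sub_cancel_left] at h1
        calc _ ≤ (K * ‖v‖) * 1 := by
              gcongr
              · exact h1
              · rw [Real.norm_of_nonneg (ballBump_nonneg _ _)]
                exact ballBump_le_one _ _
          _ = _ := mul_one _
      · rw [ballBump_eq_zero (hε0 n) (not_lt.1 hx), Set.indicator_of_notMem (by exact hx)]
        simp
    · refine Filter.Tendsto.const_mul _ ?_
      by_cases hx : ellNorm 1 x < 1
      · rw [Set.indicator_of_mem (by exact hx)]
        refine tendsto_const_nhds.congr' ?_
        have hlt : ∀ᶠ n in Filter.atTop, ε n < 1 - ellNorm 1 x :=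
          hεt.eventually_lt_const (by linarith)
        filter_upwards [hlt] with n hn
        have h3 : 1 ≤ (1 - ellNorm 1 x) / ε n := by
          rw [one_le_div (hε0 n)]
          exact hn.le
        simp [ballBump, h3]
      · rw [Set.indicator_of_notMem (by exact hx)]
        refine tendsto_const_nhds.congr fun n => ?_
        rw [ballBump_eq_zero (hε0 n) (not_lt.1 hx)]
  have hlim := le_of_tendsto_of_tendsto' hleft hright hineq
  have e1 : ∫ x, (F (x + v) - F x) * ({x : Vec d | ellNorm 1 x < 1}).indicator 1 x =
      C / d * ∫ u, (F (u + v) - F u) ∂ballMeasure Q := by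
    have h1 : ∀ x, (F (x + v) - F x) * ({x : Vec d | ellNorm 1 x < 1}).indicator 1 x =
        ({x : Vec d | ellNorm 1 x < 1}).indicator (fun x => F (x + v) - F x) x := by
      intro x
      by_cases hx : ellNorm 1 x < 1 <;> simp [hx]
    simp_rw [h1]
    rw [integral_indicator hms, hQ.ballMeasure_eq hd, integral_smul_measure,
      ENNReal.toReal_ofReal (by positivity), smul_eq_mul]
  rw [e1] at hlim
  have e2 : sphereMean Q F v 1 = ∫ y, F y * inner ℝ (signVec y) v ∂Q := by simp [sphereMean]
  rw [e2, div_mul_eq_mul_div, le_div_iff₀ hd', mul_assoc] at hlim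
  have := le_of_mul_le_mul_left hlim hC
  linarith

end Divergence

/-! ### Bias and second moment of the gradient estimate in one round. -/

section OneRound

variable {d : ℕ} {C : ℝ} {Q : Measure (Vec d)} {q : ℝ≥0∞} {L h : ℝ} {F : Vec d → ℝ}

/-- Poincaré's inequality sees the Euclidean Lipschitz constant; the power of `d` lost here produces
the term `2 / (q ∧ 2)` in the final exponent. -/
theorem lipschitz_of_ellNorm (hd : 0 < d) (hq : 1 ≤ q) (hL : 0 < L)
    (hF : ∀ x y, |F x - F y| ≤ L * ellNorm q (x - y)) :
    LipschitzWith (Real.toNNReal (L * (d : ℝ) ^ ((1 / min q 2).toReal - 1 / 2))) F := by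
  refine LipschitzWith.of_dist_le_mul fun x y => ?_
  rw [Real.dist_eq, dist_eq_norm, Real.coe_toNNReal _ (by positivity), mul_assoc]
  exact (hF x y).trans (mul_le_mul_of_nonneg_left (ellNorm_le_mul_norm hd hq _) hL.le)

theorem lipschitz_comp_add_smul {K : ℝ≥0} (hF : LipschitzWith K F) (y : Vec d) (h : ℝ) :
    LipschitzWith (K * ‖h‖₊) fun u => F (y + h • u) := by
  refine LipschitzWith.of_dist_le_mul fun u v => ?_
  refine (hF.dist_le_mul _ _).trans (le_of_eq ?_)
  rw [dist_add_left, dist_smul₀, NNReal.coe_mul, coe_nnnorm, mul_assoc]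

theorem convexOn_comp_add_smul (hF : ConvexOn ℝ Set.univ F) (y : Vec d) (h : ℝ) :
    ConvexOn ℝ Set.univ fun u => F (y + h • u) := by
  have := hF.comp_affineMap (AffineMap.const ℝ (Vec d) y + (h • AffineMap.id ℝ (Vec d)))
  simp only [Set.preimage_univ] at this
  exact this.congr fun t _ => by simp

/-- The divergence inequality for a constant function, in the directions `v` and `-v`. -/
theorem IsPolar.integral_inner_signVec (hQ : IsPolar C Q) (hd : 0 < d) (v : Vec d) :
    ∫ y, inner ℝ (signVec y) v ∂Q = 0 := by
  have hd' : (0 : ℝ) < d := by exact_mod_cast hd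
  have h := fun v => hQ.mul_sphereMean_le hd (F := fun _ => 1) (K := 0)
    (LipschitzWith.const 1) (convexOn_const 1 convex_univ) v
  have h1 := h v
  have h2 := h (-v)
  simp only [one_mul, sub_self, integral_zero, inner_neg_right, integral_neg] at h1 h2
  nlinarith

/-- The regret of a point `y` against `x` is controlled by the averaged gradient estimate. -/
theorem IsPolar.sub_le_integral_inner (hQ : IsPolar C Q) (hd : 3 ≤ d) (hq : 1 ≤ q) (hL : 0 < L)
    (hh : 0 < h) (hFc : ConvexOn ℝ Set.univ F)
    (hF : ∀ x y, |F x - F y| ≤ L * ellNorm q (x - y)) (x y : Vec d) :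
    F y - F x ≤ L * h * bq q d +
      ∫ u, (d : ℝ) / (2 * h) * (F (y + h • u) - F (y - h • u)) * inner ℝ (signVec u) (y - x) ∂Q := by
  have hd0 : 0 < d := by omega
  have hlip := lipschitz_of_ellNorm hd0 hq hL hF
  have hc := hlip.continuous
  have hprob := hQ.isProbabilityMeasure_ballMeasure hd0
  -- The direction is scaled so that `y + h • u` moves to `x + h • u`. The second use, with `-h`,
  -- provides the other query point and symmetrizes the ball average.
  have h1 := hQ.mul_sphereMean_le hd0 (lipschitz_comp_add_smul hlip y h)
    (convexOn_comp_add_smul hFc y h) (h⁻¹ • (x - y))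
  have h2 := hQ.mul_sphereMean_le hd0 (lipschitz_comp_add_smul hlip y (-h))
    (convexOn_comp_add_smul hFc y (-h)) ((-h)⁻¹ • (x - y))
  have hh' : -h ≠ 0 := by linarith
  have e1 : ∀ u, y + h • (u + h⁻¹ • (x - y)) = x + h • u := fun u => by
    rw [smul_add, smul_smul, mul_inv_cancel₀ hh.ne', one_smul]
    abel
  have e2 : ∀ u, y + (-h) • (u + (-h)⁻¹ • (x - y)) = x + (-h) • u := fun u => by
    rw [smul_add, smul_smul, mul_inv_cancel₀ hh', one_smul]
    abel
  simp only [e1, e2, inner_smul_right, mul_left_comm _ (h⁻¹), mul_left_comm _ ((-h)⁻¹),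
    integral_const_mul] at h1 h2
  have iQ : ∀ s : ℝ, Integrable (fun u => F (y + s • u) * inner ℝ (signVec u) (x - y)) Q := fun s =>
    hQ.integrable_mul_inner_signVec (F := fun u => F (y + s • u)) (by fun_prop) _
  have iB : ∀ (z : Vec d) (s : ℝ), Integrable (fun u => F (z + s • u)) (ballMeasure Q) := fun z s =>
    hQ.integrable_ballMeasure hd0 (by fun_prop)
  rw [integral_sub (iB _ _) (iB _ _)] at h1 h2
  -- convexity of `F` at `y`
  have h3 : 2 * F y ≤ ∫ u, F (y + h • u) ∂ballMeasure Q + ∫ u, F (y + (-h) • u) ∂ballMeasure Q := by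
    rw [← integral_add (iB _ _) (iB _ _)]
    have : 2 * F y = ∫ _, 2 * F y ∂ballMeasure Q := by simp
    rw [this]
    refine integral_mono (integrable_const _) ((iB _ _).add (iB _ _)) fun u => ?_
    have := hFc.2 (Set.mem_univ (y + h • u)) (Set.mem_univ (y + (-h) • u))
      (by norm_num : (0 : ℝ) ≤ 1 / 2) (by norm_num : (0 : ℝ) ≤ 1 / 2) (by norm_num)
    have e : (1 / 2 : ℝ) • (y + h • u) + (1 / 2 : ℝ) • (y + (-h) • u) = y := by module
    rw [e] at this
    simp only [smul_eq_mul] at this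
    linarith
  -- the Lipschitz property of `F` at `x`
  have h4 : ∀ s : ℝ, |s| = h → ∫ u, F (x + s • u) ∂ballMeasure Q ≤ F x + L * h * bq q d := by
    intro s hs
    have hle : ∫ u, F (x + s • u) ∂ballMeasure Q ≤
        ∫ u, (F x + L * h * ellNorm q u) ∂ballMeasure Q := by
      refine integral_mono (iB _ _) (hQ.integrable_ballMeasure hd0
        (continuous_const.add ((continuous_ellNorm hq).const_mul _))) fun u => ?_
      have := (le_abs_self _).trans (hF (x + s • u) x)
      rw [add_sub_cancel_left, ellNorm_smul hq, hs] at this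
      simp only
      linarith
    refine hle.trans ?_
    rw [integral_add (integrable_const _) ((hQ.integrable_ballMeasure hd0
      (continuous_ellNorm hq)).const_mul _), integral_const_mul]
    simp only [integral_const, probReal_univ, one_smul]
    gcongr
    exact hQ.integral_ellNorm_ballMeasure_le_bq hd hq
  have h5 := h4 h (abs_of_pos hh)
  have h6 := h4 (-h) (by rw [abs_neg, abs_of_pos hh])
  have e3 : ∫ u, (d : ℝ) / (2 * h) * (F (y + h • u) - F (y - h • u)) *
      inner ℝ (signVec u) (y - x) ∂Q =
      -((d : ℝ) / (2 * h)) * (∫ u, F (y + h • u) * inner ℝ (signVec u) (x - y) ∂Q -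
        ∫ u, F (y + (-h) • u) * inner ℝ (signVec u) (x - y) ∂Q) := by
    rw [← integral_sub (iQ _) (iQ _), ← integral_const_mul]
    congr 1 with u
    have e4 : inner ℝ (signVec u) (y - x) = - inner ℝ (signVec u) (x - y) := by
      rw [← inner_neg_right, neg_sub]
    rw [e4, neg_smul, ← sub_eq_add_neg]
    ring
  rw [e3]
  set I1 := ∫ u, F (y + h • u) * inner ℝ (signVec u) (x - y) ∂Q
  set I2 := ∫ u, F (y + (-h) • u) * inner ℝ (signVec u) (x - y) ∂Q
  have e5 : -((d : ℝ) / (2 * h)) * (I1 - I2) = -(1 / 2) * (h⁻¹ * (d * I1) + (-h)⁻¹ * (d * I2)) := by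
    rw [inv_neg]
    field_simp
    ring
  rw [e5]
  linarith

theorem IsPolar.integral_sq_sub_le (hQ : IsPolar C Q) (hd : 0 < d) (hq : 1 ≤ q) (hL : 0 < L)
    (hF : ∀ x y, |F x - F y| ≤ L * ellNorm q (x - y)) (y : Vec d) :
    ∫ u, (F (y + h • u) - F (y - h • u)) ^ 2 ∂Q ≤
      48 * h ^ 2 * L ^ 2 * (d : ℝ) ^ (2 * (1 / min q 2).toReal - 3) := by
  have hd' : (0 : ℝ) < d := by exact_mod_cast hd
  have h1 := hQ.integral_sq_sub_neg_le hd
    (lipschitz_comp_add_smul (lipschitz_of_ellNorm hd hq hL hF) y h)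
  simp only [smul_neg, ← sub_eq_add_neg] at h1
  refine h1.trans (le_of_eq ?_)
  rw [NNReal.coe_mul, coe_nnnorm, Real.coe_toNNReal _ (by positivity), mul_pow, mul_pow,
    Real.norm_eq_abs, sq_abs, ← Real.rpow_natCast ((d : ℝ) ^ _) 2, ← Real.rpow_mul hd'.le]
  have e : (2 * (1 / min q 2).toReal - 3 : ℝ) =
      ((1 / min q 2).toReal - 1 / 2) * ((2 : ℕ) : ℝ) - ((2 : ℕ) : ℝ) := by
    push_cast
    ring
  rw [e, Real.rpow_sub hd', Real.rpow_natCast]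
  ring

theorem inner_gradEstimate (f : Vec d → ℝ) (h : ℝ) (x ζ v : Vec d) (a b : ℝ) :
    inner ℝ (gradEstimate f h x ζ a b) v =
      (d : ℝ) / (2 * h) * (f (x + h • ζ) - f (x - h • ζ)) * inner ℝ (signVec ζ) v +
        (d : ℝ) / (2 * h) * (a - b) * inner ℝ (signVec ζ) v := by
  rw [gradEstimate, inner_smul_left]
  simp only [conj_trivial]
  ring

theorem ellNorm_gradEstimate_sq {p : ℝ≥0∞} (hd : 0 < d) (hp : 1 ≤ p) (f : Vec d → ℝ) (h : ℝ)
    (x ζ : Vec d) (a b : ℝ) : ellNorm p.conjExponent (gradEstimate f h x ζ a b) ^ 2 =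
      (d : ℝ) ^ (2 - 2 * (1 / p).toReal) * ((d : ℝ) / (2 * h)) ^ 2 *
        ((f (x + h • ζ) - f (x - h • ζ)) + (a - b)) ^ 2 := by
  have hd' : (0 : ℝ) < d := by exact_mod_cast hd
  have e : (2 - 2 * (1 / p).toReal : ℝ) = (1 - (1 / p).toReal) * ((2 : ℕ) : ℝ) := by
    push_cast
    ring
  rw [gradEstimate, ellNorm_smul (one_le_conjExponent p), ellNorm_signVec hd hp, mul_pow, sq_abs,
    e, Real.rpow_mul hd'.le, Real.rpow_natCast]
  ring

variable {Ω : Type*} [MeasurableSpace Ω] {P : Measure Ω} [IsProbabilityMeasure P]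
  {X ζ : Ω → Vec d} {ξ' ξ'' : Ω → ℝ}

/-- A crude pointwise bound, used for integrability only; the sharper mean square comes from the
Poincaré inequality. -/
theorem abs_sub_le_of_ellNorm_one (hq : 1 ≤ q) (hL : 0 < L) (hh : 0 < h)
    (hF : ∀ x y, |F x - F y| ≤ L * ellNorm q (x - y)) (y : Vec d) {u : Vec d}
    (hu : ellNorm 1 u = 1) : |F (y + h • u) - F (y - h • u)| ≤ 2 * h * L := by
  have e : y + h • u - (y - h • u) = (2 * h) • u := by module
  have h1 := hF (y + h • u) (y - h • u)
  have h2 := ellNorm_antitone le_rfl hq u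
  have h2h : (0 : ℝ) < 2 * h := by linarith
  rw [e, ellNorm_smul hq, abs_of_pos h2h] at h1
  rw [hu] at h2
  calc _ ≤ L * (2 * h * ellNorm q u) := h1
    _ ≤ L * (2 * h * 1) := by gcongr
    _ = _ := by ring

/-- The joint distribution of the action, the noise and the random direction of one round. -/
theorem map_prodMk_eq (hXm : Measurable X) (hζm : Measurable ζ) (hξm' : Measurable ξ')
    (hξm'' : Measurable ξ'') (hζQ : P.map ζ = Q)
    (hind : IndepFun (fun ω => (X ω, ξ' ω, ξ'' ω)) ζ P) :
    P.map (fun ω => ((X ω, ξ' ω, ξ'' ω), ζ ω)) =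
      (P.map fun ω => (X ω, ξ' ω, ξ'' ω)).prod Q := by
  rw [← hζQ]
  exact (indepFun_iff_map_prod_eq_prod_map_map (by fun_prop) hζm.aemeasurable).1 hind

theorem IsPolar.integrable_sq_sub_add (hQ : IsPolar C Q) (hq : 1 ≤ q) (hL : 0 < L) (hh : 0 < h)
    (hFm : Continuous F) (hF : ∀ x y, |F x - F y| ≤ L * ellNorm q (x - y))
    (hXm : Measurable X) (hζm : Measurable ζ) (hξm' : Measurable ξ') (hξm'' : Measurable ξ'')
    (hζQ : P.map ζ = Q) (hξ' : Integrable (fun ω => ξ' ω ^ 2) P)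
    (hξ'' : Integrable (fun ω => ξ'' ω ^ 2) P) :
    Integrable (fun ω =>
      ((F (X ω + h • ζ ω) - F (X ω - h • ζ ω)) + (ξ' ω - ξ'' ω)) ^ 2) P := by
  have hζn : ∀ᵐ ω ∂P, ellNorm 1 (ζ ω) = 1 :=
    ae_of_ae_map hζm.aemeasurable (hζQ ▸ hQ.ae_norm)
  have hFm' := hFm.measurable
  refine (((integrable_const ((2 * h * L) ^ 2)).add (hξ'.add hξ'')).const_mul 3).mono'
    (by fun_prop) (hζn.mono fun ω hω => ?_)
  have h1 := abs_sub_le_of_ellNorm_one hq hL hh hF (X ω) hω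
  have h2 : (F (X ω + h • ζ ω) - F (X ω - h • ζ ω)) ^ 2 ≤ (2 * h * L) ^ 2 := by
    rw [← sq_abs]
    gcongr
  rw [Real.norm_of_nonneg (by positivity)]
  simp only [Pi.add_apply]
  nlinarith [sq_nonneg ((F (X ω + h • ζ ω) - F (X ω - h • ζ ω)) - ξ' ω),
    sq_nonneg ((F (X ω + h • ζ ω) - F (X ω - h • ζ ω)) + ξ'' ω), sq_nonneg (ξ' ω + ξ'' ω)]

/-- By independence the action may be frozen while averaging over the direction, so the sphere
estimate applies. The noise is split off by `(a + b) ^ 2 ≤ 2 a ^ 2 + 2 b ^ 2`, which needs no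
relation between noise and action. -/
theorem IsPolar.integral_ellNorm_gradEstimate_sq_le (hQ : IsPolar C Q) (hd : 0 < d) (hq : 1 ≤ q)
    {p : ℝ≥0∞} (hp : 1 ≤ p) (hL : 0 < L) (hh : 0 < h)
    (hF : ∀ x y, |F x - F y| ≤ L * ellNorm q (x - y))
    (hXm : Measurable X) (hζm : Measurable ζ) (hξm' : Measurable ξ') (hξm'' : Measurable ξ'')
    (hζQ : P.map ζ = Q) (hind : IndepFun (fun ω => (X ω, ξ' ω, ξ'' ω)) ζ P) {σ : ℝ}
    (hξ' : Integrable (fun ω => ξ' ω ^ 2) P ∧ ∫ ω, ξ' ω ^ 2 ∂P ≤ σ ^ 2)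
    (hξ'' : Integrable (fun ω => ξ'' ω ^ 2) P ∧ ∫ ω, ξ'' ω ^ 2 ∂P ≤ σ ^ 2) :
    Integrable (fun ω => ellNorm p.conjExponent
      (gradEstimate F h (X ω) (ζ ω) (ξ' ω) (ξ'' ω)) ^ 2) P ∧
    ∫ ω, ellNorm p.conjExponent (gradEstimate F h (X ω) (ζ ω) (ξ' ω) (ξ'' ω)) ^ 2 ∂P ≤
      24 * L ^ 2 * (d : ℝ) ^ (1 + 2 * (1 / min q 2).toReal - 2 * (1 / p).toReal) +
        2 * σ ^ 2 * (d : ℝ) ^ (4 - 2 * (1 / p).toReal) / h ^ 2 := by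
  have hd' : (0 : ℝ) < d := by exact_mod_cast hd
  have hFm := (lipschitz_of_ellNorm hd hq hL hF).continuous
  have := hQ.prob
  have hint := hQ.integrable_sq_sub_add hq hL hh hFm hF hXm hζm hξm' hξm'' hζQ hξ'.1 hξ''.1
  simp only [ellNorm_gradEstimate_sq hd hp]
  refine ⟨hint.const_mul _, ?_⟩
  rw [integral_const_mul]
  have hζn : ∀ᵐ ω ∂P, ellNorm 1 (ζ ω) = 1 :=
    ae_of_ae_map hζm.aemeasurable (hζQ ▸ hQ.ae_norm)
  have hFm' := hFm.measurable
  have iD : Integrable (fun ω => (F (X ω + h • ζ ω) - F (X ω - h • ζ ω)) ^ 2) P := by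
    refine (integrable_const ((2 * h * L) ^ 2)).mono' (by fun_prop) (hζn.mono fun ω hω => ?_)
    have h1 := abs_sub_le_of_ellNorm_one hq hL hh hF (X ω) hω
    rw [Real.norm_of_nonneg (by positivity), ← sq_abs]
    gcongr
  have hD : ∫ ω, (F (X ω + h • ζ ω) - F (X ω - h • ζ ω)) ^ 2 ∂P ≤
      48 * h ^ 2 * L ^ 2 * (d : ℝ) ^ (2 * (1 / min q 2).toReal - 3) := by
    have hmap := map_prodMk_eq hXm hζm hξm' hξm'' hζQ hind
    have hprob := Measure.isProbabilityMeasure_map (μ := P)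
      (f := fun ω => (X ω, ξ' ω, ξ'' ω)) (by fun_prop)
    set Φ : (Vec d × ℝ × ℝ) × Vec d → ℝ := fun z =>
      (F (z.1.1 + h • z.2) - F (z.1.1 - h • z.2)) ^ 2 with hΦ
    have hΦm : Measurable Φ := by fun_prop
    have hm : Measurable fun ω => ((X ω, ξ' ω, ξ'' ω), ζ ω) := by fun_prop
    have e1 : ∫ ω, (F (X ω + h • ζ ω) - F (X ω - h • ζ ω)) ^ 2 ∂P =
        ∫ z, Φ z ∂((P.map fun ω => (X ω, ξ' ω, ξ'' ω)).prod Q) := by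
      rw [← hmap, integral_map hm.aemeasurable hΦm.aestronglyMeasurable]
    have iΦ : Integrable Φ ((P.map fun ω => (X ω, ξ' ω, ξ'' ω)).prod Q) := by
      rw [← hmap, integrable_map_measure hΦm.aestronglyMeasurable hm.aemeasurable]
      exact iD
    rw [e1, integral_prod _ iΦ]
    have := integral_mono iΦ.integral_prod_left (integrable_const
      (48 * h ^ 2 * L ^ 2 * (d : ℝ) ^ (2 * (1 / min q 2).toReal - 3)))
      fun z => hQ.integral_sq_sub_le (h := h) hd hq hL hF z.1
    simpa using this
  have hle : ∫ ω, ((F (X ω + h • ζ ω) - F (X ω - h • ζ ω)) + (ξ' ω - ξ'' ω)) ^ 2 ∂P ≤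
      2 * (48 * h ^ 2 * L ^ 2 * (d : ℝ) ^ (2 * (1 / min q 2).toReal - 3)) + 8 * σ ^ 2 := by
    have iR : Integrable (fun ω => 2 * (F (X ω + h • ζ ω) - F (X ω - h • ζ ω)) ^ 2 +
        (4 * ξ' ω ^ 2 + 4 * ξ'' ω ^ 2)) P :=
      (iD.const_mul 2).add ((hξ'.1.const_mul 4).add (hξ''.1.const_mul 4))
    refine (integral_mono hint iR fun ω => ?_).trans ?_
    · simp only
      nlinarith [sq_nonneg ((F (X ω + h • ζ ω) - F (X ω - h • ζ ω)) - (ξ' ω - ξ'' ω)),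
        sq_nonneg (ξ' ω + ξ'' ω)]
    · have i4 : Integrable (fun ω => 4 * ξ' ω ^ 2 + 4 * ξ'' ω ^ 2) P :=
        (hξ'.1.const_mul 4).add (hξ''.1.const_mul 4)
      rw [integral_add (iD.const_mul 2) i4,
        integral_add (hξ'.1.const_mul 4) (hξ''.1.const_mul 4), integral_const_mul,
        integral_const_mul, integral_const_mul]
      linarith [hξ'.2, hξ''.2]
  refine (mul_le_mul_of_nonneg_left hle (by positivity)).trans (le_of_eq ?_)
  have p1 : (d : ℝ) ^ (1 + 2 * (1 / min q 2).toReal - 2 * (1 / p).toReal) =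
      (d : ℝ) ^ (2 - 2 * (1 / p).toReal) * ((d : ℝ) ^ (2 * (1 / min q 2).toReal - 3) *
        (d : ℝ) ^ (2 : ℝ)) := by
    rw [← Real.rpow_add hd', ← Real.rpow_add hd']
    congr 1
    ring
  have p2 : (d : ℝ) ^ (4 - 2 * (1 / p).toReal) =
      (d : ℝ) ^ (2 - 2 * (1 / p).toReal) * (d : ℝ) ^ (2 : ℝ) := by
    rw [← Real.rpow_add hd']
    congr 1
    ring
  rw [p1, p2, Real.rpow_two]
  field_simp
  ring

theorem IsPolar.integral_sub_le (hQ : IsPolar C Q) (hd : 3 ≤ d) (hq : 1 ≤ q) (hL : 0 < L)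
    (hh : 0 < h) (hFc : ConvexOn ℝ Set.univ F)
    (hF : ∀ x y, |F x - F y| ≤ L * ellNorm q (x - y))
    (hXm : Measurable X) (hζm : Measurable ζ) (hξm' : Measurable ξ') (hξm'' : Measurable ξ'')
    (hζQ : P.map ζ = Q) (hind : IndepFun (fun ω => (X ω, ξ' ω, ξ'' ω)) ζ P)
    (hξ' : Integrable (fun ω => ξ' ω ^ 2) P) (hξ'' : Integrable (fun ω => ξ'' ω ^ 2) P)
    {x : Vec d} {M : ℝ} (hM : ∀ ω, ‖X ω - x‖ ≤ M) :
    Integrable (fun ω => F (X ω) - F x) P ∧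
    Integrable (fun ω =>
      inner ℝ (gradEstimate F h (X ω) (ζ ω) (ξ' ω) (ξ'' ω)) (X ω - x)) P ∧
    ∫ ω, (F (X ω) - F x) ∂P ≤ L * h * bq q d +
      ∫ ω, inner ℝ (gradEstimate F h (X ω) (ζ ω) (ξ' ω) (ξ'' ω)) (X ω - x) ∂P := by
  have hd0 : 0 < d := by omega
  have hlip := lipschitz_of_ellNorm hd0 hq hL hF
  have hFm := hlip.continuous
  have hFm' := hFm.measurable
  have := hQ.prob
  have hsm := measurable_signVec (d := d)
  have i1 : Integrable (fun ω => F (X ω) - F x) P := by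
    refine (integrable_const (L * (d : ℝ) ^ ((1 / min q 2).toReal - 1 / 2) * M)).mono'
      (by fun_prop) (Filter.Eventually.of_forall fun ω => ?_)
    have := hlip.dist_le_mul (X ω) x
    rw [Real.coe_toNNReal _ (by positivity), dist_eq_norm, dist_eq_norm] at this
    refine this.trans ?_
    gcongr
    exact hM ω
  have i2 : Integrable (fun ω =>
      inner ℝ (gradEstimate F h (X ω) (ζ ω) (ξ' ω) (ξ'' ω)) (X ω - x)) P := by
    have hsq := hQ.integrable_sq_sub_add hq hL hh hFm hF hXm hζm hξm' hξm'' hζQ hξ' hξ''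
    have hmlp : MemLp (fun ω => (F (X ω + h • ζ ω) - F (X ω - h • ζ ω)) + (ξ' ω - ξ'' ω)) 2 P :=
      (memLp_two_iff_integrable_sq (by fun_prop)).2 hsq
    have hb := (hmlp.integrable (by norm_num)).const_mul ((d : ℝ) / (2 * h))
    have hbdd := Integrable.mul_bdd (c := √d * M) hb
      ((hsm.comp hζm).inner (hXm.sub_const x)).aestronglyMeasurable
      (Filter.Eventually.of_forall fun ω => (abs_inner_signVec_le (ζ ω) (X ω - x)).trans (by
        gcongr
        exact hM ω))
    refine hbdd.congr (Filter.Eventually.of_forall fun ω => ?_)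
    simp only [inner_gradEstimate, Function.comp_apply]
    ring
  refine ⟨i1, i2, ?_⟩
  have hmap := map_prodMk_eq hXm hζm hξm' hξm'' hζQ hind
  have hZ : Measurable fun ω => (X ω, ξ' ω, ξ'' ω) := by fun_prop
  have hprob := Measure.isProbabilityMeasure_map (μ := P) hZ.aemeasurable
  set Ψ : (Vec d × ℝ × ℝ) × Vec d → ℝ := fun z =>
    inner ℝ (gradEstimate F h z.1.1 z.2 z.1.2.1 z.1.2.2) (z.1.1 - x) with hΨ
  have hΨm : Measurable Ψ := by
    simp only [hΨ, inner_gradEstimate]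
    have : Measurable fun z : (Vec d × ℝ × ℝ) × Vec d => inner ℝ (signVec z.2) (z.1.1 - x) :=
      (hsm.comp measurable_snd).inner (by fun_prop)
    fun_prop
  have hm : Measurable fun ω => ((X ω, ξ' ω, ξ'' ω), ζ ω) := by fun_prop
  have e1 : ∫ ω, inner ℝ (gradEstimate F h (X ω) (ζ ω) (ξ' ω) (ξ'' ω)) (X ω - x) ∂P =
      ∫ z, Ψ z ∂((P.map fun ω => (X ω, ξ' ω, ξ'' ω)).prod Q) := by
    rw [← hmap, integral_map hm.aemeasurable hΨm.aestronglyMeasurable]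
  have iΨ : Integrable Ψ ((P.map fun ω => (X ω, ξ' ω, ξ'' ω)).prod Q) := by
    rw [← hmap, integrable_map_measure hΨm.aestronglyMeasurable hm.aemeasurable]
    exact i2
  have hinner : ∀ z : Vec d × ℝ × ℝ, F z.1 - F x - L * h * bq q d ≤ ∫ u, Ψ (z, u) ∂Q := by
    intro z
    have h1 := hQ.sub_le_integral_inner hd hq hL hh hFc hF x z.1
    have j1 : Integrable (fun u => (d : ℝ) / (2 * h) * (F (z.1 + h • u) - F (z.1 - h • u)) *
        inner ℝ (signVec u) (z.1 - x)) Q :=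
      hQ.integrable_mul_inner_signVec
        (F := fun u => (d : ℝ) / (2 * h) * (F (z.1 + h • u) - F (z.1 - h • u))) (by fun_prop) _
    have j2 : Integrable (fun u => (d : ℝ) / (2 * h) * (z.2.1 - z.2.2) *
        inner ℝ (signVec u) (z.1 - x)) Q :=
      hQ.integrable_mul_inner_signVec (F := fun _ => (d : ℝ) / (2 * h) * (z.2.1 - z.2.2))
        (by fun_prop) _
    simp only [hΨ, inner_gradEstimate]
    -- With the noise frozen, its contribution is a multiple of the mean of the sign vector, which
    -- vanishes.
    rw [integral_add j1 j2, integral_const_mul _ (fun u => inner ℝ (signVec u) (z.1 - x)),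
      hQ.integral_inner_signVec hd0]
    linarith
  have iL : Integrable (fun z : Vec d × ℝ × ℝ => F z.1 - F x - L * h * bq q d)
      (P.map fun ω => (X ω, ξ' ω, ξ'' ω)) := by
    rw [integrable_map_measure (by fun_prop) hZ.aemeasurable]
    exact i1.sub (integrable_const _)
  have h2 := integral_mono iL iΨ.integral_prod_left hinner
  rw [← integral_prod _ iΨ, ← e1, integral_map hZ.aemeasurable (by fun_prop)] at h2
  simp only at h2
  rw [integral_sub i1 (integrable_const _)] at h2
  simp only [integral_const, probReal_univ, one_smul] at h2
  linarith

end OneRound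

/-! ### Measurability and non-anticipation of the algorithm. -/

section Measurability

variable {d : ℕ} {p : ℝ≥0∞} {R : ℝ} {h : ℕ → ℝ} {Θ : Set (Vec d)} {V : Vec d → ℝ}
  {f : ℕ → Vec d → ℝ}

theorem measurable_stepSize (R : ℝ) (t : ℕ) : Measurable (stepSize R t) := by
  unfold stepSize
  split_ifs
  · exact measurable_const
  · refine measurable_const.mul (Measurable.ite (measurableSet_singleton 0) measurable_const ?_)
    fun_prop

theorem measurable_gradEstimate {Ω : Type*} [MeasurableSpace Ω] {F : Vec d → ℝ} {s : ℝ}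
    (hF : Measurable F) {x u : Ω → Vec d} {a b : Ω → ℝ} (hx : Measurable x) (hu : Measurable u)
    (ha : Measurable a) (hb : Measurable b) :
    Measurable fun ω => gradEstimate F s (x ω) (u ω) (a ω) (b ω) := by
  have hs := measurable_signVec (d := d)
  unfold gradEstimate
  fun_prop

theorem measurable_argmaxPoint (hm : Measurable (argmaxPoint Θ V 1)) {Ω : Type*}
    [MeasurableSpace Ω] {η : Ω → ℝ} {z : Ω → Vec d} (hη : Measurable η) (hz : Measurable z) :
    Measurable fun ω => argmaxPoint Θ V (η ω) (z ω) := by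
  simp only [argmaxPoint_eq (η _)]
  exact hm.comp (hη.smul hz)

theorem measurable_state (hm : Measurable (argmaxPoint Θ V 1)) (hf : ∀ t, Measurable (f t))
    {Ω : Type*} [MeasurableSpace Ω] {ζ : ℕ → Ω → Vec d} {ξ' ξ'' : ℕ → Ω → ℝ}
    (hζ : ∀ t, Measurable (ζ t)) (hξ' : ∀ t, Measurable (ξ' t)) (hξ'' : ∀ t, Measurable (ξ'' t))
    (t : ℕ) : Measurable fun ω => state p R h Θ V f (fun k => ζ k ω) (fun k => ξ' k ω)
      (fun k => ξ'' k ω) t := by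
  induction t with
  | zero => exact measurable_const
  | succ t ih =>
    have hg := measurable_gradEstimate (s := h t) (hf t) (measurable_argmaxPoint hm
      ((measurable_stepSize R t).comp ih.snd) ih.fst) (hζ t) (hξ' t) (hξ'' t)
    exact (ih.fst.sub hg).prodMk (ih.snd.add
      (((continuous_ellNorm (one_le_conjExponent p)).measurable.comp hg).pow_const 2))

theorem measurable_action (hm : Measurable (argmaxPoint Θ V 1)) (hf : ∀ t, Measurable (f t))
    {Ω : Type*} [MeasurableSpace Ω] {ζ : ℕ → Ω → Vec d} {ξ' ξ'' : ℕ → Ω → ℝ}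
    (hζ : ∀ t, Measurable (ζ t)) (hξ' : ∀ t, Measurable (ξ' t)) (hξ'' : ∀ t, Measurable (ξ'' t))
    (t : ℕ) : Measurable fun ω => action p R h Θ V f (fun k => ζ k ω) (fun k => ξ' k ω)
      (fun k => ξ'' k ω) t := by
  have hs := measurable_state (p := p) (R := R) (h := h) hm hf hζ hξ' hξ'' t
  exact measurable_argmaxPoint hm ((measurable_stepSize R t).comp hs.snd) hs.fst

theorem state_congr {ζ ζ' : ℕ → Vec d} {ξ' ξ'' : ℕ → ℝ} {t : ℕ} (hζ : ∀ k < t, ζ k = ζ' k) :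
    state p R h Θ V f ζ ξ' ξ'' t = state p R h Θ V f ζ' ξ' ξ'' t := by
  induction t with
  | zero => rfl
  | succ t ih =>
    simp only [state, ih fun k hk => hζ k (by omega), hζ t (by omega)]

theorem action_congr {ζ ζ' : ℕ → Vec d} {ξ' ξ'' : ℕ → ℝ} {t : ℕ} (hζ : ∀ k < t, ζ k = ζ' k) :
    action p R h Θ V f ζ ξ' ξ'' t = action p R h Θ V f ζ' ξ' ξ'' t := by
  simp only [action, state_congr hζ]

end Measurability

/-! ### Independence of the current direction from the past. -/

section Independence

variable {Ω : Type*} [MeasurableSpace Ω] {P : Measure Ω} [IsProbabilityMeasure P]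

/-- Both hypotheses together make the joint law a triple product, which is then reassociated. -/
theorem indepFun_prodMk_left {α β γ : Type*} [MeasurableSpace α] [MeasurableSpace β]
    [MeasurableSpace γ] {W : Ω → α} {A : Ω → β} {B : Ω → γ} (hW : Measurable W)
    (hA : Measurable A) (hB : Measurable B) (h : IndepFun W (fun ω => (A ω, B ω)) P)
    (hAB : IndepFun A B P) : IndepFun (fun ω => (W ω, A ω)) B P := by
  have := Measure.isProbabilityMeasure_map (μ := P) hW.aemeasurable
  have := Measure.isProbabilityMeasure_map (μ := P) hA.aemeasurable
  have := Measure.isProbabilityMeasure_map (μ := P) hB.aemeasurable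
  have hWA : IndepFun W A P := h.comp measurable_id measurable_fst
  rw [indepFun_iff_map_prod_eq_prod_map_map (by fun_prop) (by fun_prop)] at h hAB hWA ⊢
  rw [hWA, ← MeasurableEquiv.prodAssoc.map_measurableEquiv_injective.eq_iff,
    Measure.prodAssoc_prod, ← hAB, ← h, Measure.map_map (by fun_prop) (by fun_prop)]
  rfl

variable {d : ℕ} {p : ℝ≥0∞} {R : ℝ} {h : ℕ → ℝ} {Θ : Set (Vec d)} {V : Vec d → ℝ}
  {f : ℕ → Vec d → ℝ} {ζ : ℕ → Ω → Vec d} {ξ' ξ'' : ℕ → Ω → ℝ}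

/-- The extension by zero of a finite sequence of vectors. -/
def extendZero (t k : ℕ) (a : Finset.range t → Vec d) : Vec d :=
  if hk : k ∈ Finset.range t then a ⟨k, hk⟩ else 0

theorem measurable_extendZero (t k : ℕ) : Measurable (extendZero (d := d) t k) := by
  unfold extendZero
  split_ifs
  · exact measurable_pi_apply _
  · exact measurable_const

/-- The random direction of a round is independent of the action and the noise in that round. -/
theorem indepFun_action (hm : Measurable (argmaxPoint Θ V 1)) (hf : ∀ t, Measurable (f t))
    (hζ : ∀ t, Measurable (ζ t)) (hξ' : ∀ t, Measurable (ξ' t)) (hξ'' : ∀ t, Measurable (ξ'' t))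
    (hζi : iIndepFun ζ P)
    (hξζ : IndepFun (fun ω (t : ℕ) => (ξ' t ω, ξ'' t ω)) (fun ω (t : ℕ) => ζ t ω) P) (t : ℕ) :
    IndepFun (fun ω => (action p R h Θ V f (fun k => ζ k ω) (fun k => ξ' k ω)
      (fun k => ξ'' k ω) t, ξ' t ω, ξ'' t ω)) (ζ t) P := by
  have hAB : IndepFun (fun ω (k : Finset.range t) => ζ k ω) (ζ t) P :=
    (hζi.indepFun_finset (Finset.range t) {t} (by simp) hζ).comp measurable_id
      (measurable_pi_apply (⟨t, by simp⟩ : ({t} : Finset ℕ)))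
  have hW : Measurable fun ω (t : ℕ) => (ξ' t ω, ξ'' t ω) := by fun_prop
  have hA : Measurable fun ω (k : Finset.range t) => ζ k ω := by fun_prop
  have hψ : Measurable fun z : ℕ → Vec d => ((fun k : Finset.range t => z k), z t) := by
    fun_prop
  have key : IndepFun (fun ω => ((fun t : ℕ => (ξ' t ω, ξ'' t ω)),
      fun k : Finset.range t => ζ k ω)) (ζ t) P :=
    indepFun_prodMk_left hW hA (hζ t) (hξζ.comp measurable_id hψ) hAB
  have m1 : ∀ k, Measurable fun z : (ℕ → ℝ × ℝ) × (Finset.range t → Vec d) =>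
      extendZero t k z.2 := fun k => (measurable_extendZero t k).comp measurable_snd
  have m2 : ∀ k, Measurable fun z : (ℕ → ℝ × ℝ) × (Finset.range t → Vec d) => z.1 k :=
    fun k => (measurable_pi_apply k).comp measurable_fst
  have m3 := measurable_action (p := p) (R := R) (h := h) hm hf m1
    (fun k => (m2 k).fst) (fun k => (m2 k).snd) t
  have hΦ := m3.prodMk (m2 t)
  -- The action depends only on earlier directions, so the algorithm may be rerun on these padded by
  -- zeros. This exhibits the action as a measurable function of the whole noise sequence and the
  -- past directions.
  have e : (fun ω => (action p R h Θ V f (fun k => ζ k ω) (fun k => ξ' k ω)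
      (fun k => ξ'' k ω) t, ξ' t ω, ξ'' t ω)) =
      (fun z : (ℕ → ℝ × ℝ) × (Finset.range t → Vec d) =>
        (action p R h Θ V f (fun k => extendZero t k z.2) (fun k => (z.1 k).1)
          (fun k => (z.1 k).2) t, (z.1 t).1, (z.1 t).2)) ∘
      fun ω => ((fun t : ℕ => (ξ' t ω, ξ'' t ω)), fun k : Finset.range t => ζ k ω) := by
    funext ω
    refine Prod.ext ?_ rfl
    exact action_congr fun k hk => by simp [extendZero, hk]
  rw [e]
  exact key.comp hΦ measurable_id

end Independence

/-! ### Summation over the rounds and numerical constants. -/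

theorem sum_rpow_neg_quarter_le (T : ℕ) :
    ∑ t ∈ Finset.range T, ((t : ℝ) + 1) ^ (-(1 / 4) : ℝ) ≤ 4 / 3 * (T : ℝ) ^ (3 / 4 : ℝ) := by
  induction T with
  | zero => simp
  | succ n ih =>
    rw [Finset.sum_range_succ]
    have hm : (0 : ℝ) < (n : ℝ) + 1 := by positivity
    have h1 : ((n : ℝ) + 1) ^ (3 / 4 : ℝ) = ((n : ℝ) + 1) ^ (-(1 / 4) : ℝ) * ((n : ℝ) + 1) := by
      rw [← Real.rpow_add_one hm.ne']
      norm_num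
    -- Bernoulli's inequality for the concave power `3 / 4`; the sum then telescopes.
    have h2 : (n : ℝ) ^ (3 / 4 : ℝ) ≤
        ((n : ℝ) + 1) ^ (3 / 4 : ℝ) * (1 + 3 / 4 * -(1 / ((n : ℝ) + 1))) := by
      have hle : 1 / ((n : ℝ) + 1) ≤ 1 := by
        rw [div_le_one hm]
        linarith [n.cast_nonneg (α := ℝ)]
      have e : (n : ℝ) = ((n : ℝ) + 1) * (1 + -(1 / ((n : ℝ) + 1))) := by
        field_simp
        ring
      conv_lhs => rw [e]
      rw [Real.mul_rpow hm.le (by linarith)]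
      gcongr
      exact rpow_one_add_le_one_add_mul_self (by linarith) (by norm_num) (by norm_num)
    have h3 : ((n : ℝ) + 1) ^ (3 / 4 : ℝ) * (1 / ((n : ℝ) + 1)) =
        ((n : ℝ) + 1) ^ (-(1 / 4) : ℝ) := by
      rw [h1]
      field_simp
    push_cast
    linarith

theorem bq_pos {q : ℝ≥0∞} {d : ℕ} (hd : 3 ≤ d) (hq : 1 ≤ q) : 0 < bq q d := by
  have hd' : (3 : ℝ) ≤ d := by exact_mod_cast hd
  unfold bq
  split_ifs with h
  · have : 0 < q.toReal := ENNReal.toReal_pos (by positivity) h.ne_top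
    positivity
  · have : 0 < Real.log d := Real.log_pos (by linarith)
    positivity

/-- The only loss is `d / (d + 1) ≤ 1`. -/
theorem sqrt_bq_mul_le {p q : ℝ≥0∞} {d : ℕ} (hd : 3 ≤ d) :
    √(bq q d) * (d : ℝ) ^ (1 - (1 / p).toReal / 2) ≤
      if q < ENNReal.ofReal (Real.log d) then
        √(q.toReal * (d : ℝ) ^ (1 + (1 / q).toReal - (1 / p).toReal))
      else √(Real.exp 1 * Real.log d * (d : ℝ) ^ (1 - (1 / p).toReal)) := by
  have hd' : (3 : ℝ) ≤ d := by exact_mod_cast hd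
  have hd0 : (0 : ℝ) < d := by linarith
  have hlog : 0 < Real.log d := Real.log_pos (by linarith)
  have key : ∀ c : ℝ, 0 ≤ c → √(1 / ((d : ℝ) + 1) * c) * (d : ℝ) ^ (1 - (1 / p).toReal / 2) ≤
      √(c * (d : ℝ) ^ (1 - (1 / p).toReal)) := by
    intro c hc
    have e : (d : ℝ) ^ (1 - (1 / p).toReal / 2) = √((d : ℝ) ^ (1 - (1 / p).toReal) * d) := by
      rw [← Real.rpow_add_one hd0.ne', Real.sqrt_eq_rpow, ← Real.rpow_mul hd0.le]
      congr 1
      ring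
    rw [e, ← Real.sqrt_mul (by positivity)]
    refine Real.sqrt_le_sqrt ?_
    have : 1 / ((d : ℝ) + 1) * d ≤ 1 := by
      rw [one_div_mul_eq_div, div_le_one (by positivity)]
      linarith
    calc 1 / ((d : ℝ) + 1) * c * ((d : ℝ) ^ (1 - (1 / p).toReal) * d) =
        c * (d : ℝ) ^ (1 - (1 / p).toReal) * (1 / ((d : ℝ) + 1) * d) := by ring
      _ ≤ c * (d : ℝ) ^ (1 - (1 / p).toReal) * 1 := by gcongr
      _ = _ := by ring
  unfold bq
  split_ifs with h
  · refine (key _ (by positivity)).trans (le_of_eq ?_)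
    rw [mul_assoc, ← Real.rpow_add hd0]
    congr 3
    ring
  · exact key _ (by positivity)

/-- The regret bound for the discretization parameter of the algorithm, with explicit constants. -/
theorem regret_constants_le {R L σ b D A : ℝ} (hR : 0 < R) (hL : 0 < L) (hσ : 0 ≤ σ) (hb : 0 < b)
    (hD : 0 < D) (hA : 0 ≤ A) {h : ℕ → ℝ}
    (hh : ∀ t : ℕ, h t = √(6.65 * √6 * (R / b)) * ((t : ℝ) + 1) ^ (-(1 / 4) : ℝ) * D) (T : ℕ) :
    ∑ t ∈ Finset.range T, L * h t * b +
      6 * R * √(∑ t ∈ Finset.range T, (24 * L ^ 2 * A + 2 * σ ^ 2 * D ^ 4 / h t ^ 2)) ≤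
    110.6 * R * L * √(T * A) + 5.9 * √R * (σ + L) * (T : ℝ) ^ (3 / 4 : ℝ) * (√b * D) := by
  have hs6 : √6 ≤ 2.45 := Real.sqrt_le_iff.2 (by norm_num)
  have hs6' : 2.449 ≤ √6 := Real.le_sqrt_of_sq_le (by norm_num)
  set c := √(6.65 * √6) with hc
  -- The upper bound serves the bias, where `4.04 * (4 / 3) ≤ 5.9`; the lower bound serves the
  -- noise, where `2 / c ^ 2 ≤ 1 / 4`.
  have hc1 : c ≤ 4.04 := Real.sqrt_le_iff.2 ⟨by norm_num, by linarith⟩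
  have hc2 : 4 ≤ c := Real.le_sqrt_of_sq_le (by linarith)
  have hr : 0 < √R := Real.sqrt_pos.2 hR
  have hrb : 0 < √b := Real.sqrt_pos.2 hb
  have hκ : √(6.65 * √6 * (R / b)) = c * (√R / √b) := by
    rw [Real.sqrt_mul (by positivity), Real.sqrt_div hR.le]
  have er : √R * √R = R := Real.mul_self_sqrt hR.le
  have eb : √b * √b = b := Real.mul_self_sqrt hb.le
  have hT : (0 : ℝ) ≤ (T : ℝ) ^ (3 / 4 : ℝ) := by positivity
  have bias : ∑ t ∈ Finset.range T, L * h t * b ≤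
      5.9 * √R * L * (T : ℝ) ^ (3 / 4 : ℝ) * (√b * D) := by
    have e : ∀ t, L * h t * b = L * c * √R * √b * D * ((t : ℝ) + 1) ^ (-(1 / 4) : ℝ) := by
      intro t
      rw [hh, hκ]
      nth_rw 2 [← eb]
      field_simp
    simp only [e, ← Finset.mul_sum]
    calc _ ≤ L * c * √R * √b * D * (4 / 3 * (T : ℝ) ^ (3 / 4 : ℝ)) := by
          gcongr
          exact sum_rpow_neg_quarter_le T
      _ = (c * (4 / 3)) * (√R * L * (T : ℝ) ^ (3 / 4 : ℝ) * (√b * D)) := by ring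
      _ ≤ 5.9 * (√R * L * (T : ℝ) ^ (3 / 4 : ℝ) * (√b * D)) := by
          gcongr
          linarith
      _ = _ := by ring
  have noise : ∑ t ∈ Finset.range T, (24 * L ^ 2 * A + 2 * σ ^ 2 * D ^ 4 / h t ^ 2) ≤
      (5 * L * √(T * A)) ^ 2 + (0.5 * σ * D * (T : ℝ) ^ (3 / 4 : ℝ) * √b / √R) ^ 2 := by
    have h1 : ∀ t ∈ Finset.range T, 24 * L ^ 2 * A + 2 * σ ^ 2 * D ^ 4 / h t ^ 2 ≤
        24 * L ^ 2 * A + 1 / 4 * σ ^ 2 * D ^ 2 * b / R * (T : ℝ) ^ (1 / 2 : ℝ) := by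
      intro t ht
      have ht' : (t : ℝ) + 1 ≤ T := by exact_mod_cast Finset.mem_range.1 ht
      have hpos : (0 : ℝ) < (t : ℝ) + 1 := by positivity
      have e1 : (((t : ℝ) + 1) ^ (-(1 / 4) : ℝ)) ^ 2 = (((t : ℝ) + 1) ^ (1 / 2 : ℝ))⁻¹ := by
        rw [← Real.rpow_natCast, ← Real.rpow_mul hpos.le, ← Real.rpow_neg hpos.le]
        norm_num
      have e2 : h t ^ 2 = c ^ 2 * (R / b) * (((t : ℝ) + 1) ^ (1 / 2 : ℝ))⁻¹ * D ^ 2 := by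
        rw [hh, hκ, mul_pow, mul_pow, mul_pow, div_pow, Real.sq_sqrt hR.le, Real.sq_sqrt hb.le, e1]
      have hc3 : 16 ≤ c ^ 2 := by nlinarith
      rw [e2]
      gcongr
      calc 2 * σ ^ 2 * D ^ 4 / (c ^ 2 * (R / b) * (((t : ℝ) + 1) ^ (1 / 2 : ℝ))⁻¹ * D ^ 2) =
          2 / c ^ 2 * σ ^ 2 * D ^ 2 * b / R * ((t : ℝ) + 1) ^ (1 / 2 : ℝ) := by
            field_simp
        _ ≤ 1 / 4 * σ ^ 2 * D ^ 2 * b / R * (T : ℝ) ^ (1 / 2 : ℝ) := by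
            gcongr ?_ * _ * _ * _ / _ * ?_
            · rw [div_le_iff₀ (by positivity)]
              linarith
            · gcongr
    refine (Finset.sum_le_sum h1).trans ?_
    have e3 : ((T : ℝ) ^ (3 / 4 : ℝ)) ^ 2 = T * (T : ℝ) ^ (1 / 2 : ℝ) := by
      rcases Nat.eq_zero_or_pos T with rfl | h0
      · simp
      · have h0' : (0 : ℝ) < T := by exact_mod_cast h0
        rw [← Real.rpow_natCast, ← Real.rpow_mul h0'.le, mul_comm (T : ℝ),
          ← Real.rpow_add_one h0'.ne']
        norm_num
    rw [Finset.sum_const, Finset.card_range, nsmul_eq_mul, div_pow, mul_pow, mul_pow _ √b, mul_pow,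
      mul_pow, mul_pow, mul_pow, Real.sq_sqrt (by positivity), Real.sq_sqrt hb.le,
      Real.sq_sqrt hR.le, e3]
    have : 0 ≤ L ^ 2 * (T * A) := by positivity
    ring_nf at this ⊢
    linarith
  -- Here `5 ^ 2 ≥ 24` covers the loss part. After multiplication by `6 * R` the constants are `30`
  -- and `3`, well within the claimed ones.
  have hsq : √(∑ t ∈ Finset.range T, (24 * L ^ 2 * A + 2 * σ ^ 2 * D ^ 4 / h t ^ 2)) ≤
      5 * L * √(T * A) + 0.5 * σ * D * (T : ℝ) ^ (3 / 4 : ℝ) * √b / √R := by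
    refine Real.sqrt_le_iff.2 ⟨by positivity, noise.trans ?_⟩
    have h1 : 0 ≤ 5 * L * √(T * A) := by positivity
    have h2 : 0 ≤ 0.5 * σ * D * (T : ℝ) ^ (3 / 4 : ℝ) * √b / √R := by positivity
    nlinarith [mul_nonneg h1 h2]
  have hmul := mul_le_mul_of_nonneg_left hsq (by positivity : 0 ≤ 6 * R)
  have e4 : 6 * R * (5 * L * √(T * A) + 0.5 * σ * D * (T : ℝ) ^ (3 / 4 : ℝ) * √b / √R) =
      30 * (R * L * √(T * A)) + 3 * (√R * σ * (T : ℝ) ^ (3 / 4 : ℝ) * (√b * D)) := by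
    have e5 : R * (0.5 * σ * D * (T : ℝ) ^ (3 / 4 : ℝ) * √b / √R) =
        R / √R * (0.5 * σ * D * (T : ℝ) ^ (3 / 4 : ℝ) * √b) := by ring
    rw [mul_assoc, mul_add, e5, Real.div_sqrt]
    ring
  have n1 : 0 ≤ R * L * √(T * A) := by positivity
  have n2 : 0 ≤ √R * σ * (T : ℝ) ^ (3 / 4 : ℝ) * (√b * D) := by positivity
  rw [e4] at hmul
  linarith

end ZeroOrder

end

/-! ### Assembly of the regret bound. -/

theorem theorem4 {Ω : Type*} [MeasurableSpace Ω] (P : Measure Ω) [IsProbabilityMeasure P]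
    (d : ℕ) (hd : 3 ≤ d) (p q : ℝ≥0∞) (hp : 1 ≤ p) (hq : 1 ≤ q)
    (R L σ : ℝ) (hR : 0 < R) (hL : 0 < L) (hσ : 0 ≤ σ)
    -- the feasible set and the regularizer
    (Θ : Set (ZeroOrder.Vec d)) (hΘ : IsCompact Θ) (hΘc : Convex ℝ Θ)
    (V : ZeroOrder.Vec d → ℝ) (hVlsc : LowerSemicontinuousOn V Θ)
    (hV : ZeroOrder.IsStronglyConvex p Θ V)
    (hVR : ∀ x ∈ Θ, ∀ y ∈ Θ, V x - V y ≤ R ^ 2)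
    -- the loss functions
    (f : ℕ → ZeroOrder.Vec d → ℝ) (hf : ∀ t, ConvexOn ℝ Set.univ (f t))
    (hfL : ∀ t x y, |f t x - f t y| ≤ L * ZeroOrder.ellNorm q (x - y))
    -- the random directions
    (ζ : ℕ → Ω → ZeroOrder.Vec d) (hζm : ∀ t, Measurable (ζ t))
    (hζ : ∀ t, pdf.IsUniform (ζ t) (ZeroOrder.l1Sphere d) P (ZeroOrder.surfaceMeasure d))
    (hζi : iIndepFun ζ P)
    -- the adversarial noise
    (ξ' ξ'' : ℕ → Ω → ℝ) (hξm' : ∀ t, Measurable (ξ' t)) (hξm'' : ∀ t, Measurable (ξ'' t))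
    (hξ' : ∀ t, Integrable (fun ω => ξ' t ω ^ 2) P ∧ ∫ ω, ξ' t ω ^ 2 ∂P ≤ σ ^ 2)
    (hξ'' : ∀ t, Integrable (fun ω => ξ'' t ω ^ 2) P ∧ ∫ ω, ξ'' t ω ^ 2 ∂P ≤ σ ^ 2)
    (hξζ : IndepFun (fun ω (t : ℕ) => (ξ' t ω, ξ'' t ω)) (fun ω (t : ℕ) => ζ t ω) P)
    -- the actions of the algorithm
    (X : ℕ → Ω → ZeroOrder.Vec d)
    (hX : ∀ t ω, X t ω = ZeroOrder.action p R (ZeroOrder.discretization p q d R) Θ V f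
      (fun k => ζ k ω) (fun k => ξ' k ω) (fun k => ξ'' k ω) t)
    (T : ℕ) (x : ZeroOrder.Vec d) (hx : x ∈ Θ) :
    Integrable (fun ω => ∑ t ∈ Finset.range T, (f t (X t ω) - f t x)) P ∧
    ∫ ω, ∑ t ∈ Finset.range T, (f t (X t ω) - f t x) ∂P ≤
      110.6 * R * L * √((T : ℝ) * (d : ℝ) ^ (1 + (2 / min q 2).toReal - (2 / p).toReal)) +
      5.9 * √R * (σ + L) * (T : ℝ) ^ (3 / 4 : ℝ) *
        (if q < ENNReal.ofReal (Real.log d) then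
          √(q.toReal * (d : ℝ) ^ (1 + (1 / q).toReal - (1 / p).toReal))
        else √(Real.exp 1 * Real.log d * (d : ℝ) ^ (1 - (1 / p).toReal))) := by
  have hd0 : 0 < d := by omega
  have hd' : (0 : ℝ) < d := by exact_mod_cast hd0
  obtain rfl : X = fun t ω => ZeroOrder.action p R (ZeroOrder.discretization p q d R) Θ V f
      (fun k => ζ k ω) (fun k => ξ' k ω) (fun k => ξ'' k ω) t := funext₂ hX
  set X : ℕ → Ω → ZeroOrder.Vec d := fun t ω => ZeroOrder.action p R
    (ZeroOrder.discretization p q d R) Θ V f (fun k => ζ k ω) (fun k => ξ' k ω)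
    (fun k => ξ'' k ω) t with hXdef
  clear hX
  have hne : Θ.Nonempty := ⟨x, hx⟩
  have hm := (ZeroOrder.continuous_argmaxPoint hΘ hne hVlsc hp hV).measurable
  have hfm : ∀ t, Measurable (f t) := fun t =>
    (ZeroOrder.lipschitz_of_ellNorm hd0 hq hL (hfL t)).continuous.measurable
  have hXm : ∀ t, Measurable (X t) := fun t =>
    ZeroOrder.measurable_action hm hfm hζm hξm' hξm'' t
  have hind : ∀ t, IndepFun (fun ω => (X t ω, ξ' t ω, ξ'' t ω)) (ζ t) P := fun t =>
    ZeroOrder.indepFun_action hm hfm hζm hξm' hξm'' hζi hξζ t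
  -- The normalized surface measure is the law of `ζ 0`, hence a probability measure.
  have hQ : IsProbabilityMeasure (ProbabilityTheory.cond (ZeroOrder.surfaceMeasure d)
      (ZeroOrder.l1Sphere d)) :=
    hζ 0 ▸ Measure.isProbabilityMeasure_map (hζm 0).aemeasurable
  obtain ⟨C, hC⟩ := ZeroOrder.exists_isPolar_cond hd0 hQ
  have hb := ZeroOrder.bq_pos hd hq
  set b := ZeroOrder.bq q d with hbdef
  set h := ZeroOrder.discretization p q d R with hh
  have hh0 : ∀ t, 0 < h t := fun t => by
    simp only [hh, ZeroOrder.discretization]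
    positivity
  have hXΘ : ∀ t ω, X t ω ∈ Θ := fun t ω => (ZeroOrder.argmaxPoint_spec hΘ hne hVlsc _ _).1
  obtain ⟨M, hM⟩ := hΘ.isBounded.exists_norm_le
  have hMX : ∀ t ω, ‖X t ω - x‖ ≤ M + M := fun t ω =>
    (norm_sub_le _ _).trans (add_le_add (hM _ (hXΘ t ω)) (hM _ hx))
  have round := fun t => hC.integral_sub_le hd hq hL (hh0 t) (hf t) (hfL t) (hXm t) (hζm t)
    (hξm' t) (hξm'' t) (hζ t) (hind t) (hξ' t).1 (hξ'' t).1 (hMX t)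
  have moment := fun t => hC.integral_ellNorm_gradEstimate_sq_le hd0 hq hp hL (hh0 t) (hfL t)
    (hXm t) (hζm t) (hξm' t) (hξm'' t) (hζ t) (hind t) (hξ' t) (hξ'' t)
  set g : ℕ → Ω → ZeroOrder.Vec d := fun t ω =>
    ZeroOrder.gradEstimate (f t) (h t) (X t ω) (ζ t ω) (ξ' t ω) (ξ'' t ω) with hg
  have hgrad : ∀ ω t, ZeroOrder.gradient p R h Θ V f (fun k => ζ k ω) (fun k => ξ' k ω)
      (fun k => ξ'' k ω) t = g t ω := fun _ _ => rfl
  have pathwise : ∀ ω, ∑ t ∈ Finset.range T, inner ℝ (g t ω) (X t ω - x) ≤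
      6 * R * √(∑ t ∈ Finset.range T, ZeroOrder.ellNorm p.conjExponent (g t ω) ^ 2) := by
    intro ω
    refine ZeroOrder.ftrl_regret_le hΘ hVlsc hp hV hR hVR (fun t => g t ω) (fun t => X t ω)
      (fun t => ?_) T hx
    have h1 : ∀ t, (ZeroOrder.state p R h Θ V f (fun k => ζ k ω) (fun k => ξ' k ω)
        (fun k => ξ'' k ω) t).1 = -∑ k ∈ Finset.range t, g k ω := by
      intro t
      induction t with
      | zero => simp [ZeroOrder.state]
      | succ t ih =>
        rw [ZeroOrder.state_succ_fst, ih, hgrad, Finset.sum_range_succ]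
        abel
    simp only [hXdef, ZeroOrder.action]
    rw [h1, ZeroOrder.state_snd]
    simp only [hgrad]
  have iF : Integrable (fun ω => ∑ t ∈ Finset.range T, (f t (X t ω) - f t x)) P :=
    integrable_finsetSum _ fun t _ => (round t).1
  have iS : Integrable (fun ω => ∑ t ∈ Finset.range T,
      ZeroOrder.ellNorm p.conjExponent (g t ω) ^ 2) P :=
    integrable_finsetSum _ fun t _ => (moment t).1
  have hS0 : ∀ ω, 0 ≤ ∑ t ∈ Finset.range T, ZeroOrder.ellNorm p.conjExponent (g t ω) ^ 2 :=
    fun ω => Finset.sum_nonneg fun _ _ => sq_nonneg _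
  have mS : MemLp (fun ω => √(∑ t ∈ Finset.range T,
      ZeroOrder.ellNorm p.conjExponent (g t ω) ^ 2)) 2 P := by
    refine (memLp_two_iff_integrable_sq iS.1.aemeasurable.sqrt.aestronglyMeasurable).2 ?_
    simpa only [Real.sq_sqrt (hS0 _)] using iS
  refine ⟨iF, ?_⟩
  set A := (d : ℝ) ^ (1 + 2 * (1 / min q 2).toReal - 2 * (1 / p).toReal) with hA
  set D := (d : ℝ) ^ (1 - (1 / p).toReal / 2) with hD
  have hD0 : 0 < D := by positivity
  have hD4 : (d : ℝ) ^ (4 - 2 * (1 / p).toReal) = D ^ 4 := by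
    rw [hD, ← Real.rpow_natCast, ← Real.rpow_mul hd'.le]
    congr 1
    push_cast
    ring
  have hsqrt : ∫ ω, √(∑ t ∈ Finset.range T, ZeroOrder.ellNorm p.conjExponent (g t ω) ^ 2) ∂P ≤
      √(∑ t ∈ Finset.range T, (24 * L ^ 2 * A + 2 * σ ^ 2 * D ^ 4 / h t ^ 2)) := by
    -- Jensen's inequality: the squared mean of the square root is at most the mean of the sum,
    -- which is bounded round by round.
    refine Real.le_sqrt_of_sq_le ((ZeroOrder.sq_integral_le_integral_sq mS).trans ?_)
    simp only [Real.sq_sqrt (hS0 _)]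
    rw [integral_finsetSum _ fun t _ => (moment t).1]
    exact Finset.sum_le_sum fun t _ => hD4 ▸ (moment t).2
  have regret : ∫ ω, ∑ t ∈ Finset.range T, (f t (X t ω) - f t x) ∂P ≤
      ∑ t ∈ Finset.range T, L * h t * b +
        6 * R * √(∑ t ∈ Finset.range T, (24 * L ^ 2 * A + 2 * σ ^ 2 * D ^ 4 / h t ^ 2)) := by
    rw [integral_finsetSum _ fun t _ => (round t).1]
    calc _ ≤ ∑ t ∈ Finset.range T, (L * h t * b + ∫ ω, inner ℝ (g t ω) (X t ω - x) ∂P) :=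
          Finset.sum_le_sum fun t _ => (round t).2.2
      _ = ∑ t ∈ Finset.range T, L * h t * b +
          ∫ ω, ∑ t ∈ Finset.range T, inner ℝ (g t ω) (X t ω - x) ∂P := by
        rw [Finset.sum_add_distrib, integral_finsetSum _ fun t _ => (round t).2.1]
      _ ≤ ∑ t ∈ Finset.range T, L * h t * b + ∫ ω, 6 * R *
          √(∑ t ∈ Finset.range T, ZeroOrder.ellNorm p.conjExponent (g t ω) ^ 2) ∂P := by
        exact add_le_add le_rfl (integral_mono (integrable_finsetSum _ fun t _ => (round t).2.1)
          ((mS.integrable (by norm_num)).const_mul _) pathwise)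
      _ ≤ _ := by
        rw [integral_const_mul]
        gcongr
  have hhD : ∀ t : ℕ, h t = √(6.65 * √6 * (R / b)) * ((t : ℝ) + 1) ^ (-(1 / 4) : ℝ) * D := by
    intro t
    simp only [hh, ZeroOrder.discretization, hD, hbdef]
    congr 3
    rw [one_div, one_div, ENNReal.toReal_inv, ENNReal.toReal_inv, ENNReal.toReal_mul, mul_inv]
    simp only [ENNReal.toReal_ofNat]
    ring
  have hA' : (d : ℝ) ^ (1 + (2 / min q 2).toReal - (2 / p).toReal) = A := by
    rw [hA]
    simp only [ENNReal.toReal_div, ENNReal.toReal_ofNat, ENNReal.toReal_one]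
    congr 1
    ring
  rw [hA']
  refine regret.trans ((ZeroOrder.regret_constants_le hR hL hσ hb hD0 (by positivity) hhD T).trans
    (add_le_add le_rfl ?_))
  exact mul_le_mul_of_nonneg_left (ZeroOrder.sqrt_bq_mul_le hd) (by positivity)
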